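/- Let $n\ge 2$, $s\in(0,1)$ and $a=1-2s\in(-1,1)$. Write points of $\mathbb R^{n+1}$ as $(x,y)$ with $x\in\mathbb R^n$, $y\in\mathbb R$, and $|(x,y)|=(|x|^2+y^2)^{1/2}$. Let $$h(x,y)=\frac{\nu_{n+1+a}}{(|x|^2+y^2)^{\frac{n-1+a}{2}}},\qquad \nu_k=\frac{\pi^{k/2}\,\Gamma\!\left(\frac{k-1}{2}\right)}{4}.$$ Let $W^{1,2}(\mathbb R^{n+1}_+,y^a)$ be the closure of $C_c^\infty(\{y\ge 0\})$ in the norm $\big(\int_{y>0}y^a(|u|^2+|\nabla u|^2)\,dx\,dy\big)^{1/2}$. For $A\subset\mathbb R^n$ let $$\mathrm{cap}_s(A)=\inf\Big\{\int_{y>0}y^a|\nabla u|^2\,dx\,dy\;;\;u\in W^{1,2}(\mathbb R^{n+1}_+,y^a),\ u(x,0)\ge 1\ \text{for all }x\in A\Big\},$$ where $u(x,0)$ is the limit as $r\to0$ of the averages of $u$, with respect to $y^a\,dx\,dy$, over the half balls $\{|(\cdot)-(x,0)|<r,\ y>0\}$. A function $\varphi$ is called an $s$-capacitary potential of $A$ if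 it attains this infimum, the minimizer being taken in the closure of the admissible set with respect to convergence of gradients in $L^2(y^a\,dx\,dy)$ and of functions in $L^2(y^a\,dx\,dy)$ on bounded sets. There is a constant $\mu_{n,a}>0$ with $\mathrm{div}(|y|^a\nabla h)=-\mu_{n,a}\,\delta_{0}$ in the sense of distributions on $\mathbb R^{n+1}$, and the following holds. For all $M>0$ and $\delta>0$ there is $R_\delta>0$, depending only on $n$, $a$, $M$, $\delta$, such that the following is true. Let $(\Omega,\mathcal F,P)$ be a probability space and let $S_\varepsilon(k,\omega)\subset\mathbb R^n$ ($\varepsilon>0$, $k\in\mathbb Z^n$, $\omega\in\Omega$) be sets for which there are numbers $\gamma(k,\omega)\in[0,\infty)$, independent of $\varepsilon$, with $$\mathrm{cap}_s(S_\varepsilon(k,\omega))=\varepsilon^n\gamma(k,\omega)\quad\text{for all }\varepsilon>0,\ k\in\mathbb Z^n,\ \omega\in\Omega,$$ and, for almost every $\omega$, $$S_\varepsilon(k,\omega)\subset\{x\in\mathbb R^n:\ |x-\varepsilon k|\le M\varepsilon^{\frac{n}{n-1+a}}\}\quad\text{for all }\varepsilon>0,\ k\in\mathbb Z^n.$$ Then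 for almost every $\omega$, for all $\varepsilon>0$ and $k\in\mathbb Z^n$, every $s$-capacitary potential $\varphi^\varepsilon_k(\cdot,\cdot,\omega)$ of $S_\varepsilon(k,\omega)$ has a representative that is continuous on the set of all $(x,y)$ with $y\ge 0$ and $|(x-\varepsilon k,y)|\ge R_\delta\,\varepsilon^{\frac{n}{n-1+a}}$ and satisfies, at every point $(x,y)$ of that set, $$\Big|\varphi^\varepsilon_k(x,y,\omega)-\varepsilon^n\gamma(k,\omega)\frac{2}{\mu_{n,a}}h(x-\varepsilon k,y)\Big|\le\delta\,\varepsilon^n\gamma(k,\omega)\frac{2}{\mu_{n,a}}h(x-\varepsilon k,y).$$ -/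

import Mathlib

open MeasureTheory Filter Topology Set
open scoped ENNReal NNReal

noncomputable section

namespace FracCap

/-- The space `ℝⁿ⁺¹ = ℝⁿ × ℝ` with points `(x, y)`. As a type, the product carries the sup norm;
all metric notions below go through `euclNorm` and `euclDot` instead. -/
abbrev Pt (n : ℕ) : Type := EuclideanSpace ℝ (Fin n) × ℝ

/-- The Euclidean norm `|(x, y)| = (|x|² + y²)^{1/2}`. -/
def euclNorm {n : ℕ} (z : Pt n) : ℝ := Real.sqrt (‖z.1‖ ^ 2 + z.2 ^ 2)

/-- The Euclidean inner product on `ℝⁿ × ℝ`. -/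
def euclDot {n : ℕ} (z w : Pt n) : ℝ := inner ℝ z.1 w.1 + z.2 * w.2

/-- The Euclidean gradient `∇f = (∇ₓ f, ∂_y f)`. -/
def euclGrad {n : ℕ} (f : Pt n → ℝ) (z : Pt n) : Pt n :=
  (gradient (fun x => f (x, z.2)) z.1, deriv (fun y => f (z.1, y)) z.2)

/-- The open Euclidean ball of radius `r` in `ℝⁿ⁺¹`. -/
def euclBall {n : ℕ} (c : Pt n) (r : ℝ) : Set (Pt n) := {z | euclNorm (z - c) < r}

/-- The measure `y^a dx dy` on the half space `{y > 0}`. -/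
def halfMeasure (n : ℕ) (a : ℝ) : Measure (Pt n) :=
  (volume.restrict {z : Pt n | 0 < z.2}).withDensity (fun z => ENNReal.ofReal (z.2 ^ a))

/-- `C_c^∞(ℝⁿ⁺¹)`; its restrictions to `{y ≥ 0}` are the smooth functions with compact support
in the closed half space (they need not vanish on `{y = 0}`). -/
def IsTest {n : ℕ} (ψ : Pt n → ℝ) : Prop := ContDiff ℝ ((⊤ : ℕ∞) : WithTop ℕ∞) ψ ∧ HasCompactSupport ψ

/-- `u` lies in the weighted Sobolev space `W^{1,2} = W_0^{1,2}` of the closed half space with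
weight `y^a` and has gradient `g`: the pair `(u, g)` is a limit of `(ψ_j, ∇ψ_j)` in
`L²(y^a dx dy)`, with `ψ_j` smooth and compactly supported in the closed half space.
(For `-1 < a < 1` the weight is of Muckenhoupt class `A₂`, and this is the same space as the one
given by weak derivatives.) -/
def IsSobolev {n : ℕ} (a : ℝ) (u : Pt n → ℝ) (g : Pt n → Pt n) : Prop :=
  MemLp u 2 (halfMeasure n a) ∧ MemLp g 2 (halfMeasure n a) ∧
  ∃ ψ : ℕ → Pt n → ℝ, (∀ j, IsTest (ψ j)) ∧
    Tendsto (fun j => eLpNorm (fun z => ψ j z - u z) 2 (halfMeasure n a)) atTop (𝓝 0) ∧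
    Tendsto (fun j => eLpNorm (fun z => euclGrad (ψ j) z - g z) 2 (halfMeasure n a)) atTop (𝓝 0)

/-- The Dirichlet energy `∫_{y > 0} y^a |g|² dx dy` of a function with gradient `g`. -/
def energy {n : ℕ} (a : ℝ) (g : Pt n → Pt n) : ℝ≥0∞ :=
  ∫⁻ z, ENNReal.ofReal (euclNorm (g z) ^ 2) ∂(halfMeasure n a)

/-- `u(x, 0) = t`: the value at the boundary point `(x, 0)` of the precise representative of `u`,
i.e. the limit of the averages of `u` over the half balls centred at `(x, 0)`. -/
def HasTraceValue {n : ℕ} (a : ℝ) (u : Pt n → ℝ) (x : EuclideanSpace ℝ (Fin n)) (t : ℝ) : Prop :=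
  Tendsto (fun r : ℝ => ⨍ z in euclBall ((x, 0) : Pt n) r, u z ∂(halfMeasure n a))
    (𝓝[>] 0) (𝓝 t)

/-- The admissible functions of the capacity problem: `u ∈ W^{1,2}` with `u(x, 0) ≥ 1` for all
`x ∈ A`. -/
def IsAdmissible {n : ℕ} (a : ℝ) (A : Set (EuclideanSpace ℝ (Fin n)))
    (u : Pt n → ℝ) (g : Pt n → Pt n) : Prop :=
  IsSobolev a u g ∧ ∀ x ∈ A, ∃ t : ℝ, 1 ≤ t ∧ HasTraceValue a u x t

/-- The `s`-capacity of `A ⊆ ℝⁿ`, where `s = (1 - a) / 2`. -/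
def sCap {n : ℕ} (a : ℝ) (A : Set (EuclideanSpace ℝ (Fin n))) : ℝ≥0∞ :=
  ⨅ (u : Pt n → ℝ) (g : Pt n → Pt n) (_ : IsAdmissible a A u g), energy a g

/-- `φ` (with gradient `g`) lies in the closure of the admissible functions for the energy norm:
gradients converge in `L²(y^a dx dy)` and functions in `L²(y^a dx dy)` on bounded sets. -/
def IsInEnergyClosure {n : ℕ} (a : ℝ) (A : Set (EuclideanSpace ℝ (Fin n)))
    (φ : Pt n → ℝ) (g : Pt n → Pt n) : Prop :=
  AEStronglyMeasurable φ (halfMeasure n a) ∧ MemLp g 2 (halfMeasure n a) ∧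
  ∃ (u : ℕ → Pt n → ℝ) (v : ℕ → Pt n → Pt n), (∀ j, IsAdmissible a A (u j) (v j)) ∧
    Tendsto (fun j => eLpNorm (fun z => v j z - g z) 2 (halfMeasure n a)) atTop (𝓝 0) ∧
    ∀ r : ℝ, Tendsto (fun j => eLpNorm (fun z => u j z - φ z) 2
      ((halfMeasure n a).restrict (euclBall 0 r))) atTop (𝓝 0)

/-- The `s`-capacitary potential of `A`: the function that attains the infimum of the capacity
problem. The minimiser is sought in the closure of the admissible set for the energy norm, because
it decays like `|(x, y)|^{-(n-1+a)}` and so is not in `L²(y^a dx dy)` when `n + a ≤ 3`. -/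
def IsCapacitaryPotential {n : ℕ} (a : ℝ) (A : Set (EuclideanSpace ℝ (Fin n)))
    (φ : Pt n → ℝ) : Prop :=
  ∃ g : Pt n → Pt n, IsInEnergyClosure a A φ g ∧ energy a g = sCap a A

/-- `ν_k = π^{k/2} Γ((k-1)/2) / 4`. -/
def nuConst (k : ℝ) : ℝ := Real.pi ^ (k / 2) * Real.Gamma ((k - 1) / 2) / 4

/-- `h(x, y) = ν_{n+1+a} / (|x|² + y²)^{(n-1+a)/2}`. -/
def hFun (n : ℕ) (a : ℝ) (z : Pt n) : ℝ :=
  nuConst (n + 1 + a) / (‖z.1‖ ^ 2 + z.2 ^ 2) ^ (((n : ℝ) - 1 + a) / 2)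

/-- `μ` is the constant for which `div(|y|^a ∇h) = -μ δ` in the sense of distributions on
`ℝⁿ⁺¹`, with `δ` the Dirac mass at the origin. -/
def IsFundamentalConst (n : ℕ) (a μ : ℝ) : Prop :=
  ∀ ψ : Pt n → ℝ, IsTest ψ →
    ∫ z : Pt n, |z.2| ^ a * euclDot (euclGrad (hFun n a) z) (euclGrad ψ z) = μ * ψ 0

/-- The lattice point `εk`, `k ∈ ℤⁿ`. -/
def latticePt {n : ℕ} (ε : ℝ) (k : Fin n → ℤ) : EuclideanSpace ℝ (Fin n) :=
  WithLp.toLp 2 (fun i => ε * (k i : ℝ))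

/-- The critical size `a^ε = ε^{n/(n-1+a)} = ε^{n/(n-2s)}`. -/
def critSize (n : ℕ) (a ε : ℝ) : ℝ := ε ^ ((n : ℝ) / ((n : ℝ) - 1 + a))

/-- The points `(x, y)`, `y ≥ 0`, at distance at least `r` from `(c, 0)`. -/
def farRegion {n : ℕ} (c : EuclideanSpace ℝ (Fin n)) (r : ℝ) : Set (Pt n) :=
  {z | 0 ≤ z.2 ∧ r ≤ euclNorm (z - (c, 0))}

end FracCap

end

noncomputable section

namespace FracCap

/-! Write β = `halfDim n a` = (n + 1 + a)/2, which exceeds 1 because n ≥ 2 and a > -1, and k =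
`fundKernel`, the Neumann fundamental solution of div(y^a ∇·) in the half space; then h = (μ/2) k.
The theorem follows from a representation: if A lies in a compact K ⊂ {y = 0}, a capacitary
potential of A equals almost everywhere z ↦ ∫ k(z - x) dm(x), for a measure m on K of total mass
cap(A) (`IsCapacitaryPotential.exists_ae_eq_potential`). Take for K the closed ball of radius M
critical sizes. From a point at least M/τ critical sizes away, all of K is seen at the same distance
up to factors 1 ± τ, so k(z - x) is k(z - c) up to a relative error δ (`abs_fundKernel_sub_le`).
Integrating against m gives the estimate, and the integral is the continuous representative.

The measure m is the first variation of the energy. Adding to an admissible function a positive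
multiple of a test function that is nonnegative on A keeps it admissible, so ψ ↦ ∫ y^a g·∇ψ is a
positive functional depending only on ψ restricted to K. The extension theorem of M. Riesz and the
Riesz–Markov theorem make it a measure (`exists_measure_of_nonneg`). Moving towards and away from a
test function equal to 1 on A shows that its mass is the energy, hence the capacity.

The identification of φ with the potential of m uses neither elliptic regularity nor a maximum
principle. Both are tested against the Gaussians exp(-t|z - (x, 0)|²). Put F(t) = t^β ∫ y^a φ
exp(-t|z - (x, 0)|²). Integration by parts along the dilation field turns F' into a pairing of g
with the gradient of the Gaussian, hence into (1/4) t^(β-2) ∫ exp(-t|x' - x|²) dm(x'). Hardy's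
inequality gives a weighted L² bound on φ, which forces F(0+) = 0, so m determines F
(`IsTestLimit.rpow_mul_integral_gauss`). A Tonelli computation gives the same F for the potential of
m (`integral_potential_mul_gauss`). Since Gaussians centred on {y = 0} are stable under products up
to constants and separate the points of the closed half space, their integrals determine a function
(`ae_eq_zero_of_forall_integral_gauss`).

The same derivative formula for a test function, integrated over all t > 0, yields the equation for
k; even reflection carries it to the whole space and supplies μ. -/

variable {n : ℕ} {a : ℝ}

/-! ### The weighted half-space measure and its Gaussian integrals -/

/-- The measure `y^a dy` on `(0, ∞)`. -/
def powMeasure (a : ℝ) : Measure ℝ :=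
  (volume.restrict (Ioi 0)).withDensity fun y => ENNReal.ofReal (y ^ a)

/-- The squared Euclidean norm on `ℝⁿ × ℝ`. -/
def normSq {n : ℕ} (z : Pt n) : ℝ := ‖z.1‖ ^ 2 + z.2 ^ 2

/-- Half of the effective dimension `n + 1 + a`. -/
def halfDim (n : ℕ) (a : ℝ) : ℝ := ((n : ℝ) + 1 + a) / 2

lemma measurable_powDensity (a : ℝ) : Measurable fun y : ℝ => ENNReal.ofReal (y ^ a) := by
  fun_prop

instance (a : ℝ) : SFinite (powMeasure a) := by unfold powMeasure; infer_instance

/-- The weight depends on `y` alone; this form gives access to Fubini and to one-dimensional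
integrals. -/
lemma halfMeasure_eq_prod (n : ℕ) (a : ℝ) :
    halfMeasure n a = (volume : Measure (EuclideanSpace ℝ (Fin n))).prod (powMeasure a) := by
  unfold halfMeasure powMeasure
  rw [prod_withDensity_right (measurable_powDensity a)]
  congr 1
  rw [Measure.volume_eq_prod, ← Measure.restrict_univ (μ := (volume : Measure (EuclideanSpace ℝ (Fin n)))),
    Measure.prod_restrict, Measure.restrict_univ]
  congr 1
  ext z; simp

lemma integral_powMeasure (a : ℝ) (f : ℝ → ℝ) :
    ∫ y, f y ∂powMeasure a = ∫ y in Ioi 0, y ^ a * f y := by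
  unfold powMeasure
  rw [integral_withDensity_eq_integral_toReal_smul (measurable_powDensity a) (by simp)]
  refine setIntegral_congr_fun measurableSet_Ioi fun y hy => ?_
  simp [ENNReal.toReal_ofReal (Real.rpow_nonneg (le_of_lt hy) a)]

lemma integrable_powMeasure_iff (a : ℝ) (f : ℝ → ℝ) :
    Integrable f (powMeasure a) ↔ IntegrableOn (fun y => y ^ a * f y) (Ioi 0) := by
  unfold powMeasure
  rw [integrable_withDensity_iff_integrable_smul' (measurable_powDensity a) (by simp)]
  refine integrableOn_congr_fun (fun y hy => ?_) measurableSet_Ioi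
  simp [ENNReal.toReal_ofReal (Real.rpow_nonneg (le_of_lt hy) a)]

lemma ae_pos_halfMeasure (n : ℕ) (a : ℝ) : ∀ᵐ z ∂halfMeasure n a, 0 < z.2 := by
  unfold halfMeasure
  exact (withDensity_absolutelyContinuous _ _).ae_le
    (ae_restrict_mem (measurableSet_lt measurable_const measurable_snd))

lemma normSq_nonneg (z : Pt n) : 0 ≤ normSq z := by unfold normSq; positivity

lemma euclNorm_sq (z : Pt n) : euclNorm z ^ 2 = normSq z := by
  exact Real.sq_sqrt (normSq_nonneg z)

lemma euclDot_self (z : Pt n) : euclDot z z = normSq z := by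
  simp [euclDot, normSq, sq]

@[fun_prop]
lemma contDiff_normSq {m : WithTop ℕ∞} : ContDiff ℝ m (normSq : Pt n → ℝ) := by
  unfold normSq
  exact (contDiff_fst.norm_sq ℝ).add (contDiff_snd.pow 2)

@[fun_prop]
lemma continuous_normSq : Continuous (normSq : Pt n → ℝ) := by
  unfold normSq; fun_prop

lemma normSq_sub_mk (z : Pt n) (x : EuclideanSpace ℝ (Fin n)) :
    normSq (z - (x, 0)) = ‖z.1 - x‖ ^ 2 + z.2 ^ 2 := by simp [normSq]

/-- `∫_{y > 0} y^a exp(-|z|²) dz`. -/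
def gaussMass (n : ℕ) (a : ℝ) : ℝ := Real.pi ^ ((n : ℝ) / 2) * (Real.Gamma ((a + 1) / 2) / 2)

lemma gaussMass_pos (ha : -1 < a) : 0 < gaussMass n a := by
  unfold gaussMass
  have := Real.Gamma_pos_of_pos (s := (a + 1) / 2) (by linarith)
  have := Real.pi_pos
  positivity

/-- The Gaussian `exp(-t |z - (x, 0)|²)`. -/
def gauss (t : ℝ) (x : EuclideanSpace ℝ (Fin n)) (z : Pt n) : ℝ :=
  Real.exp (-t * normSq (z - (x, 0)))

lemma gauss_pos (t : ℝ) (x : EuclideanSpace ℝ (Fin n)) (z : Pt n) : 0 < gauss t x z :=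
  Real.exp_pos _

@[fun_prop]
lemma contDiff_gauss {m : WithTop ℕ∞} (t : ℝ) (x : EuclideanSpace ℝ (Fin n)) :
    ContDiff ℝ m (gauss t x) := by
  unfold gauss
  exact Real.contDiff_exp.comp (contDiff_const.mul (contDiff_normSq.comp (by fun_prop)))

@[fun_prop]
lemma continuous_gauss (t : ℝ) (x : EuclideanSpace ℝ (Fin n)) : Continuous (gauss t x) :=
  (contDiff_gauss (m := 0) t x).continuous

lemma gauss_eq_mul (t : ℝ) (x : EuclideanSpace ℝ (Fin n)) (z : Pt n) :
    gauss t x z = Real.exp (-t * ‖z.1 - x‖ ^ 2) * Real.exp (-t * z.2 ^ 2) := by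
  rw [gauss, normSq_sub_mk, ← Real.exp_add]; ring_nf

lemma integral_powMeasure_gauss (ha : -1 < a) {t : ℝ} (ht : 0 < t) :
    Integrable (fun y => Real.exp (-t * y ^ 2)) (powMeasure a) ∧
    ∫ y, Real.exp (-t * y ^ 2) ∂powMeasure a =
      t ^ (-((a + 1) / 2)) * (Real.Gamma ((a + 1) / 2) / 2) := by
  constructor
  · rw [integrable_powMeasure_iff]
    exact integrableOn_rpow_mul_exp_neg_mul_sq ht ha
  · rw [integral_powMeasure]
    have := integral_rpow_mul_exp_neg_mul_rpow (p := 2) (q := a) (b := t) (by norm_num) ha ht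
    simp only [Real.rpow_ofNat] at this
    rw [this, neg_div]; ring

lemma integrable_exp_neg_norm_sq {t : ℝ} (ht : 0 < t) :
    Integrable (fun x : EuclideanSpace ℝ (Fin n) => Real.exp (-t * ‖x‖ ^ 2)) := by
  -- The Bochner integral of a non-integrable function is 0, while the known value is a positive
  -- power of π/t.
  by_contra h
  have h1 := GaussianFourier.integral_rexp_neg_mul_sq_norm (V := EuclideanSpace ℝ (Fin n)) ht
  rw [integral_undef h] at h1
  have : 0 < Real.pi / t := div_pos Real.pi_pos ht
  exact absurd h1 (by positivity)

lemma integrable_gauss (ha : -1 < a) {t : ℝ} (ht : 0 < t) (x : EuclideanSpace ℝ (Fin n)) :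
    Integrable (gauss t x) (halfMeasure n a) := by
  rw [halfMeasure_eq_prod]
  have := (((integrable_exp_neg_norm_sq (n := n) ht).comp_sub_right x)).mul_prod
    (integral_powMeasure_gauss ha ht).1
  exact this.congr (ae_of_all _ fun z => (gauss_eq_mul t x z).symm)

/-- The `x`-integral contributes t^(-n/2) and the weighted `y`-integral t^(-(a+1)/2): the half space
scales like a space of dimension n + 1 + a. -/
lemma integral_gauss (ha : -1 < a) {t : ℝ} (ht : 0 < t) (x : EuclideanSpace ℝ (Fin n)) :
    ∫ z, gauss t x z ∂halfMeasure n a = gaussMass n a * t ^ (-halfDim n a) := by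
  simp_rw [halfMeasure_eq_prod, gauss_eq_mul]
  rw [integral_prod_mul (fun x' => Real.exp (-t * ‖x' - x‖ ^ 2)) (fun y => Real.exp (-t * y ^ 2)),
    integral_sub_right_eq_self (fun x' => Real.exp (-t * ‖x'‖ ^ 2)),
    GaussianFourier.integral_rexp_neg_mul_sq_norm ht, (integral_powMeasure_gauss ha ht).2,
    Real.div_rpow Real.pi_pos.le ht.le, finrank_euclideanSpace, Fintype.card_fin]
  have : halfDim n a = (n : ℝ) / 2 + (a + 1) / 2 := by unfold halfDim; ring
  rw [this, neg_add, Real.rpow_add ht, Real.rpow_neg ht.le ((n : ℝ) / 2), gaussMass]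
  ring

/-- The weight is integrable near 0 because a > -1; `Fact` makes this bound visible to instance
search. -/
instance instIsLocallyFinitePowMeasure [Fact (-1 < a)] : IsLocallyFiniteMeasure (powMeasure a) := by
  refine ⟨fun y => ⟨Iio (y + 1), Iio_mem_nhds (by linarith), ?_⟩⟩
  have h : IntegrableOn (fun y : ℝ => y ^ a) (Ioo 0 (y + 1)) := by
    rcases le_or_gt (y + 1) 0 with h | h
    · simp [Ioo_eq_empty (not_lt.2 h)]
    · exact (intervalIntegral.integrableOn_Ioo_rpow_iff h).2 Fact.out
  unfold powMeasure
  rw [withDensity_apply _ measurableSet_Iio, Measure.restrict_restrict measurableSet_Iio]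
  have : Iio (y + 1) ∩ Ioi 0 = Ioo 0 (y + 1) := by ext; simp [and_comm]
  rw [this]
  exact h.lintegral_lt_top

instance [Fact (-1 < a)] : IsLocallyFiniteMeasure (halfMeasure n a) := by
  rw [halfMeasure_eq_prod]; infer_instance

instance : SFinite (halfMeasure n a) := by
  rw [halfMeasure_eq_prod]; infer_instance

/-! ### Euclidean gradients and test functions -/

/-- `Pt n` carries the sup norm and has no inner product structure, so `euclGrad` is assembled from
partial gradients; this ties it to the Fréchet derivative, where the chain and product rules are
available. -/
lemma euclDot_euclGrad {f : Pt n → ℝ} {z : Pt n} (hf : DifferentiableAt ℝ f z) (w : Pt n) :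
    euclDot (euclGrad f z) w = fderiv ℝ f z w := by
  have h1 : HasFDerivAt (fun x => f (x, z.2))
      ((fderiv ℝ f z).comp (ContinuousLinearMap.inl ℝ _ ℝ)) z.1 :=
    HasFDerivAt.comp (g := f) z.1 hf.hasFDerivAt (hasFDerivAt_prodMk_left z.1 z.2)
  have h2 : HasFDerivAt (fun y => f (z.1, y))
      ((fderiv ℝ f z).comp (ContinuousLinearMap.inr ℝ (EuclideanSpace ℝ (Fin n)) ℝ)) z.2 :=
    HasFDerivAt.comp (g := f) z.2 hf.hasFDerivAt (hasFDerivAt_prodMk_right z.1 z.2)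
  unfold euclDot euclGrad
  rw [gradient, InnerProductSpace.toDual_symm_apply, h1.fderiv, h2.hasDerivAt.deriv]
  simp only [ContinuousLinearMap.comp_apply, ContinuousLinearMap.inl_apply,
    ContinuousLinearMap.inr_apply]
  rw [mul_comm, ← smul_eq_mul, ← map_smul, ← map_add]
  simp

lemma euclGrad_eq {f : Pt n → ℝ} {z : Pt n} (hf : DifferentiableAt ℝ f z) :
    euclGrad f z = ((InnerProductSpace.toDual ℝ _).symm
      ((fderiv ℝ f z).comp (ContinuousLinearMap.inl ℝ _ ℝ)), fderiv ℝ f z (0, 1)) := by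
  have h1 : HasFDerivAt (fun x => f (x, z.2))
      ((fderiv ℝ f z).comp (ContinuousLinearMap.inl ℝ _ ℝ)) z.1 :=
    HasFDerivAt.comp (g := f) z.1 hf.hasFDerivAt (hasFDerivAt_prodMk_left z.1 z.2)
  have h2 : HasFDerivAt (fun y => f (z.1, y))
      ((fderiv ℝ f z).comp (ContinuousLinearMap.inr ℝ (EuclideanSpace ℝ (Fin n)) ℝ)) z.2 :=
    HasFDerivAt.comp (g := f) z.2 hf.hasFDerivAt (hasFDerivAt_prodMk_right z.1 z.2)
  unfold euclGrad
  rw [gradient, h1.fderiv, h2.hasDerivAt.deriv]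
  simp

lemma IsTest.differentiableAt {ψ : Pt n → ℝ} (h : IsTest ψ) (z : Pt n) : DifferentiableAt ℝ ψ z :=
  (h.1.differentiable (by simp)) z

lemma IsTest.continuous {ψ : Pt n → ℝ} (h : IsTest ψ) : Continuous ψ := h.1.continuous

lemma IsTest.continuous_fderiv {ψ : Pt n → ℝ} (h : IsTest ψ) : Continuous (fderiv ℝ ψ) :=
  h.1.continuous_fderiv (by simp)

lemma IsTest.euclGrad_eq {ψ : Pt n → ℝ} (h : IsTest ψ) :
    euclGrad ψ = fun z => ((InnerProductSpace.toDual ℝ _).symm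
      ((fderiv ℝ ψ z).comp (ContinuousLinearMap.inl ℝ _ ℝ)), fderiv ℝ ψ z (0, 1)) :=
  funext fun z => FracCap.euclGrad_eq (h.differentiableAt z)

lemma IsTest.continuous_euclGrad {ψ : Pt n → ℝ} (h : IsTest ψ) : Continuous (euclGrad ψ) := by
  rw [h.euclGrad_eq]
  have := h.continuous_fderiv
  fun_prop

lemma IsTest.hasCompactSupport_euclGrad {ψ : Pt n → ℝ} (h : IsTest ψ) :
    HasCompactSupport (euclGrad ψ) := by
  rw [h.euclGrad_eq]
  refine (h.2.fderiv (𝕜 := ℝ)).mono fun z hz h0 => hz ?_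
  simp [h0]

lemma IsTest.memLp [Fact (-1 < a)] {ψ : Pt n → ℝ} (h : IsTest ψ) :
    MemLp ψ 2 (halfMeasure n a) :=
  h.continuous.memLp_of_hasCompactSupport h.2

lemma IsTest.memLp_euclGrad [Fact (-1 < a)] {ψ : Pt n → ℝ} (h : IsTest ψ) :
    MemLp (euclGrad ψ) 2 (halfMeasure n a) :=
  h.continuous_euclGrad.memLp_of_hasCompactSupport h.hasCompactSupport_euclGrad

lemma IsTest.add {ψ χ : Pt n → ℝ} (h : IsTest ψ) (h' : IsTest χ) : IsTest (fun z => ψ z + χ z) :=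
  ⟨h.1.add h'.1, h.2.add h'.2⟩

lemma IsTest.mul_left {ψ χ : Pt n → ℝ} (h : IsTest ψ) (h' : ContDiff ℝ ((⊤ : ℕ∞) : WithTop ℕ∞) χ) :
    IsTest (fun z => χ z * ψ z) :=
  ⟨h'.mul h.1, h.2.mul_left⟩

lemma IsTest.const_mul {ψ : Pt n → ℝ} (c : ℝ) (h : IsTest ψ) : IsTest (fun z => c * ψ z) :=
  h.mul_left contDiff_const

lemma IsTest.sub {ψ χ : Pt n → ℝ} (h : IsTest ψ) (h' : IsTest χ) : IsTest (fun z => ψ z - χ z) := by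
  simpa [sub_eq_add_neg] using h.add (h'.const_mul (-1))

lemma IsTest.euclGrad_add {ψ χ : Pt n → ℝ} (h : IsTest ψ) (h' : IsTest χ) :
    euclGrad (fun z => ψ z + χ z) = euclGrad ψ + euclGrad χ := by
  rw [(h.add h').euclGrad_eq, h.euclGrad_eq, h'.euclGrad_eq]
  funext z
  have := fderiv_add (h.differentiableAt z) (h'.differentiableAt z)
  rw [show (fun z => ψ z + χ z) = ψ + χ from rfl, this]
  ext <;> simp

lemma IsTest.euclGrad_const_mul {ψ : Pt n → ℝ} (c : ℝ) (h : IsTest ψ) :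
    euclGrad (fun z => c * ψ z) = c • euclGrad ψ := by
  rw [(h.const_mul c).euclGrad_eq, h.euclGrad_eq]
  funext z
  have := fderiv_const_mul (h.differentiableAt z) c
  rw [this]
  ext <;> simp

lemma IsTest.euclGrad_sub {ψ χ : Pt n → ℝ} (h : IsTest ψ) (h' : IsTest χ) :
    euclGrad (fun z => ψ z - χ z) = euclGrad ψ - euclGrad χ := by
  have := h.euclGrad_add (h'.const_mul (-1))
  rw [h'.euclGrad_const_mul] at this
  simpa [sub_eq_add_neg] using this

/-! ### Integration by parts for the dilation field -/

/-- The field x - x₀ has divergence n; each coordinate contributes one integration by parts. -/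
lemma integral_fderiv_sub_euclideanSpace {f : EuclideanSpace ℝ (Fin n) → ℝ} (hf : ContDiff ℝ 1 f)
    (hc : HasCompactSupport f) (x₀ : EuclideanSpace ℝ (Fin n)) :
    ∫ x, fderiv ℝ f x (x - x₀) = -(n : ℝ) * ∫ x, f x := by
  have hcd := hf.continuous_fderiv one_ne_zero
  have hcs : HasCompactSupport (fderiv ℝ f) := hc.fderiv ℝ
  have hd : Differentiable ℝ f := hf.differentiable one_ne_zero
  let e : Fin n → EuclideanSpace ℝ (Fin n) := fun i => EuclideanSpace.single i 1
  have hexp : ∀ x, fderiv ℝ f x (x - x₀) = ∑ i, (x i - x₀ i) * fderiv ℝ f x (e i) := by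
    intro x
    have : x - x₀ = ∑ i, (x i - x₀ i) • e i := by
      ext j; simp [e, Finset.sum_apply, Pi.single_apply]
    conv_lhs => rw [this]
    simp
  have hderiv : ∀ i x, fderiv ℝ (fun x : EuclideanSpace ℝ (Fin n) => x i - x₀ i) x (e i) = 1 := by
    intro i x
    have : HasFDerivAt (fun x : EuclideanSpace ℝ (Fin n) => x i - x₀ i)
      (EuclideanSpace.proj i : EuclideanSpace ℝ (Fin n) →L[ℝ] ℝ) x :=
      (EuclideanSpace.proj i : EuclideanSpace ℝ (Fin n) →L[ℝ] ℝ).hasFDerivAt.sub_const _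
    rw [this.fderiv]; simp [e]
  have hint : ∀ i, Integrable (fun x => (x i - x₀ i) * fderiv ℝ f x (e i)) := by
    intro i
    refine Continuous.integrable_of_hasCompactSupport (by fun_prop) ?_
    exact hcs.mono fun x hx h0 => hx (by simp [h0])
  have hfi : Integrable f := hf.continuous.integrable_of_hasCompactSupport hc
  simp_rw [hexp]
  rw [integral_finsetSum _ fun i _ => hint i]
  have hi : ∀ i, ∫ x, (x i - x₀ i) * fderiv ℝ f x (e i) = -∫ x, f x := by
    intro i
    rw [integral_mul_fderiv_eq_neg_fderiv_mul_of_integrable (f := fun x => x i - x₀ i) (g := f)]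
    · simp [hderiv]
    · simpa [hderiv] using hfi
    · exact hint i
    · refine Continuous.integrable_of_hasCompactSupport (by fun_prop) ?_
      exact hc.mul_left
    · intro x _
      fun_prop
    · exact fun x _ => hd x
  simp [hi]

/-- The derivative of y^(a+1) g(y) is integrated over (0, ∞). The boundary term vanishes at 0
because a + 1 > 0 and at infinity by compact support. -/
lemma integral_mul_deriv_powMeasure [h : Fact (-1 < a)] {g : ℝ → ℝ} (hg : ContDiff ℝ 1 g)
    (hc : HasCompactSupport g) :
    ∫ y, y * deriv g y ∂powMeasure a = -(a + 1) * ∫ y, g y ∂powMeasure a := by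
  have ha : -1 < a := h.out
  have hcd := hg.continuous_deriv le_rfl
  have hi1 : Integrable g (powMeasure a) := hg.continuous.integrable_of_hasCompactSupport hc
  have hi2 : Integrable (fun y => y * deriv g y) (powMeasure a) :=
    Continuous.integrable_of_hasCompactSupport (by fun_prop) (HasCompactSupport.deriv hc).mul_left
  rw [integral_powMeasure, integral_powMeasure]
  rw [integrable_powMeasure_iff] at hi1 hi2
  have key : ∫ y in Ioi (0 : ℝ), (y ^ a * (y * deriv g y) + (a + 1) * (y ^ a * g y)) = 0 - 0 := by
    have hcont : Continuous fun y : ℝ => y ^ (a + 1) * g y :=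
      (Real.continuous_rpow_const (by linarith)).mul hg.continuous
    have := integral_Ioi_of_hasDerivAt_of_tendsto (a := 0) (m := 0)
      (f := fun y : ℝ => y ^ (a + 1) * g y)
      (f' := fun y => y ^ a * (y * deriv g y) + (a + 1) * (y ^ a * g y))
      hcont.continuousWithinAt ?_ (hi2.add (hi1.const_mul _)) ?_
    · rw [this]; simp [Real.zero_rpow (show a + 1 ≠ 0 by linarith)]
    · intro y hy
      have hy : 0 < y := hy
      convert! (Real.hasDerivAt_rpow_const (p := a + 1) (Or.inl hy.ne')).mul
        (hg.differentiable one_ne_zero y).hasDerivAt using 1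
      rw [add_sub_cancel_right, Real.rpow_add hy, Real.rpow_one]; ring
    · refine tendsto_const_nhds.congr' ?_
      have h0 : ∀ᶠ y in cocompact ℝ, g y = 0 := by
        filter_upwards [hc.compl_mem_cocompact] with y hy
        exact image_eq_zero_of_notMem_tsupport hy
      filter_upwards [atTop_le_cocompact h0] with y hy
      simp [hy]
  rw [integral_add hi2 (hi1.const_mul _), integral_const_mul] at key
  linarith

/-- The dilation field about a boundary point is tangent to {y = 0}, and div(y^a (z - (x₀, 0))) = (n
+ 1 + a) y^a. No boundary term appears although `F` need not vanish on {y = 0}. The Gaussian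
identity and Hardy's inequality are both instances. -/
lemma integral_fderiv_sub_halfMeasure [h : Fact (-1 < a)] {F : Pt n → ℝ} (hF : ContDiff ℝ 1 F)
    (hc : HasCompactSupport F) (x₀ : EuclideanSpace ℝ (Fin n)) :
    ∫ z, fderiv ℝ F z (z - (x₀, 0)) ∂halfMeasure n a =
      -(2 * halfDim n a) * ∫ z, F z ∂halfMeasure n a := by
  have hcd := hF.continuous_fderiv one_ne_zero
  have hcs : HasCompactSupport (fderiv ℝ F) := hc.fderiv ℝ
  have hd : Differentiable ℝ F := hF.differentiable one_ne_zero
  have hi : Integrable F (halfMeasure n a) := hF.continuous.integrable_of_hasCompactSupport hc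
  have hiA : Integrable (fun z => fderiv ℝ F z (z.1 - x₀, 0)) (halfMeasure n a) :=
    Continuous.integrable_of_hasCompactSupport (by fun_prop)
      (hcs.mono fun x hx h0 => hx (by simp [h0]))
  have hiB : Integrable (fun z => z.2 * fderiv ℝ F z (0, 1)) (halfMeasure n a) :=
    Continuous.integrable_of_hasCompactSupport (by fun_prop)
      (hcs.mono fun x hx h0 => hx (by simp [h0]))
  have hsplit : ∀ z : Pt n, fderiv ℝ F z (z - (x₀, 0)) =
      fderiv ℝ F z (z.1 - x₀, 0) + z.2 * fderiv ℝ F z (0, 1) := by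
    intro z
    rw [← smul_eq_mul, ← map_smul, ← map_add]; congr 1
    ext <;> simp
  simp_rw [hsplit]
  rw [integral_add hiA hiB]
  rw [halfMeasure_eq_prod] at hi hiA hiB ⊢
  have hA : ∫ z, fderiv ℝ F z (z.1 - x₀, 0) ∂(volume.prod (powMeasure a)) =
      -(n : ℝ) * ∫ z, F z ∂(volume.prod (powMeasure a)) := by
    rw [integral_prod_symm _ hiA, integral_prod_symm _ hi, ← integral_const_mul]
    refine integral_congr_ae (ae_of_all _ fun y => ?_)
    have hf : ContDiff ℝ 1 fun x => F (x, y) := hF.comp (by fun_prop)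
    have hcf : HasCompactSupport fun x => F (x, y) :=
      hc.comp_isClosedEmbedding
        (Isometry.of_dist_eq fun _ _ => by simp [Prod.dist_eq]).isClosedEmbedding
    beta_reduce
    rw [← integral_fderiv_sub_euclideanSpace hf hcf x₀]
    refine integral_congr_ae (ae_of_all _ fun x => ?_)
    have h1 : HasFDerivAt (fun x => F (x, y))
      ((fderiv ℝ F (x, y)).comp (ContinuousLinearMap.inl ℝ _ ℝ)) x :=
      HasFDerivAt.comp (g := F) x (hd (x, y)).hasFDerivAt (hasFDerivAt_prodMk_left x y)
    simp [h1.fderiv]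
  have hB : ∫ z, z.2 * fderiv ℝ F z (0, 1) ∂(volume.prod (powMeasure a)) =
      -(a + 1) * ∫ z, F z ∂(volume.prod (powMeasure a)) := by
    rw [integral_prod _ hiB, integral_prod _ hi, ← integral_const_mul]
    refine integral_congr_ae (ae_of_all _ fun x => ?_)
    have hf : ContDiff ℝ 1 fun y => F (x, y) := hF.comp (by fun_prop)
    have hcf : HasCompactSupport fun y => F (x, y) :=
      hc.comp_isClosedEmbedding
        (Isometry.of_dist_eq fun _ _ => by simp [Prod.dist_eq]).isClosedEmbedding
    beta_reduce
    rw [← integral_mul_deriv_powMeasure hf hcf]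
    refine integral_congr_ae (ae_of_all _ fun y => ?_)
    have h1 : HasFDerivAt (fun y => F (x, y))
      ((fderiv ℝ F (x, y)).comp (ContinuousLinearMap.inr ℝ _ ℝ)) y :=
      HasFDerivAt.comp (g := F) y (hd (x, y)).hasFDerivAt (hasFDerivAt_prodMk_right x y)
    simp [h1.hasDerivAt.deriv]
  rw [hA, hB]
  unfold halfDim; ring

/-! ### Derivatives of Gaussians and Euclidean geometry of the product -/

lemma fderiv_normSq (z w : Pt n) : fderiv ℝ normSq z w = 2 * euclDot z w := by
  have h1 : HasFDerivAt (fun z : Pt n => ‖z.1‖ ^ 2) _ z := (hasFDerivAt_fst (𝕜 := ℝ)).norm_sq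
  have h2 : HasFDerivAt (fun z : Pt n => z.2 ^ 2) _ z := (hasFDerivAt_snd (𝕜 := ℝ)).pow 2
  have h : HasFDerivAt (normSq : Pt n → ℝ) _ z := h1.add h2
  rw [h.fderiv]
  simp [euclDot]; ring

lemma fderiv_normSq_sub (c z w : Pt n) :
    fderiv ℝ (fun z => normSq (z - c)) z w = 2 * euclDot (z - c) w := by
  rw [fderiv_comp_sub, fderiv_normSq]

lemma differentiable_normSq : Differentiable ℝ (normSq : Pt n → ℝ) :=
  (contDiff_normSq (m := 1)).differentiable one_ne_zero

lemma differentiable_gauss (t : ℝ) (x : EuclideanSpace ℝ (Fin n)) : Differentiable ℝ (gauss t x) :=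
  (contDiff_gauss (m := 1) t x).differentiable one_ne_zero

lemma fderiv_gauss (t : ℝ) (x : EuclideanSpace ℝ (Fin n)) (z w : Pt n) :
    fderiv ℝ (gauss t x) z w = -(2 * t) * gauss t x z * euclDot (z - (x, 0)) w := by
  have hd : DifferentiableAt ℝ (fun z : Pt n => normSq (z - (x, 0))) z :=
    (differentiable_normSq _).comp z (by fun_prop)
  have := ((hd.hasFDerivAt.const_mul (-t)).exp).fderiv
  change fderiv ℝ (fun z => Real.exp (-t * normSq (z - (x, 0)))) z w = _
  rw [this]
  simp only [smul_apply, fderiv_normSq_sub, smul_eq_mul, gauss]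
  ring

lemma abs_euclDot_le (z w : Pt n) : |euclDot z w| ≤ euclNorm z * euclNorm w := by
  have h1 : |inner ℝ z.1 w.1| ≤ ‖z.1‖ * ‖w.1‖ := abs_real_inner_le_norm _ _
  have h2 : |euclDot z w| ≤ ‖z.1‖ * ‖w.1‖ + |z.2| * |w.2| := by
    unfold euclDot
    refine (abs_add_le _ _).trans ?_
    rw [abs_mul]; linarith
  refine h2.trans ?_
  unfold euclNorm
  rw [← Real.sqrt_mul (by positivity)]
  apply Real.le_sqrt_of_sq_le
  rw [← sq_abs z.2, ← sq_abs w.2]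
  nlinarith [sq_nonneg (‖z.1‖ * |w.2| - ‖w.1‖ * |z.2|)]

lemma euclNorm_nonneg (z : Pt n) : 0 ≤ euclNorm z := Real.sqrt_nonneg _

lemma normSq_le (z : Pt n) : normSq z ≤ 2 * ‖z‖ ^ 2 := by
  have h1 : ‖z.1‖ ≤ ‖z‖ := norm_fst_le z
  have h2 : ‖z.2‖ ≤ ‖z‖ := norm_snd_le z
  unfold normSq
  rw [← sq_abs z.2, ← Real.norm_eq_abs]
  have := norm_nonneg z.1
  have := norm_nonneg z.2
  nlinarith

lemma euclNorm_le (z : Pt n) : euclNorm z ≤ 2 * ‖z‖ := by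
  apply Real.sqrt_le_iff.2
  have := normSq_le z
  unfold normSq at this
  constructor
  · positivity
  · nlinarith [sq_nonneg ‖z‖]

lemma norm_le_euclNorm (z : Pt n) : ‖z‖ ≤ euclNorm z := by
  rw [Prod.norm_def]
  refine max_le (Real.le_sqrt_of_sq_le (by nlinarith [sq_nonneg z.2])) (Real.le_sqrt_of_sq_le ?_)
  rw [Real.norm_eq_abs, sq_abs]; nlinarith [sq_nonneg ‖z.1‖]

@[fun_prop]
lemma continuous_euclNorm : Continuous (euclNorm : Pt n → ℝ) := by unfold euclNorm; fun_prop

@[fun_prop]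
lemma Continuous.euclDot {X : Type*} [TopologicalSpace X] {f g : X → Pt n} (hf : Continuous f)
    (hg : Continuous g) : Continuous fun x => euclDot (f x) (g x) := by
  unfold FracCap.euclDot; fun_prop

lemma euclDot_comm (z w : Pt n) : euclDot z w = euclDot w z := by
  unfold euclDot; rw [real_inner_comm]; ring

lemma euclDot_smul_left (c : ℝ) (z w : Pt n) : euclDot (c • z) w = c * euclDot z w := by
  simp [euclDot, inner_smul_left]; ring

lemma euclDot_smul_right (c : ℝ) (z w : Pt n) : euclDot z (c • w) = c * euclDot z w := by
  rw [euclDot_comm, euclDot_smul_left, euclDot_comm]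

lemma euclDot_add_left (z z' w : Pt n) : euclDot (z + z') w = euclDot z w + euclDot z' w := by
  simp [euclDot, inner_add_left]; ring

lemma euclDot_sub_left (z z' w : Pt n) : euclDot (z - z') w = euclDot z w - euclDot z' w := by
  simp [euclDot, inner_sub_left]; ring

lemma euclDot_add_right (z z' w : Pt n) : euclDot w (z + z') = euclDot w z + euclDot w z' := by
  simp [euclDot, inner_add_right]; ring

/-! ### Dilation identities for test functions: Gaussians and Hardy's inequality -/

/-- The equation `div(y^a ∇ u) = y^a (4 t² ρ² - 2 t (n + 1 + a)) u` for the Gaussian, in weak form. -/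
lemma IsTest.integral_gauss_mul_grad [Fact (-1 < a)] {ψ : Pt n → ℝ} (hψ : IsTest ψ) (t : ℝ)
    (x : EuclideanSpace ℝ (Fin n)) :
    ∫ z, gauss t x z * euclDot (euclGrad ψ z) (z - (x, 0)) ∂halfMeasure n a =
      ∫ z, ψ z * (gauss t x z * (2 * t * normSq (z - (x, 0)) - 2 * halfDim n a))
        ∂halfMeasure n a := by
  have hF : IsTest (fun z => gauss t x z * ψ z) := hψ.mul_left (contDiff_gauss t x)
  have h := integral_fderiv_sub_halfMeasure (a := a) (hF.1.of_le (by exact_mod_cast le_top)) hF.2 x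
  have hfd : ∀ z, fderiv ℝ (fun z => gauss t x z * ψ z) z (z - (x, 0)) =
      gauss t x z * euclDot (euclGrad ψ z) (z - (x, 0)) -
        ψ z * (gauss t x z * (2 * t * normSq (z - (x, 0)))) := by
    intro z
    rw [fderiv_fun_mul (differentiable_gauss t x z) (hψ.differentiableAt z)]
    simp only [add_apply, smul_apply, fderiv_gauss,
      smul_eq_mul, euclDot_self, euclDot_euclGrad (hψ.differentiableAt z)]
    ring
  have hg := hψ.continuous_euclGrad
  have hψc := hψ.continuous
  have hi1 : Integrable (fun z => gauss t x z * euclDot (euclGrad ψ z) (z - (x, 0)))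
      (halfMeasure n a) := by
    refine Continuous.integrable_of_hasCompactSupport (by fun_prop) ?_
    exact hψ.hasCompactSupport_euclGrad.mono fun z hz h0 => hz (by simp [h0, euclDot])
  have hi2 : Integrable (fun z => ψ z * (gauss t x z * (2 * t * normSq (z - (x, 0)))))
      (halfMeasure n a) :=
    Continuous.integrable_of_hasCompactSupport (by fun_prop) hψ.2.mul_right
  have hi3 : Integrable (fun z => gauss t x z * ψ z) (halfMeasure n a) :=
    hF.continuous.integrable_of_hasCompactSupport hF.2
  simp_rw [hfd] at h
  rw [integral_sub hi1 hi2] at h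
  have : ∀ z, ψ z * (gauss t x z * (2 * t * normSq (z - (x, 0)) - 2 * halfDim n a)) =
      ψ z * (gauss t x z * (2 * t * normSq (z - (x, 0)))) +
        -(2 * halfDim n a) * (gauss t x z * ψ z) := fun z => by ring
  simp_rw [this]
  rw [integral_add hi2 (hi3.const_mul _), integral_const_mul]
  linarith

/-- Hardy's inequality for test functions. -/
lemma IsTest.hardy [Fact (-1 < a)] (hb : 1 < halfDim n a) {ψ : Pt n → ℝ} (hψ : IsTest ψ) :
    ∫ z, ψ z ^ 2 / (1 + normSq z) ∂halfMeasure n a ≤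
      (1 / (halfDim n a - 1)) ^ 2 * ∫ z, normSq (euclGrad ψ z) ∂halfMeasure n a := by
  have hpos : ∀ z : Pt n, 0 < 1 + normSq z := fun z => by linarith [normSq_nonneg z]
  have hwd : ContDiff ℝ ((⊤ : ℕ∞) : WithTop ℕ∞) (fun z : Pt n => (1 + normSq z)⁻¹) :=
    (contDiff_const.add contDiff_normSq).inv fun z => (hpos z).ne'
  have hwc : Continuous (fun z : Pt n => (1 + normSq z)⁻¹) := hwd.continuous
  have hF : IsTest (fun z => (ψ z * (1 + normSq z)⁻¹) * ψ z) := hψ.mul_left (hψ.1.mul hwd)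
  have h := integral_fderiv_sub_halfMeasure (a := a) (hF.1.of_le (by exact_mod_cast le_top)) hF.2 0
  have hg := hψ.continuous_euclGrad
  have hψc := hψ.continuous
  have hfd : ∀ z, fderiv ℝ (fun z => (ψ z * (1 + normSq z)⁻¹) * ψ z) z (z - (0, 0)) =
      2 * ψ z * (1 + normSq z)⁻¹ * euclDot (euclGrad ψ z) z -
        2 * ψ z ^ 2 * normSq z * (1 + normSq z)⁻¹ ^ 2 := by
    intro z
    have hd1 : DifferentiableAt ℝ (fun z : Pt n => 1 + normSq z) z :=
      (differentiable_normSq z).const_add 1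
    have hd : DifferentiableAt ℝ (fun z : Pt n => (1 + normSq z)⁻¹) z := hd1.inv (hpos z).ne'
    have hd2 : fderiv ℝ (fun z : Pt n => (1 + normSq z)⁻¹) z z =
        -(2 * normSq z) * (1 + normSq z)⁻¹ ^ 2 := by
      have := (hasDerivAt_inv (hpos z).ne').comp_hasFDerivAt z hd1.hasFDerivAt
      have h2 := this.fderiv
      rw [show (fun z : Pt n => (1 + normSq z)⁻¹) = Inv.inv ∘ fun z => 1 + normSq z from rfl, h2]
      simp [fderiv_normSq, euclDot_self]; ring
    rw [fderiv_fun_mul ((hψ.differentiableAt z).fun_mul hd) (hψ.differentiableAt z),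
      fderiv_fun_mul (hψ.differentiableAt z) hd]
    simp only [add_apply, smul_apply, smul_eq_mul,
      euclDot_euclGrad (hψ.differentiableAt z), Prod.mk_zero_zero, sub_zero, hd2]
    ring
  simp_rw [hfd] at h
  have hcs : ∀ f : Pt n → ℝ, Continuous f → (∀ z, ψ z = 0 → f z = 0) →
      Integrable f (halfMeasure n a) := fun f hf h0 =>
    hf.integrable_of_hasCompactSupport (hψ.2.mono fun z hz hz' => hz (h0 z hz'))
  have hi0 : Integrable (fun z => ψ z ^ 2 * (1 + normSq z)⁻¹) (halfMeasure n a) :=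
    hcs _ (by fun_prop) fun z hz => by simp [hz]
  have hi1 : Integrable (fun z => 2 * ψ z * (1 + normSq z)⁻¹ * euclDot (euclGrad ψ z) z)
    (halfMeasure n a) := hcs _ (by fun_prop) fun z hz => by simp [hz]
  have hi2 : Integrable (fun z => 2 * ψ z ^ 2 * normSq z * (1 + normSq z)⁻¹ ^ 2)
    (halfMeasure n a) := hcs _ (by fun_prop) fun z hz => by simp [hz]
  have hi3 : Integrable (fun z => normSq (euclGrad ψ z)) (halfMeasure n a) := by
    refine Continuous.integrable_of_hasCompactSupport (by fun_prop) ?_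
    exact hψ.hasCompactSupport_euclGrad.mono fun z hz h0 => hz (by simp [h0, normSq])
  -- Young's inequality is applied with parameter b. Of the 2b + 2 copies of ∫ ψ²/(1 + |z|²) in the
  -- dilation identity, `hA` uses up two and `hB` uses up b, leaving b of them below b⁻¹ ∫ |∇ψ|².
  set b := halfDim n a - 1 with hbdef
  have hb0 : 0 < b := by linarith
  have e0 : ∀ z, ψ z * (1 + normSq z)⁻¹ * ψ z = ψ z ^ 2 * (1 + normSq z)⁻¹ := fun z => by ring
  simp_rw [e0] at h
  simp_rw [div_eq_mul_inv (ψ _ ^ 2)]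
  rw [integral_sub hi1 hi2] at h
  have hA : ∫ z, 2 * ψ z ^ 2 * normSq z * (1 + normSq z)⁻¹ ^ 2 ∂halfMeasure n a ≤
      ∫ z, 2 * (ψ z ^ 2 * (1 + normSq z)⁻¹) ∂halfMeasure n a := by
    refine integral_mono hi2 (hi0.const_mul 2) fun z => ?_
    have h1 := hpos z
    have h2 : normSq z * (1 + normSq z)⁻¹ ≤ 1 := by
      rw [← div_eq_mul_inv, div_le_one h1]; linarith
    have h3 : 0 ≤ ψ z ^ 2 * (1 + normSq z)⁻¹ := by positivity
    have := mul_le_mul_of_nonneg_left h2 h3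
    simp only
    nlinarith
  have hB : -∫ z, 2 * ψ z * (1 + normSq z)⁻¹ * euclDot (euclGrad ψ z) z ∂halfMeasure n a ≤
      ∫ z, (b * (ψ z ^ 2 * (1 + normSq z)⁻¹) + b⁻¹ * normSq (euclGrad ψ z)) ∂halfMeasure n a := by
    rw [← integral_neg]
    refine integral_mono hi1.neg ((hi0.const_mul b).add (hi3.const_mul b⁻¹)) fun z => ?_
    have h1 := hpos z
    have h4 := abs_euclDot_le (euclGrad ψ z) z
    have h5 := euclNorm_sq (euclGrad ψ z)
    have h6 := euclNorm_sq z
    have h7 := euclNorm_nonneg z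
    have h8 := euclNorm_nonneg (euclGrad ψ z)
    have hw : 0 < (1 + normSq z)⁻¹ := by positivity
    have hz1 : euclNorm z ^ 2 * (1 + normSq z)⁻¹ ≤ 1 := by
      rw [h6, ← div_eq_mul_inv, div_le_one h1]; linarith
    simp only
    rw [← h5]
    generalize (1 + normSq z)⁻¹ = w at *
    generalize euclNorm (euclGrad ψ z) = G at *
    generalize euclNorm z = r at *
    have h9 : -(2 * ψ z * w * euclDot (euclGrad ψ z) z) ≤ 2 * |ψ z| * w * (G * r) := by
      refine (neg_le_abs _).trans ?_
      rw [abs_mul, abs_mul, abs_mul, abs_of_pos hw, abs_two]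
      gcongr
    have h10 : 2 * |ψ z| * w * (G * r) ≤ b * (ψ z ^ 2 * w) + b⁻¹ * (G ^ 2 * (r ^ 2 * w)) := by
      rw [← sq_abs (ψ z)]
      have : b * (|ψ z| ^ 2 * w) + b⁻¹ * (G ^ 2 * (r ^ 2 * w)) - 2 * |ψ z| * w * (G * r) =
          w * b⁻¹ * (b * |ψ z| - G * r) ^ 2 := by field_simp; ring
      have : 0 ≤ w * b⁻¹ * (b * |ψ z| - G * r) ^ 2 := by positivity
      linarith
    have h11 : b⁻¹ * (G ^ 2 * (r ^ 2 * w)) ≤ b⁻¹ * (G ^ 2 * 1) := by gcongr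
    linarith
  rw [integral_const_mul] at hA
  rw [integral_add (hi0.const_mul b) (hi3.const_mul b⁻¹), integral_const_mul, integral_const_mul]
    at hB
  have hN : 2 * halfDim n a = 2 * b + 2 := by rw [hbdef]; ring
  rw [hN] at h
  have : b * ∫ z, ψ z ^ 2 * (1 + normSq z)⁻¹ ∂halfMeasure n a ≤
      b⁻¹ * ∫ z, normSq (euclGrad ψ z) ∂halfMeasure n a := by linarith
  have h2 := mul_le_mul_of_nonneg_left this (inv_pos.2 hb0).le
  rw [← mul_assoc, inv_mul_cancel₀ hb0.ne', one_mul] at h2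
  calc _ ≤ _ := h2
    _ = _ := by rw [one_div]; ring

lemma eLpNorm_two_eq {X F : Type*} [MeasurableSpace X] [NormedAddCommGroup F] {μ : Measure X}
    {f : X → F} (hf : MemLp f 2 μ) :
    eLpNorm f 2 μ = ENNReal.ofReal (Real.sqrt (∫ x, ‖f x‖ ^ 2 ∂μ)) := by
  rw [hf.eLpNorm_eq_integral_rpow_norm (by simp) (by simp), Real.sqrt_eq_rpow]
  simp

/-- The square root of the weight in Hardy's inequality. -/
def hardyWeight (z : Pt n) : ℝ := (Real.sqrt (1 + normSq z))⁻¹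

@[fun_prop]
lemma continuous_hardyWeight : Continuous (hardyWeight : Pt n → ℝ) := by
  unfold hardyWeight
  refine Continuous.inv₀ (by fun_prop) fun z => ?_
  have := normSq_nonneg z
  positivity

lemma hardyWeight_pos (z : Pt n) : 0 < hardyWeight z := by
  have := normSq_nonneg z
  unfold hardyWeight; positivity

lemma hardyWeight_le_one (z : Pt n) : hardyWeight z ≤ 1 := by
  have := normSq_nonneg z
  exact inv_le_one_of_one_le₀ (Real.one_le_sqrt.2 (by linarith))

lemma hardyWeight_sq (z : Pt n) : hardyWeight z ^ 2 = (1 + normSq z)⁻¹ := by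
  have := normSq_nonneg z
  rw [hardyWeight, inv_pow, Real.sq_sqrt (by linarith)]

/-- `eLpNorm` sees the sup norm of the gradient; the numerator 2 is a crude price for passing from
the Euclidean norm to it. -/
lemma IsTest.eLpNorm_hardy [Fact (-1 < a)] (hb : 1 < halfDim n a) {ψ : Pt n → ℝ} (hψ : IsTest ψ) :
    eLpNorm (fun z => hardyWeight z * ψ z) 2 (halfMeasure n a) ≤
      ENNReal.ofReal (2 / (halfDim n a - 1)) * eLpNorm (euclGrad ψ) 2 (halfMeasure n a) := by
  have hψc := hψ.continuous
  have hb0 : 0 < halfDim n a - 1 := by linarith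
  have hm : MemLp (fun z => hardyWeight z * ψ z) 2 (halfMeasure n a) :=
    Continuous.memLp_of_hasCompactSupport (by fun_prop) hψ.2.mul_left
  have hG : Integrable (fun z => ‖euclGrad ψ z‖ ^ 2) (halfMeasure n a) :=
    hψ.memLp_euclGrad.integrable_norm_pow (by simp)
  rw [eLpNorm_two_eq hm, eLpNorm_two_eq hψ.memLp_euclGrad,
    ← ENNReal.ofReal_mul (by positivity)]
  apply ENNReal.ofReal_le_ofReal
  apply Real.sqrt_le_iff.2 ⟨by positivity, ?_⟩
  rw [mul_pow, Real.sq_sqrt (integral_nonneg fun z => by positivity)]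
  have h1 : ∫ z, ‖hardyWeight z * ψ z‖ ^ 2 ∂halfMeasure n a =
      ∫ z, ψ z ^ 2 / (1 + normSq z) ∂halfMeasure n a := by
    congr 1; ext z
    rw [Real.norm_eq_abs, sq_abs, mul_pow, hardyWeight_sq]; field_simp
  rw [h1]
  refine (hψ.hardy hb).trans ?_
  have h2 : ∫ z, normSq (euclGrad ψ z) ∂halfMeasure n a ≤
      ∫ z, 4 * ‖euclGrad ψ z‖ ^ 2 ∂halfMeasure n a := by
    refine integral_mono_of_nonneg (ae_of_all _ fun z => normSq_nonneg _) (hG.const_mul 4)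
      (ae_of_all _ fun z => ?_)
    have := normSq_le (euclGrad ψ z)
    simp only
    nlinarith [sq_nonneg ‖euclGrad ψ z‖]
  rw [integral_const_mul] at h2
  calc _ ≤ (1 / (halfDim n a - 1)) ^ 2 * (4 * ∫ z, ‖euclGrad ψ z‖ ^ 2 ∂halfMeasure n a) := by
        gcongr
    _ = _ := by ring

/-! ### Integrability against Gaussians -/

lemma one_add_normSq_le (z : Pt n) (x : EuclideanSpace ℝ (Fin n)) :
    1 + normSq z ≤ (2 + 2 * ‖x‖ ^ 2) * (1 + normSq (z - (x, 0))) := by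
  rw [normSq_sub_mk, normSq]
  have h : ‖z.1‖ ≤ ‖z.1 - x‖ + ‖x‖ := norm_le_norm_sub_add _ _
  have h0 := norm_nonneg z.1
  have h1 : ‖z.1‖ ^ 2 ≤ 2 * ‖z.1 - x‖ ^ 2 + 2 * ‖x‖ ^ 2 := by
    nlinarith [sq_nonneg (‖z.1 - x‖ - ‖x‖)]
  nlinarith [sq_nonneg z.2, mul_nonneg (sq_nonneg ‖x‖) (sq_nonneg z.2),
    mul_nonneg (sq_nonneg ‖x‖) (sq_nonneg ‖z.1 - x‖)]

lemma normSq_sub_le (z : Pt n) (x : EuclideanSpace ℝ (Fin n)) :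
    normSq (z - (x, 0)) ≤ (2 + 2 * ‖x‖ ^ 2) * (1 + normSq z) := by
  rw [normSq_sub_mk, normSq]
  have h : ‖z.1 - x‖ ≤ ‖z.1‖ + ‖x‖ := norm_sub_le _ _
  have h0 := norm_nonneg (z.1 - x)
  have h1 : ‖z.1 - x‖ ^ 2 ≤ 2 * ‖z.1‖ ^ 2 + 2 * ‖x‖ ^ 2 := by
    nlinarith [sq_nonneg (‖z.1‖ - ‖x‖)]
  nlinarith [sq_nonneg z.2, mul_nonneg (sq_nonneg ‖x‖) (sq_nonneg z.2),
    mul_nonneg (sq_nonneg ‖x‖) (sq_nonneg ‖z.1‖)]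

/-- Half of the exponent beats the polynomial, by u^m / m! ≤ exp u with u = (t/2)(1 + ρ), after
recentring with `one_add_normSq_le`. -/
lemma exists_pow_mul_gauss_le {t : ℝ} (ht : 0 < t) (x : EuclideanSpace ℝ (Fin n)) (m : ℕ) :
    ∃ C, 0 < C ∧ ∀ z, (1 + normSq z) ^ m * gauss t x z ≤ C * gauss (t / 2) x z := by
  refine ⟨(2 + 2 * ‖x‖ ^ 2) ^ m * (m.factorial * Real.exp (t / 2) / (t / 2) ^ m),
    by positivity, fun z => ?_⟩
  set ρ := normSq (z - (x, 0)) with hρ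
  have hρ0 : 0 ≤ ρ := normSq_nonneg _
  have h1 : (1 + normSq z) ^ m ≤ (2 + 2 * ‖x‖ ^ 2) ^ m * (1 + ρ) ^ m := by
    rw [← mul_pow]
    exact pow_le_pow_left₀ (by linarith [normSq_nonneg z]) (one_add_normSq_le z x) m
  have h2 := Real.pow_div_factorial_le_exp (t / 2 * (1 + ρ)) (by positivity) m
  have h3 : (1 + ρ) ^ m ≤ m.factorial * Real.exp (t / 2) / (t / 2) ^ m * Real.exp (t / 2 * ρ) := by
    rw [div_le_iff₀ (by positivity), mul_pow] at h2
    rw [div_mul_eq_mul_div, le_div_iff₀ (by positivity), mul_assoc, ← Real.exp_add]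
    calc _ = (t / 2) ^ m * (1 + ρ) ^ m := by ring
      _ ≤ _ := h2
      _ = _ := by rw [mul_comm]; ring_nf
  have h4 : gauss t x z = Real.exp (-(t / 2 * ρ)) * gauss (t / 2) x z := by
    rw [gauss, gauss, ← Real.exp_add, hρ]; ring_nf
  have h5 := (gauss_pos (t / 2) x z).le
  rw [h4]
  calc (1 + normSq z) ^ m * (Real.exp (-(t / 2 * ρ)) * gauss (t / 2) x z)
      ≤ ((2 + 2 * ‖x‖ ^ 2) ^ m * (m.factorial * Real.exp (t / 2) / (t / 2) ^ m *
        Real.exp (t / 2 * ρ))) * (Real.exp (-(t / 2 * ρ)) * gauss (t / 2) x z) := by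
        refine mul_le_mul_of_nonneg_right (h1.trans ?_) (by positivity)
        gcongr
    _ = _ := by
        rw [show ∀ A B C D E : ℝ, (A * (B * C)) * (D * E) = A * B * E * (C * D) by intros; ring,
          ← Real.exp_add]
        simp

lemma gauss_sq (t : ℝ) (x : EuclideanSpace ℝ (Fin n)) (z : Pt n) :
    gauss t x z ^ 2 = gauss (2 * t) x z := by
  rw [gauss, gauss, ← Real.exp_nat_mul]; push_cast; ring_nf

lemma memLp_of_le_gauss {F : Type*} [NormedAddCommGroup F] (ha : -1 < a) {t : ℝ} (ht : 0 < t)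
    {x : EuclideanSpace ℝ (Fin n)} {f : Pt n → F} {C : ℝ} {m : ℕ}
    (hf : AEStronglyMeasurable f (halfMeasure n a))
    (h : ∀ z, ‖f z‖ ≤ C * ((1 + normSq z) ^ m * gauss t x z)) :
    MemLp f 2 (halfMeasure n a) := by
  rw [memLp_two_iff_integrable_sq_norm hf]
  obtain ⟨D, hD, hD'⟩ := exists_pow_mul_gauss_le (n := n) (t := 2 * t) (by linarith) x (2 * m)
  refine ((integrable_gauss ha (t := 2 * t / 2) (by linarith) x).const_mul (C ^ 2 * D)).mono'
    (hf.norm.pow 2) (ae_of_all _ fun z => ?_)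
  rw [Real.norm_of_nonneg (by positivity)]
  calc ‖f z‖ ^ 2 ≤ (C * ((1 + normSq z) ^ m * gauss t x z)) ^ 2 :=
        pow_le_pow_left₀ (norm_nonneg _) (h z) 2
    _ = C ^ 2 * ((1 + normSq z) ^ (2 * m) * gauss (2 * t) x z) := by
        rw [mul_pow, mul_pow, gauss_sq, ← pow_mul, mul_comm m 2]
    _ ≤ C ^ 2 * (D * gauss (2 * t / 2) x z) := 
        mul_le_mul_of_nonneg_left (hD' z) (sq_nonneg C)
    _ = _ := by ring

/-- A potential need not be in L², but it is after multiplication by `hardyWeight`; the inverse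
weight grows at most polynomially and is absorbed by the Gaussian decay of `f`. -/
lemma integrable_mul_of_le_gauss (ha : -1 < a) {t : ℝ} (ht : 0 < t)
    {x : EuclideanSpace ℝ (Fin n)} {φ f : Pt n → ℝ} {C : ℝ} {m : ℕ}
    (hφ : MemLp (fun z => hardyWeight z * φ z) 2 (halfMeasure n a))
    (hf : AEStronglyMeasurable f (halfMeasure n a))
    (h : ∀ z, |f z| ≤ C * ((1 + normSq z) ^ m * gauss t x z)) :
    MemLp (fun z => (hardyWeight z)⁻¹ * f z) 2 (halfMeasure n a) ∧
      Integrable (fun z => φ z * f z) (halfMeasure n a) := by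
  have h1 : MemLp (fun z => (hardyWeight z)⁻¹ * f z) 2 (halfMeasure n a) := by
    refine memLp_of_le_gauss (C := C) (m := m + 1) (t := t) (x := x) ha ht ?_ fun z => ?_
    · refine AEStronglyMeasurable.mul (Continuous.aestronglyMeasurable ?_) hf
      exact continuous_hardyWeight.inv₀ fun z => (hardyWeight_pos z).ne'
    · have h0 := normSq_nonneg z
      have h2 : (hardyWeight z)⁻¹ ≤ 1 + normSq z := by
        rw [hardyWeight, inv_inv]
        exact Real.sqrt_le_self_iff.2 (Or.inr (by linarith))
      rw [norm_mul, Real.norm_eq_abs (f z), Real.norm_of_nonneg (inv_pos.2 (hardyWeight_pos z)).le]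
      calc _ ≤ (1 + normSq z) * (C * ((1 + normSq z) ^ m * gauss t x z)) :=
            mul_le_mul h2 (h z) (abs_nonneg _) (by linarith)
        _ = _ := by ring
  refine ⟨h1, (hφ.integrable_mul h1).congr (ae_of_all _ fun z => ?_)⟩
  have := (hardyWeight_pos z).ne'
  simp only [Pi.mul_apply]
  field_simp

/-! ### Limits of test functions in the energy norm -/

/-- `(φ, g)` is a limit of pairs `(ψ_j, ∇ψ_j)` with test functions `ψ_j`, where gradients converge in
`L²(y^a dx dy)` and functions in `L²(y^a dx dy)` on bounded sets. -/
def IsTestLimit (a : ℝ) (φ : Pt n → ℝ) (g : Pt n → Pt n) : Prop :=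
  AEStronglyMeasurable φ (halfMeasure n a) ∧ MemLp g 2 (halfMeasure n a) ∧
  ∃ ψ : ℕ → Pt n → ℝ, (∀ j, IsTest (ψ j)) ∧
    Tendsto (fun j => eLpNorm (fun z => euclGrad (ψ j) z - g z) 2 (halfMeasure n a)) atTop (𝓝 0) ∧
    ∀ r : ℝ, Tendsto (fun j => eLpNorm (fun z => ψ j z - φ z) 2
      ((halfMeasure n a).restrict (euclBall 0 r))) atTop (𝓝 0)

/-- A diagonal choice: each admissible `u j` is replaced by a test function within 1/(j + 1) of it
in both norms. -/
lemma IsInEnergyClosure.isTestLimit {A : Set (EuclideanSpace ℝ (Fin n))} {φ : Pt n → ℝ}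
    {g : Pt n → Pt n} [Fact (-1 < a)] (h : IsInEnergyClosure a A φ g) : IsTestLimit a φ g := by
  obtain ⟨hφ, hg, u, v, hadm, hv, hu⟩ := h
  have hlim : Tendsto (fun j : ℕ => ((j : ℝ≥0∞) + 1)⁻¹) atTop (𝓝 0) := by
    have := ENNReal.tendsto_inv_nat_nhds_zero.comp (tendsto_add_atTop_nat 1)
    refine this.congr fun j => by simp
  have hch : ∀ j : ℕ, ∃ ψ : Pt n → ℝ, IsTest ψ ∧
      eLpNorm (fun z => ψ z - u j z) 2 (halfMeasure n a) < ((j : ℝ≥0∞) + 1)⁻¹ ∧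
      eLpNorm (fun z => euclGrad ψ z - v j z) 2 (halfMeasure n a) < ((j : ℝ≥0∞) + 1)⁻¹ := by
    intro j
    obtain ⟨_, _, ψ, hψ, h1, h2⟩ := (hadm j).1
    have hpos : (0 : ℝ≥0∞) < ((j : ℝ≥0∞) + 1)⁻¹ := by simp
    obtain ⟨i, hi1, hi2⟩ := ((h1.eventually_lt_const hpos).and (h2.eventually_lt_const hpos)).exists
    exact ⟨ψ i, hψ i, hi1, hi2⟩
  choose ψ hψ h1 h2 using hch
  refine ⟨hφ, hg, ψ, hψ, ?_, fun r => ?_⟩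
  · refine tendsto_of_tendsto_of_tendsto_of_le_of_le tendsto_const_nhds
      (by simpa using hlim.add hv) (fun j => zero_le) fun j => ?_
    calc eLpNorm (fun z => euclGrad (ψ j) z - g z) 2 (halfMeasure n a)
        = eLpNorm ((fun z => euclGrad (ψ j) z - v j z) + fun z => v j z - g z) 2
          (halfMeasure n a) := by congr 1; ext1 z; simp
      _ ≤ _ := eLpNorm_add_le ((hψ j).memLp_euclGrad.sub (hadm j).1.2.1).1
          ((hadm j).1.2.1.sub hg).1 (by norm_num)
      _ ≤ _ := add_le_add (h2 j).le le_rfl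
  · refine tendsto_of_tendsto_of_tendsto_of_le_of_le tendsto_const_nhds
      (by simpa using hlim.add (hu r)) (fun j => zero_le) fun j => ?_
    calc eLpNorm (fun z => ψ j z - φ z) 2 ((halfMeasure n a).restrict (euclBall 0 r))
        = eLpNorm ((fun z => ψ j z - u j z) + fun z => u j z - φ z) 2
          ((halfMeasure n a).restrict (euclBall 0 r)) := by congr 1; ext1 z; simp
      _ ≤ _ := eLpNorm_add_le ((hψ j).memLp.sub (hadm j).1.1).1.restrict
          ((hadm j).1.1.1.sub hφ).restrict (by norm_num)
      _ ≤ _ := add_le_add ((eLpNorm_mono_measure _ Measure.restrict_le_self).trans (h1 j).le) le_rfl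

/-- Monotone convergence over an exhaustion by balls. -/
lemma eLpNorm_le_of_forall_euclBall {μ : Measure (Pt n)} {f : Pt n → ℝ} {c : ℝ≥0∞}
    (h : ∀ r : ℝ, eLpNorm f 2 (μ.restrict (euclBall 0 r)) ≤ c) : eLpNorm f 2 μ ≤ c := by
  have hf : ∀ μ' : Measure (Pt n), eLpNorm f 2 μ' ≤ c ↔ ∫⁻ z, ‖f z‖ₑ ^ (2 : ℝ) ∂μ' ≤ c ^ (2 : ℝ) := by
    intro μ'
    rw [eLpNorm_eq_lintegral_rpow_enorm_toReal (by simp) (by simp)]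
    rw [one_div, ENNReal.rpow_inv_le_iff (by simp)]
    simp
  simp_rw [hf] at h ⊢
  have hU : (⋃ k : ℕ, euclBall (0 : Pt n) k) = univ := by
    refine eq_univ_of_forall fun z => mem_iUnion.2 ?_
    obtain ⟨k, hk⟩ := exists_nat_gt (euclNorm z)
    exact ⟨k, by simpa [euclBall] using hk⟩
  rw [← setLIntegral_univ, ← hU, setLIntegral_iUnion_of_directed]
  · exact iSup_le fun k => h k
  · refine directed_of_isDirected_le fun i j hij z hz => ?_
    have hij : (i : ℝ) ≤ j := by exact_mod_cast hij
    exact lt_of_lt_of_le hz hij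

/-- Hardy's inequality for ψ_j - ψ_k is read on a fixed ball, where k → ∞ is allowed, and the ball
then exhausts the space. This turns local convergence of the functions into global weighted
convergence. -/
lemma IsTestLimit.eLpNorm_hardyWeight_sub_le [Fact (-1 < a)] (hb : 1 < halfDim n a)
    {φ : Pt n → ℝ} {g : Pt n → Pt n} (hφ : AEStronglyMeasurable φ (halfMeasure n a))
    (hg : MemLp g 2 (halfMeasure n a)) {ψ : ℕ → Pt n → ℝ} (hψ : ∀ j, IsTest (ψ j))
    (hgrad : Tendsto (fun j => eLpNorm (fun z => euclGrad (ψ j) z - g z) 2 (halfMeasure n a))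
      atTop (𝓝 0))
    (hloc : ∀ r : ℝ, Tendsto (fun j => eLpNorm (fun z => ψ j z - φ z) 2
      ((halfMeasure n a).restrict (euclBall 0 r))) atTop (𝓝 0)) (j : ℕ) :
    eLpNorm (fun z => hardyWeight z * (ψ j z - φ z)) 2 (halfMeasure n a) ≤
      ENNReal.ofReal (2 / (halfDim n a - 1)) *
        eLpNorm (fun z => euclGrad (ψ j) z - g z) 2 (halfMeasure n a) := by
  refine eLpNorm_le_of_forall_euclBall fun r => ?_
  set C := ENNReal.ofReal (2 / (halfDim n a - 1)) with hC
  set d := eLpNorm (fun z => euclGrad (ψ j) z - g z) 2 (halfMeasure n a) with hd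
  have hlim : Tendsto (fun k => C * (d + eLpNorm (fun z => euclGrad (ψ k) z - g z) 2
      (halfMeasure n a)) + eLpNorm (fun z => ψ k z - φ z) 2
      ((halfMeasure n a).restrict (euclBall 0 r))) atTop (𝓝 (C * (d + 0) + 0)) :=
    (ENNReal.Tendsto.const_mul (tendsto_const_nhds.add hgrad)
      (Or.inr ENNReal.ofReal_ne_top)).add (hloc r)
  rw [add_zero, add_zero] at hlim
  refine ge_of_tendsto' hlim fun k => ?_
  have hw : Continuous (hardyWeight : Pt n → ℝ) := continuous_hardyWeight
  have hjk := (hψ j).sub (hψ k)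
  have h1 : eLpNorm (fun z => hardyWeight z * (ψ j z - ψ k z)) 2
      ((halfMeasure n a).restrict (euclBall 0 r)) ≤
      C * (d + eLpNorm (fun z => euclGrad (ψ k) z - g z) 2 (halfMeasure n a)) := by
    refine (eLpNorm_mono_measure _ Measure.restrict_le_self).trans ((hjk.eLpNorm_hardy hb).trans ?_)
    gcongr
    rw [(hψ j).euclGrad_sub (hψ k)]
    calc eLpNorm (euclGrad (ψ j) - euclGrad (ψ k)) 2 (halfMeasure n a)
        = eLpNorm ((fun z => euclGrad (ψ j) z - g z) - fun z => euclGrad (ψ k) z - g z) 2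
          (halfMeasure n a) := by congr 1; ext1 z; simp
      _ ≤ _ := eLpNorm_sub_le ((hψ j).memLp_euclGrad.sub hg).1 ((hψ k).memLp_euclGrad.sub hg).1
          (by norm_num)
  have h2 : eLpNorm (fun z => hardyWeight z * (ψ k z - φ z)) 2
      ((halfMeasure n a).restrict (euclBall 0 r)) ≤ eLpNorm (fun z => ψ k z - φ z) 2
      ((halfMeasure n a).restrict (euclBall 0 r)) := by
    refine eLpNorm_mono fun z => ?_
    rw [norm_mul, Real.norm_of_nonneg (hardyWeight_pos z).le]
    exact mul_le_of_le_one_left (norm_nonneg _) (hardyWeight_le_one z)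
  calc eLpNorm (fun z => hardyWeight z * (ψ j z - φ z)) 2
        ((halfMeasure n a).restrict (euclBall 0 r))
      = eLpNorm ((fun z => hardyWeight z * (ψ j z - ψ k z)) +
          fun z => hardyWeight z * (ψ k z - φ z)) 2
        ((halfMeasure n a).restrict (euclBall 0 r)) := by congr 1; ext1 z; simp; ring
    _ ≤ _ := eLpNorm_add_le
        ((hw.mul ((hψ j).continuous.sub (hψ k).continuous)).aestronglyMeasurable)
        (hw.aestronglyMeasurable.mul
          ((hψ k).continuous.aestronglyMeasurable.sub hφ.restrict)) (by norm_num)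
    _ ≤ _ := add_le_add h1 h2

lemma IsTestLimit.memLp_hardyWeight_mul [Fact (-1 < a)] (hb : 1 < halfDim n a)
    {φ : Pt n → ℝ} {g : Pt n → Pt n} (h : IsTestLimit a φ g) :
    MemLp (fun z => hardyWeight z * φ z) 2 (halfMeasure n a) := by
  obtain ⟨hφ, hg, ψ, hψ, hgrad, hloc⟩ := h
  have hw : Continuous (hardyWeight : Pt n → ℝ) := continuous_hardyWeight
  have h0 := IsTestLimit.eLpNorm_hardyWeight_sub_le hb hφ hg hψ hgrad hloc 0
  have h1 : MemLp (fun z => hardyWeight z * (ψ 0 z - φ z)) 2 (halfMeasure n a) :=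
    ⟨hw.aestronglyMeasurable.mul ((hψ 0).continuous.aestronglyMeasurable.sub hφ),
      h0.trans_lt (ENNReal.mul_lt_top ENNReal.ofReal_lt_top ((hψ 0).memLp_euclGrad.sub hg).2)⟩
  have h2 : MemLp (fun z => hardyWeight z * ψ 0 z) 2 (halfMeasure n a) :=
    (hw.mul (hψ 0).continuous).memLp_of_hasCompactSupport (hψ 0).2.mul_left
  refine (h2.sub h1).ae_eq (ae_of_all _ fun z => ?_)
  simp only [Pi.sub_apply]; ring

/-! ### Bilinear pairings of `L²` functions -/

/-- The Euclidean inner product as a continuous bilinear map. -/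
def euclDotL (n : ℕ) : Pt n →L[ℝ] Pt n →L[ℝ] ℝ :=
  (innerSL ℝ).bilinearComp (ContinuousLinearMap.fst ℝ _ ℝ) (ContinuousLinearMap.fst ℝ _ ℝ) +
    (ContinuousLinearMap.mul ℝ ℝ).bilinearComp (ContinuousLinearMap.snd ℝ _ ℝ)
      (ContinuousLinearMap.snd ℝ _ ℝ)

lemma euclDotL_apply (z w : Pt n) : euclDotL n z w = euclDot z w := by
  simp [euclDotL, euclDot]

section Bilinear

variable {X E F : Type*} [MeasurableSpace X] {μ : Measure X}
  [NormedAddCommGroup E] [NormedSpace ℝ E] [NormedAddCommGroup F] [NormedSpace ℝ F]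

lemma integrable_bilinear (B : E →L[ℝ] F →L[ℝ] ℝ) {f : X → E} {g : X → F}
    (hf : MemLp f 2 μ) (hg : MemLp g 2 μ) : Integrable (fun x => B (f x) (g x)) μ := by
  rw [← memLp_one_iff_integrable]
  exact MemLp.of_bilin (p := 2) (q := 2) (fun x y => B x y) ‖B‖₊ hf hg
    (B.aestronglyMeasurable_comp₂ hf.1 hg.1)
    (ae_of_all _ fun x => B.le_opNorm₂ _ _)

lemma tendsto_integral_bilinear (B : E →L[ℝ] F →L[ℝ] ℝ) {f : ℕ → X → E} {f₀ : X → E} {g : X → F}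
    (hf : ∀ j, MemLp (f j) 2 μ) (hf₀ : MemLp f₀ 2 μ) (hg : MemLp g 2 μ)
    (h : Tendsto (fun j => eLpNorm (fun x => f j x - f₀ x) 2 μ) atTop (𝓝 0)) :
    Tendsto (fun j => ∫ x, B (f j x) (g x) ∂μ) atTop (𝓝 (∫ x, B (f₀ x) (g x) ∂μ)) := by
  refine tendsto_integral_of_L1' _ (integrable_bilinear B hf₀ hg).1
    (Eventually.of_forall fun j => integrable_bilinear B (hf j) hg) ?_
  have hlim : Tendsto (fun j => (‖B‖₊ : ℝ≥0∞) * eLpNorm (fun x => f j x - f₀ x) 2 μ *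
      eLpNorm g 2 μ) atTop (𝓝 (‖B‖₊ * 0 * eLpNorm g 2 μ)) :=
    ENNReal.Tendsto.mul_const (ENNReal.Tendsto.const_mul h (Or.inr ENNReal.coe_ne_top))
      (Or.inr hg.2.ne)
  rw [mul_zero, zero_mul] at hlim
  refine tendsto_of_tendsto_of_tendsto_of_le_of_le tendsto_const_nhds hlim (fun j => zero_le)
    fun j => ?_
  calc eLpNorm ((fun x => B (f j x) (g x)) - fun x => B (f₀ x) (g x)) 1 μ
      = eLpNorm (fun x => B (f j x - f₀ x) (g x)) 1 μ := by congr 1; ext1 x; simp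
    _ ≤ _ := eLpNorm_le_eLpNorm_mul_eLpNorm_of_nnnorm (p := 2) (q := 2) ((hf j).sub hf₀).1 hg.1
        (fun x y => B x y) ‖B‖₊ (ae_of_all _ fun x => B.le_opNorm₂ _ _)

end Bilinear

lemma memLp_gauss_smul_sub (ha : -1 < a) {t : ℝ} (ht : 0 < t) (x : EuclideanSpace ℝ (Fin n)) :
    MemLp (fun z : Pt n => gauss t x z • (z - (x, 0))) 2 (halfMeasure n a) := by
  refine memLp_of_le_gauss (C := 1 + (2 + 2 * ‖x‖ ^ 2)) (m := 1) (t := t) (x := x) ha ht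
    (Continuous.aestronglyMeasurable (by fun_prop)) fun z => ?_
  rw [norm_smul, Real.norm_of_nonneg (gauss_pos t x z).le]
  have h1 := norm_le_euclNorm (z - (x, 0))
  have h2 := euclNorm_sq (z - (x, 0))
  have h3 := normSq_sub_le z x
  have h4 := normSq_nonneg z
  have h5 : ‖z - (x, 0)‖ ≤ (1 + (2 + 2 * ‖x‖ ^ 2)) * (1 + normSq z) := by
    nlinarith [sq_nonneg (euclNorm (z - (x, 0)) - 1), sq_nonneg ‖x‖]
  calc _ ≤ gauss t x z * ((1 + (2 + 2 * ‖x‖ ^ 2)) * (1 + normSq z)) := by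
        gcongr; exact (gauss_pos t x z).le
    _ = _ := by ring

lemma abs_gauss_mul_le {t : ℝ} (x : EuclideanSpace ℝ (Fin n)) (c d : ℝ) (z : Pt n) :
    |gauss t x z * (c * normSq (z - (x, 0)) - d)| ≤
      (|c| * (2 + 2 * ‖x‖ ^ 2) + |d|) * ((1 + normSq z) ^ 1 * gauss t x z) := by
  have h0 := gauss_pos t x z
  have h3 := normSq_sub_le z x
  have h4 := normSq_nonneg z
  have h5 := normSq_nonneg (z - (x, 0))
  rw [abs_mul, abs_of_pos h0]
  have h6 : |c * normSq (z - (x, 0)) - d| ≤ (|c| * (2 + 2 * ‖x‖ ^ 2) + |d|) * (1 + normSq z) := by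
    refine (abs_sub _ _).trans ?_
    rw [abs_mul, abs_of_nonneg h5]
    have := mul_le_mul_of_nonneg_left h3 (abs_nonneg c)
    nlinarith [abs_nonneg d, mul_nonneg (abs_nonneg d) h4]
  calc _ ≤ gauss t x z * ((|c| * (2 + 2 * ‖x‖ ^ 2) + |d|) * (1 + normSq z)) := by gcongr
    _ = _ := by ring

/-- Both sides pass to the limit from test functions: the left by convergence of gradients, the
right by weighted convergence of functions, with `hardyWeight` on one factor and its inverse on the
other. -/
lemma IsTestLimit.integral_gauss_mul_grad [h' : Fact (-1 < a)] (hb : 1 < halfDim n a)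
    {φ : Pt n → ℝ} {g : Pt n → Pt n} (h : IsTestLimit a φ g) {t : ℝ} (ht : 0 < t)
    (x : EuclideanSpace ℝ (Fin n)) :
    ∫ z, gauss t x z * euclDot (g z) (z - (x, 0)) ∂halfMeasure n a =
      ∫ z, φ z * (gauss t x z * (2 * t * normSq (z - (x, 0)) - 2 * halfDim n a))
        ∂halfMeasure n a := by
  have ha : -1 < a := h'.out
  have hm := h.memLp_hardyWeight_mul hb
  obtain ⟨hφ, hg, ψ, hψ, hgrad, hloc⟩ := h
  have hw : Continuous (hardyWeight : Pt n → ℝ) := continuous_hardyWeight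
  have h0 := IsTestLimit.eLpNorm_hardyWeight_sub_le hb hφ hg hψ hgrad hloc
  have hmem := (integrable_mul_of_le_gauss ha ht hm
    (f := fun z => gauss t x z * (2 * t * normSq (z - (x, 0)) - 2 * halfDim n a))
    (Continuous.aestronglyMeasurable (by fun_prop)) fun z => abs_gauss_mul_le x _ _ z).1
  have hL := tendsto_integral_bilinear (euclDotL n) (fun j => (hψ j).memLp_euclGrad) hg
    (memLp_gauss_smul_sub ha ht x) hgrad
  have hR := tendsto_integral_bilinear (ContinuousLinearMap.mul ℝ ℝ)
    (f := fun j z => hardyWeight z * ψ j z) (f₀ := fun z => hardyWeight z * φ z)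
    (fun j => (hw.mul (hψ j).continuous).memLp_of_hasCompactSupport (hψ j).2.mul_left) hm hmem (by
      have : Tendsto (fun j => ENNReal.ofReal (2 / (halfDim n a - 1)) *
        eLpNorm (fun z => euclGrad (ψ j) z - g z) 2 (halfMeasure n a)) atTop
        (𝓝 (ENNReal.ofReal (2 / (halfDim n a - 1)) * 0)) :=
        ENNReal.Tendsto.const_mul hgrad (Or.inr ENNReal.ofReal_ne_top)
      rw [mul_zero] at this
      refine tendsto_of_tendsto_of_tendsto_of_le_of_le tendsto_const_nhds this
        (fun j => zero_le) fun j => ?_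
      simpa only [mul_sub] using h0 j)
  simp only [euclDotL_apply, euclDot_smul_right, ContinuousLinearMap.mul_apply'] at hL hR
  have e : ∀ (f k : Pt n → ℝ), ∫ z, hardyWeight z * f z * ((hardyWeight z)⁻¹ * k z)
      ∂halfMeasure n a = ∫ z, f z * k z ∂halfMeasure n a := by
    intro f k
    congr 1; ext z
    have := (hardyWeight_pos z).ne'
    field_simp
  simp only [e] at hR
  refine tendsto_nhds_unique hL (hR.congr fun j => ?_)
  exact ((hψ j).integral_gauss_mul_grad t x).symm

/-! ### Linear combinations of admissible functions -/

lemma IsTest.isSobolev [Fact (-1 < a)] {ψ : Pt n → ℝ} (h : IsTest ψ) :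
    IsSobolev a ψ (euclGrad ψ) :=
  ⟨h.memLp, h.memLp_euclGrad, fun _ => ψ, fun _ => h, by simp, by simp⟩

lemma IsSobolev.linComb {u u' : Pt n → ℝ} {g g' : Pt n → Pt n} [Fact (-1 < a)]
    (h : IsSobolev a u g) (h' : IsSobolev a u' g') (c d : ℝ) :
    IsSobolev a (fun z => c * u z + d * u' z) (fun z => c • g z + d • g' z) := by
  obtain ⟨hu, hg, ψ, hψ, h1, h2⟩ := h
  obtain ⟨hu', hg', ψ', hψ', h1', h2'⟩ := h'
  have key : ∀ {F : Type _} [NormedAddCommGroup F] [NormedSpace ℝ F] (f f' : ℕ → Pt n → F)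
      (_ : ∀ j, AEStronglyMeasurable (f j) (halfMeasure n a))
      (_ : ∀ j, AEStronglyMeasurable (f' j) (halfMeasure n a))
      (_ : Tendsto (fun j => eLpNorm (f j) 2 (halfMeasure n a)) atTop (𝓝 0))
      (_ : Tendsto (fun j => eLpNorm (f' j) 2 (halfMeasure n a)) atTop (𝓝 0)),
      Tendsto (fun j => eLpNorm (c • f j + d • f' j) 2 (halfMeasure n a)) atTop (𝓝 0) := by
    intro F _ _ f f' hf hf' hl hl'
    have hlim := (ENNReal.Tendsto.const_mul hl (a := ‖c‖ₑ) (Or.inr enorm_ne_top)).add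
      (ENNReal.Tendsto.const_mul hl' (a := ‖d‖ₑ) (Or.inr enorm_ne_top))
    rw [mul_zero, mul_zero, add_zero] at hlim
    refine tendsto_of_tendsto_of_tendsto_of_le_of_le tendsto_const_nhds hlim (fun j => zero_le)
      fun j => ?_
    refine (eLpNorm_add_le ((hf j).const_smul c) ((hf' j).const_smul d) (by norm_num)).trans ?_
    rw [eLpNorm_const_smul, eLpNorm_const_smul]
  refine ⟨(hu.const_mul c).add (hu'.const_mul d), (hg.const_smul c).add (hg'.const_smul d),
    fun j z => c * ψ j z + d * ψ' j z, fun j => ((hψ j).const_mul c).add ((hψ' j).const_mul d),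
    ?_, ?_⟩
  · refine (key (fun j z => ψ j z - u z) (fun j z => ψ' j z - u' z)
      (fun j => ((hψ j).memLp.sub hu).1) (fun j => ((hψ' j).memLp.sub hu').1) h1 h1').congr
      fun j => ?_
    congr 1; ext z; simp; ring
  · refine (key (fun j z => euclGrad (ψ j) z - g z) (fun j z => euclGrad (ψ' j) z - g' z)
      (fun j => ((hψ j).memLp_euclGrad.sub hg).1) (fun j => ((hψ' j).memLp_euclGrad.sub hg').1)
      h2 h2').congr fun j => ?_
    congr 1; ext1 z
    rw [((hψ j).const_mul c).euclGrad_add ((hψ' j).const_mul d), (hψ j).euclGrad_const_mul,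
      (hψ' j).euclGrad_const_mul]
    simp only [Pi.add_apply, Pi.smul_apply, smul_sub]
    abel

lemma measurableSet_euclBall (c : Pt n) (r : ℝ) : MeasurableSet (euclBall c r) :=
  (isOpen_lt (by fun_prop) continuous_const).measurableSet

lemma euclBall_subset_ball (c : Pt n) (r : ℝ) : euclBall c r ⊆ Metric.ball c r := fun z hz => by
  rw [Metric.mem_ball, dist_eq_norm]
  exact (norm_le_euclNorm _).trans_lt hz

lemma halfMeasure_euclBall_lt_top [Fact (-1 < a)] (c : Pt n) (r : ℝ) :
    halfMeasure n a (euclBall c r) < ∞ :=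
  (measure_mono (euclBall_subset_ball c r)).trans_lt measure_ball_lt_top

/-- Positive mass ensures that an average over a half ball stays among the values averaged; needed
for the traces of test functions. -/
lemma halfMeasure_euclBall_ne_zero (x : EuclideanSpace ℝ (Fin n)) {r : ℝ} (hr : 0 < r) :
    halfMeasure n a (euclBall (x, 0) r) ≠ 0 := by
  unfold halfMeasure
  rw [Ne, withDensity_apply_eq_zero' (by fun_prop),
    Measure.restrict_apply' (measurableSet_lt measurable_const measurable_snd)]
  have hsub : {z : Pt n | euclNorm (z - (x, 0)) < r} ∩ {z | 0 < z.2} ⊆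
      ({z : Pt n | ENNReal.ofReal (z.2 ^ a) ≠ 0} ∩ euclBall (x, 0) r) ∩ {z | 0 < z.2} := by
    rintro z ⟨hz, hz'⟩
    refine ⟨⟨?_, hz⟩, hz'⟩
    have : 0 < z.2 ^ a := Real.rpow_pos_of_pos hz' a
    simpa using this
  refine fun h0 => ?_
  have ho : IsOpen ({z : Pt n | euclNorm (z - (x, 0)) < r} ∩ {z | 0 < z.2}) :=
    (isOpen_lt (by fun_prop) continuous_const).inter (isOpen_lt continuous_const continuous_snd)
  have hne : ({z : Pt n | euclNorm (z - (x, 0)) < r} ∩ {z | 0 < z.2}).Nonempty := by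
    refine ⟨(x, r / 2), ?_, by simpa using hr⟩
    simp only [mem_ofPred_eq, euclNorm, Prod.mk_sub_mk, sub_self, sub_zero, norm_zero]
    rw [Real.sqrt_lt' hr]
    nlinarith
  exact (ho.measure_pos volume hne).ne' (measure_mono_null hsub h0)

lemma HasTraceValue.linComb [Fact (-1 < a)] {u u' : Pt n → ℝ} {x : EuclideanSpace ℝ (Fin n)}
    {τ τ' : ℝ} (h : HasTraceValue a u x τ) (h' : HasTraceValue a u' x τ')
    (hu : MemLp u 2 (halfMeasure n a)) (hu' : MemLp u' 2 (halfMeasure n a)) (c d : ℝ) :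
    HasTraceValue a (fun z => c * u z + d * u' z) x (c * τ + d * τ') := by
  refine ((h.const_mul c).add (h'.const_mul d)).congr fun r => ?_
  have hi : ∀ {f : Pt n → ℝ}, MemLp f 2 (halfMeasure n a) →
      IntegrableOn f (euclBall (x, 0) r) (halfMeasure n a) := by
    intro f hf
    have : IsFiniteMeasure ((halfMeasure n a).restrict (euclBall (x, 0) r)) :=
      ⟨by simpa using halfMeasure_euclBall_lt_top _ _⟩
    exact (hf.restrict _).integrable (by norm_num)
  rw [setAverage_eq, setAverage_eq, setAverage_eq,
    integral_add ((hi hu).const_mul c) ((hi hu').const_mul d), integral_const_mul,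
    integral_const_mul]
  simp only [smul_eq_mul]; ring

lemma IsTest.hasTraceValue [Fact (-1 < a)] {ψ : Pt n → ℝ} (h : IsTest ψ)
    (x : EuclideanSpace ℝ (Fin n)) : HasTraceValue a ψ x (ψ (x, 0)) := by
  rw [HasTraceValue, Metric.tendsto_nhds]
  intro ε hε
  obtain ⟨δ, hδ, hδ'⟩ := Metric.continuousAt_iff.1
    (h.continuous.continuousAt (x := ((x, 0) : Pt n))) (ε / 2) (half_pos hε)
  filter_upwards [Ioo_mem_nhdsGT hδ] with r hr
  have h0 := halfMeasure_euclBall_ne_zero (a := a) x hr.1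
  have h1 := halfMeasure_euclBall_lt_top (a := a) ((x, 0) : Pt n) r
  have hi : IntegrableOn ψ (euclBall (x, 0) r) (halfMeasure n a) :=
    (h.continuous.integrable_of_hasCompactSupport h.2).integrableOn
  have hmem : ⨍ z in euclBall (x, 0) r, ψ z ∂halfMeasure n a ∈
      Metric.closedBall (ψ (x, 0)) (ε / 2) := by
    refine (convex_closedBall _ _).set_average_mem Metric.isClosed_closedBall h0 h1.ne ?_ hi
    refine (ae_restrict_iff' (measurableSet_euclBall _ _)).2 (ae_of_all _ fun z hz => ?_)
    exact (hδ' ((euclBall_subset_ball _ _ hz).trans hr.2)).le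
  exact lt_of_le_of_lt hmem (by linarith)

/-! ### The Dirichlet energy -/

lemma normSq_add (z w : Pt n) : normSq (z + w) = normSq z + 2 * euclDot z w + normSq w := by
  rw [← euclDot_self, euclDot_add_left, euclDot_add_right, euclDot_add_right, euclDot_self,
    euclDot_self, euclDot_comm w z]
  ring

lemma euclNorm_add_le (z w : Pt n) : euclNorm (z + w) ≤ euclNorm z + euclNorm w := by
  have h1 := euclNorm_nonneg z
  have h2 := euclNorm_nonneg w
  refine Real.sqrt_le_iff.2 ⟨by positivity, ?_⟩
  have h3 := normSq_add z w
  have h4 := (abs_le.1 (abs_euclDot_le z w)).2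
  have h5 := euclNorm_sq z
  have h6 := euclNorm_sq w
  change normSq (z + w) ≤ _
  nlinarith

lemma energy_eq_eLpNorm_sq (g : Pt n → Pt n) :
    energy a g = eLpNorm (fun z => euclNorm (g z)) 2 (halfMeasure n a) ^ 2 := by
  rw [eLpNorm_eq_lintegral_rpow_enorm_toReal (by simp) (by simp), ← ENNReal.rpow_natCast,
    ← ENNReal.rpow_mul]
  simp only [ENNReal.toReal_ofNat, Nat.cast_ofNat, one_div, ne_eq, OfNat.ofNat_ne_zero,
    not_false_eq_true, inv_mul_cancel₀, ENNReal.rpow_one, energy]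
  congr 1; ext z
  rw [Real.enorm_of_nonneg (euclNorm_nonneg _), ENNReal.ofReal_rpow_of_nonneg (euclNorm_nonneg _)
    (by norm_num)]
  simp

lemma energy_eq_ofReal {g : Pt n → Pt n} (hg : MemLp g 2 (halfMeasure n a)) :
    energy a g = ENNReal.ofReal (∫ z, euclDot (g z) (g z) ∂halfMeasure n a) := by
  have := integrable_bilinear (euclDotL n) hg hg
  simp only [euclDotL_apply] at this
  rw [ofReal_integral_eq_lintegral_ofReal this
    (ae_of_all _ fun z => by simp only [Pi.zero_apply, euclDot_self]; exact normSq_nonneg _)]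
  unfold energy
  simp_rw [euclDot_self, euclNorm_sq]

/-- The energy is continuous under L² convergence of gradients, so the bound valid for admissible
functions survives in their closure. -/
lemma sCap_le_energy_of_tendsto {A : Set (EuclideanSpace ℝ (Fin n))} {u : ℕ → Pt n → ℝ}
    {v : ℕ → Pt n → Pt n} {g : Pt n → Pt n} (hadm : ∀ j, IsAdmissible a A (u j) (v j))
    (hg : MemLp g 2 (halfMeasure n a))
    (h : Tendsto (fun j => eLpNorm (fun z => v j z - g z) 2 (halfMeasure n a)) atTop (𝓝 0)) :
    sCap a A ≤ energy a g := by
  have hcap : ∀ j, sCap a A ≤ energy a (v j) := fun j =>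
    iInf_le_of_le (u j) (iInf_le_of_le (v j) (iInf_le _ (hadm j)))
  have hm : ∀ {f : Pt n → Pt n}, AEStronglyMeasurable f (halfMeasure n a) →
      AEStronglyMeasurable (fun z => euclNorm (f z)) (halfMeasure n a) := fun hf =>
    continuous_euclNorm.comp_aestronglyMeasurable hf
  have hle : ∀ j, eLpNorm (fun z => euclNorm (v j z)) 2 (halfMeasure n a) ≤
      ENNReal.ofReal 2 * eLpNorm (fun z => v j z - g z) 2 (halfMeasure n a) +
        eLpNorm (fun z => euclNorm (g z)) 2 (halfMeasure n a) := by
    intro j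
    have h1 : eLpNorm (fun z => euclNorm (v j z - g z)) 2 (halfMeasure n a) ≤
        ENNReal.ofReal 2 * eLpNorm (fun z => v j z - g z) 2 (halfMeasure n a) := by
      refine eLpNorm_le_mul_eLpNorm_of_ae_le_mul (ae_of_all _ fun z => ?_) 2
      rw [Real.norm_of_nonneg (euclNorm_nonneg _)]
      exact euclNorm_le _
    refine le_trans ?_ (add_le_add h1 le_rfl)
    refine le_trans (eLpNorm_mono_real fun z => ?_)
      (eLpNorm_add_le (hm ((hadm j).1.2.1.1.sub hg.1)) (hm hg.1) (by norm_num))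
    rw [Real.norm_of_nonneg (euclNorm_nonneg _)]
    simpa using euclNorm_add_le (v j z - g z) (g z)
  have hlim : Tendsto (fun j => (ENNReal.ofReal 2 * eLpNorm (fun z => v j z - g z) 2
      (halfMeasure n a) + eLpNorm (fun z => euclNorm (g z)) 2 (halfMeasure n a)) ^ 2) atTop
      (𝓝 ((ENNReal.ofReal 2 * 0 + eLpNorm (fun z => euclNorm (g z)) 2 (halfMeasure n a)) ^ 2)) :=
    ENNReal.Tendsto.pow ((ENNReal.Tendsto.const_mul h (Or.inr ENNReal.ofReal_ne_top)).add_const _)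
  rw [mul_zero, zero_add, ← energy_eq_eLpNorm_sq] at hlim
  refine ge_of_tendsto' hlim fun j => (hcap j).trans ?_
  rw [energy_eq_eLpNorm_sq]
  gcongr
  exact hle j

/-- First-order condition for a one-sided minimum: the quadratic expansion gives 0 ≤ t(2b + tc);
divide by t and let t → 0+. -/
lemma integral_euclDot_nonneg_of_forall_energy_le {g w : Pt n → Pt n}
    (hg : MemLp g 2 (halfMeasure n a)) (hw : MemLp w 2 (halfMeasure n a))
    (h : ∀ t : ℝ, 0 < t → t ≤ 1 → energy a g ≤ energy a (fun z => g z + t • w z)) :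
    0 ≤ ∫ z, euclDot (g z) (w z) ∂halfMeasure n a := by
  have hi := integrable_bilinear (euclDotL n) hg hw
  have hgg := integrable_bilinear (euclDotL n) hg hg
  have hww := integrable_bilinear (euclDotL n) hw hw
  simp only [euclDotL_apply] at hi hgg hww
  set b := ∫ z, euclDot (g z) (w z) ∂halfMeasure n a
  set c := ∫ z, euclDot (w z) (w z) ∂halfMeasure n a
  have key : ∀ t : ℝ, 0 < t → t ≤ 1 → 0 ≤ 2 * b + t * c := by
    intro t ht ht1
    have h1 : _ ≤ energy a (g + t • w) := h t ht ht1
    have e : ∀ z, euclDot (g z + t • w z) (g z + t • w z) =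
        euclDot (g z) (g z) + (2 * t * euclDot (g z) (w z) + t ^ 2 * euclDot (w z) (w z)) := by
      intro z
      rw [euclDot_self, normSq_add, euclDot_smul_right, ← euclDot_self (t • w z),
        euclDot_smul_left, euclDot_smul_right, euclDot_self, euclDot_self]
      ring
    rw [energy_eq_ofReal hg, energy_eq_ofReal (hg.add (hw.const_smul t)),
      ENNReal.ofReal_le_ofReal_iff (integral_nonneg fun z => by
        simp only [Pi.zero_apply, Pi.add_apply, euclDot_self]; exact normSq_nonneg _)] at h1
    have e2 : ∫ z, euclDot ((g + t • w) z) ((g + t • w) z) ∂halfMeasure n a =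
        ∫ z, euclDot (g z) (g z) ∂halfMeasure n a + (2 * t * b + t ^ 2 * c) := by
      simp only [Pi.add_apply, Pi.smul_apply, e]
      rw [integral_add hgg ((hi.const_mul _).fun_add (hww.const_mul _)),
        integral_add (hi.const_mul _) (hww.const_mul _), integral_const_mul, integral_const_mul]
    rw [e2] at h1
    have : 0 ≤ t * (2 * b + t * c) := by nlinarith
    exact nonneg_of_mul_nonneg_right this ht
  have hlim : Tendsto (fun t : ℝ => 2 * b + t * c) (𝓝[>] 0) (𝓝 (2 * b + 0 * c)) :=
    (Continuous.tendsto (by fun_prop) 0).mono_left nhdsWithin_le_nhds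
  have := ge_of_tendsto hlim (b := 0) (by
    filter_upwards [Ioo_mem_nhdsGT zero_lt_one] with t ht using key t ht.1 ht.2.le)
  linarith

/-! ### First variation of the energy at a capacitary potential -/

section Variation

variable {A : Set (EuclideanSpace ℝ (Fin n))} {φ : Pt n → ℝ} {g : Pt n → Pt n}

lemma IsAdmissible.linComb [Fact (-1 < a)] {u : Pt n → ℝ} {v : Pt n → Pt n}
    (h : IsAdmissible a A u v) {ψ : Pt n → ℝ} (hψ : IsTest ψ) {c d : ℝ}
    (hcd : ∀ x ∈ A, ∀ τ : ℝ, 1 ≤ τ → 1 ≤ c * τ + d * ψ (x, 0)) :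
    IsAdmissible a A (fun z => c * u z + d * ψ z) (fun z => c • v z + d • euclGrad ψ z) := by
  refine ⟨h.1.linComb hψ.isSobolev c d, fun x hx => ?_⟩
  obtain ⟨τ, hτ, hτ'⟩ := h.2 x hx
  exact ⟨_, hcd x hx τ hτ, hτ'.linComb (hψ.hasTraceValue x) h.1.1 hψ.memLp c d⟩

/-- The potential itself may fail to be admissible, so the combination is formed along the
approximating sequence. The condition `hcd` is quantified over all traces τ ≥ 1 because those of the
approximants are not prescribed. -/
lemma IsInEnergyClosure.sCap_le_energy_linComb [Fact (-1 < a)] (h : IsInEnergyClosure a A φ g)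
    {ψ : Pt n → ℝ} (hψ : IsTest ψ) {c d : ℝ}
    (hcd : ∀ x ∈ A, ∀ τ : ℝ, 1 ≤ τ → 1 ≤ c * τ + d * ψ (x, 0)) :
    sCap a A ≤ energy a (fun z => c • g z + d • euclGrad ψ z) := by
  obtain ⟨_, hg, u, v, hadm, hv, _⟩ := h
  refine sCap_le_energy_of_tendsto (fun j => (hadm j).linComb hψ hcd)
    ((hg.const_smul c).add (hψ.memLp_euclGrad.const_smul d)) ?_
  have hlim := ENNReal.Tendsto.const_mul hv (a := ‖c‖ₑ) (Or.inr enorm_ne_top)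
  rw [mul_zero] at hlim
  refine hlim.congr fun j => ?_
  rw [← eLpNorm_const_smul]
  congr 1; ext1 z
  simp [smul_sub]

/-- The first variation of the energy at a potential is a positive functional. -/
lemma IsInEnergyClosure.integral_euclDot_nonneg [Fact (-1 < a)] (h : IsInEnergyClosure a A φ g)
    (hE : energy a g = sCap a A) {ψ : Pt n → ℝ} (hψ : IsTest ψ) (hpos : ∀ x ∈ A, 0 ≤ ψ (x, 0)) :
    0 ≤ ∫ z, euclDot (g z) (euclGrad ψ z) ∂halfMeasure n a := by
  refine integral_euclDot_nonneg_of_forall_energy_le h.2.1 hψ.memLp_euclGrad fun t ht _ => ?_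
  rw [hE]
  have := h.sCap_le_energy_linComb hψ (c := 1) (d := t) fun x hx τ hτ => by
    have := mul_nonneg ht.le (hpos x hx); linarith
  simpa using this

/-- The total mass of the first variation of the energy at a potential is the capacity. -/
lemma IsInEnergyClosure.ofReal_integral_euclDot [Fact (-1 < a)] (h : IsInEnergyClosure a A φ g)
    (hE : energy a g = sCap a A) {η : Pt n → ℝ} (hη : IsTest η) (hone : ∀ x ∈ A, η (x, 0) = 1) :
    ENNReal.ofReal (∫ z, euclDot (g z) (euclGrad η z) ∂halfMeasure n a) = sCap a A := by
  have hg := h.2.1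
  have hη' := hη.memLp_euclGrad (a := a)
  -- Since η has trace 1 on A, both (1 - t)u + tη and, in `h2`, (1 + t)u - tη remain admissible; the
  -- two opposite inequalities force ∫ g·∇η = ∫ |g|².
  have h1 : 0 ≤ ∫ z, euclDot (g z) ((euclGrad η - g) z) ∂halfMeasure n a := by
    refine integral_euclDot_nonneg_of_forall_energy_le hg (hη'.sub hg) fun t ht ht1 => ?_
    rw [hE]
    have := h.sCap_le_energy_linComb hη (c := 1 - t) (d := t) fun x hx τ hτ => by
      rw [hone x hx]; nlinarith
    convert this using 2
    ext1 z
    simp only [Pi.sub_apply, smul_sub, sub_smul, one_smul]; abel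
  have h2 : 0 ≤ ∫ z, euclDot (g z) ((g - euclGrad η) z) ∂halfMeasure n a := by
    refine integral_euclDot_nonneg_of_forall_energy_le hg (hg.sub hη') fun t ht ht1 => ?_
    rw [hE]
    have := h.sCap_le_energy_linComb hη (c := 1 + t) (d := -t) fun x hx τ hτ => by
      rw [hone x hx]; nlinarith
    convert this using 2
    ext1 z
    simp only [Pi.sub_apply, smul_sub, add_smul, one_smul, neg_smul]; abel
  have hi := integrable_bilinear (euclDotL n) hg hη'
  have hgg := integrable_bilinear (euclDotL n) hg hg
  simp only [euclDotL_apply] at hi hgg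
  have e1 : ∫ z, euclDot (g z) ((euclGrad η - g) z) ∂halfMeasure n a =
      ∫ z, euclDot (g z) (euclGrad η z) ∂halfMeasure n a -
        ∫ z, euclDot (g z) (g z) ∂halfMeasure n a := by
    rw [← integral_sub hi hgg]
    congr 1; ext z
    rw [euclDot_comm, Pi.sub_apply, euclDot_sub_left, euclDot_comm]
  have e2 : ∫ z, euclDot (g z) ((g - euclGrad η) z) ∂halfMeasure n a =
      ∫ z, euclDot (g z) (g z) ∂halfMeasure n a -
        ∫ z, euclDot (g z) (euclGrad η z) ∂halfMeasure n a := by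
    rw [← integral_sub hgg hi]
    congr 1; ext z
    rw [euclDot_comm, Pi.sub_apply, euclDot_sub_left, euclDot_comm (euclGrad η z)]
  rw [← hE, energy_eq_ofReal hg]
  congr 1
  linarith

end Variation

/-! ### The capacitary measure -/

section

open scoped CompactlySupported

lemma exists_isTest_eq_one (r : ℝ) :
    ∃ η : Pt n → ℝ, IsTest η ∧ (∀ z, 0 ≤ η z ∧ η z ≤ 1) ∧ ∀ z, ‖z‖ ≤ r → η z = 1 := by
  let f : ContDiffBump (0 : Pt n) := ⟨max r 1, max r 1 + 1, by positivity, by linarith⟩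
  refine ⟨f, ⟨f.contDiff, f.hasCompactSupport⟩, fun z => ⟨f.nonneg, f.le_one⟩, fun z hz => ?_⟩
  exact f.one_of_mem_closedBall (by simpa [f] using Or.inl hz)

/-- The space of test functions. -/
def testSubmodule (n : ℕ) : Submodule ℝ (Pt n → ℝ) where
  carrier := {ψ | IsTest ψ}
  zero_mem' := ⟨contDiff_const, HasCompactSupport.zero⟩
  add_mem' h h' := h.add h'
  smul_mem' c _ h := h.const_mul c

/-- Restriction of test functions to a subset of `{y = 0}`. -/
def testRestrict (K : Set (EuclideanSpace ℝ (Fin n))) :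
    testSubmodule n →ₗ[ℝ] C(K, ℝ) where
  toFun ψ := ⟨fun x => ψ.1 (x, 0), ψ.2.continuous.comp (by fun_prop)⟩
  map_add' _ _ := by ext; rfl
  map_smul' _ _ := by ext; rfl

lemma testRestrict_apply (K : Set (EuclideanSpace ℝ (Fin n)))
    (ψ : testSubmodule n) (x : K) : testRestrict K ψ x = ψ.1 (x, 0) := rfl

/-- The cone of nonnegative functions. -/
def nonnegCone (X : Type*) [TopologicalSpace X] : PointedCone ℝ C(X, ℝ) where
  carrier := {f | ∀ x, 0 ≤ f x}
  zero_mem' _ := le_rfl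
  add_mem' h h' x := add_nonneg (h x) (h' x)
  smul_mem' c _ h x := mul_nonneg c.2 (h x)

/-- A positive functional on test functions that only depends on the values on a compact subset
`K` of `{y = 0}` is a measure on `K`. -/
lemma exists_measure_of_nonneg {K : Set (EuclideanSpace ℝ (Fin n))} (hK : IsCompact K)
    (L : testSubmodule n →ₗ[ℝ] ℝ) (hL : ∀ ψ, (∀ x ∈ K, 0 ≤ ψ.1 (x, 0)) → 0 ≤ L ψ) :
    ∃ m : Measure K, IsFiniteMeasure m ∧ ∀ ψ, ∫ x : K, ψ.1 (x, 0) ∂m = L ψ := by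
  have : CompactSpace K := isCompact_iff_compactSpace.1 hK
  let res := testRestrict K
  -- A linear section moves `L` to the range of `res`. The choice of preimage is immaterial: if ψ =
  -- χ on K, then L(ψ - χ) and L(χ - ψ) are both nonnegative (`hLeq`).
  obtain ⟨s, hs⟩ := res.rangeRestrict.exists_rightInverse_of_surjective res.range_rangeRestrict
  have hLeq : ∀ ψ χ, res ψ = res χ → L ψ = L χ := by
    intro ψ χ h
    have hval : ∀ x ∈ K, ψ.1 (x, 0) = χ.1 (x, 0) := fun x hx =>
      DFunLike.congr_fun h (⟨x, hx⟩ : K)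
    have h1 : 0 ≤ L (ψ - χ) := hL _ fun x hx => by simp [hval x hx]
    have h2 : 0 ≤ L (χ - ψ) := hL _ fun x hx => by simp [hval x hx]
    rw [map_sub] at h1 h2
    linarith
  have hres : ∀ y, res (s y) = y.1 := fun y => congrArg Subtype.val (LinearMap.congr_fun hs y)
  let f : C(K, ℝ) →ₗ.[ℝ] ℝ := ⟨LinearMap.range res, L ∘ₗ s⟩
  obtain ⟨η, hη, -, hη1⟩ : ∃ η : Pt n → ℝ, IsTest η ∧ (∀ z, 0 ≤ η z ∧ η z ≤ 1) ∧
      ∀ x ∈ K, η (x, 0) = 1 := by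
    obtain ⟨r, hr⟩ := hK.isBounded.exists_norm_le
    obtain ⟨η, h1, h2, h3⟩ := exists_isTest_eq_one (n := n) r
    exact ⟨η, h1, h2, fun x hx => h3 _ (by simpa using hr x hx)⟩
  -- Restrictions of test functions form only a subspace of C(K). A positive extension exists
  -- because this subspace contains the constants (η is 1 on K) and so dominates every continuous
  -- function.
  obtain ⟨Λ, hΛ, hΛ0⟩ := riesz_extension (nonnegCone K) f
    (fun y hy => hL _ fun x hx => by
      have : res (s y) ⟨x, hx⟩ = y.1 ⟨x, hx⟩ := by rw [hres]
      change 0 ≤ res (s y) ⟨x, hx⟩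
      rw [this]; exact hy _)
    (fun y => by
      obtain ⟨C, hC⟩ := (isCompact_range y.continuous).isBounded.exists_norm_le
      refine ⟨⟨res (C • ⟨η, hη⟩), LinearMap.mem_range_self _ _⟩, fun x => ?_⟩
      have h1 : -C ≤ y x := (abs_le.1 (hC _ (mem_range_self x))).1
      have h2 : res (C • ⟨η, hη⟩) x = C := by
        rw [testRestrict_apply]; simp [hη1 x x.2]
      change 0 ≤ res (C • ⟨η, hη⟩) x + y x
      rw [h2]; linarith)
  let Λ' : C_c(K, ℝ) →ₚ[ℝ] ℝ := PositiveLinearMap.mk₀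
    { toFun := fun y => Λ y.toContinuousMap
      map_add' := fun y y' => Λ.map_add y.toContinuousMap y'.toContinuousMap
      map_smul' := fun c y => Λ.map_smul c y.toContinuousMap } fun y hy => hΛ0 _ hy
  refine ⟨RealRMK.rieszMeasure Λ', inferInstance, fun ψ => ?_⟩
  have h1 := RealRMK.integral_rieszMeasure Λ' ⟨res ψ, HasCompactSupport.of_compactSpace _⟩
  refine h1.trans ?_
  change Λ (res ψ) = L ψ
  have h2 := hΛ ⟨res ψ, LinearMap.mem_range_self _ _⟩
  exact h2.trans (hLeq _ _ (hres _))

/-- The first variation of the energy at `g`, as a functional on test functions. -/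
def firstVariation [Fact (-1 < a)] {g : Pt n → Pt n} (hg : MemLp g 2 (halfMeasure n a)) :
    testSubmodule n →ₗ[ℝ] ℝ where
  toFun ψ := ∫ z, euclDot (g z) (euclGrad ψ.1 z) ∂halfMeasure n a
  map_add' ψ χ := by
    have h1 := integrable_bilinear (euclDotL n) hg (IsTest.memLp_euclGrad ψ.2)
    have h2 := integrable_bilinear (euclDotL n) hg (IsTest.memLp_euclGrad χ.2)
    simp only [euclDotL_apply] at h1 h2
    rw [← integral_add h1 h2]
    congr 1; ext z
    have := IsTest.euclGrad_add ψ.2 χ.2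
    change euclDot (g z) (euclGrad (fun z => ψ.1 z + χ.1 z) z) = _
    rw [this, Pi.add_apply, euclDot_add_right]
  map_smul' c ψ := by
    rw [RingHom.id_apply, smul_eq_mul, ← integral_const_mul]
    congr 1; ext z
    have := IsTest.euclGrad_const_mul c ψ.2
    change euclDot (g z) (euclGrad (fun z => c * ψ.1 z) z) = _
    rw [this, Pi.smul_apply, euclDot_smul_right]

/-- The capacitary measure of a set `A` contained in a compact set `K`. -/
lemma IsInEnergyClosure.exists_measure [Fact (-1 < a)] {A K : Set (EuclideanSpace ℝ (Fin n))}
    {φ : Pt n → ℝ} {g : Pt n → Pt n} (h : IsInEnergyClosure a A φ g)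
    (hE : energy a g = sCap a A) (hK : IsCompact K) (hAK : A ⊆ K) :
    ∃ m : Measure K, IsFiniteMeasure m ∧ m univ = sCap a A ∧ ∀ ψ, IsTest ψ →
      ∫ x : K, ψ (x, 0) ∂m = ∫ z, euclDot (g z) (euclGrad ψ z) ∂halfMeasure n a := by
  obtain ⟨m, hm, hmL⟩ := exists_measure_of_nonneg hK (firstVariation h.2.1) fun ψ hψ =>
    h.integral_euclDot_nonneg hE ψ.2 fun x hx => hψ x (hAK hx)
  refine ⟨m, hm, ?_, fun ψ hψ => hmL ⟨ψ, hψ⟩⟩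
  obtain ⟨r, hr⟩ := hK.isBounded.exists_norm_le
  obtain ⟨η, h1, -, h3⟩ := exists_isTest_eq_one (n := n) r
  have hη : ∀ x ∈ K, η (x, 0) = 1 := fun x hx => h3 _ (by simpa using hr x hx)
  have h4 : ∫ x : K, η (x, 0) ∂m = _ := hmL ⟨η, h1⟩
  have h5 := h.ofReal_integral_euclDot hE h1 fun x hx => hη x (hAK hx)
  change _ = ∫ z, euclDot (g z) (euclGrad η z) ∂halfMeasure n a at h4
  rw [← h5, ← h4]
  have : ∀ x : K, η (x, 0) = 1 := fun x => hη x x.2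
  simp [this, Measure.real]

end

/-! ### The Gaussian transform of a potential -/

lemma gauss_mk_zero (t : ℝ) (x x' : EuclideanSpace ℝ (Fin n)) :
    gauss t x (x', 0) = Real.exp (-t * ‖x' - x‖ ^ 2) := by
  rw [gauss, normSq_sub_mk]; simp

lemma gauss_le_one {t : ℝ} (ht : 0 ≤ t) (x : EuclideanSpace ℝ (Fin n)) (z : Pt n) :
    gauss t x z ≤ 1 := by
  rw [gauss, Real.exp_le_one_iff]
  have := mul_nonneg ht (normSq_nonneg (z - (x, 0)))
  linarith

/-- The representation of the first variation by a measure extends to Gaussians. -/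
lemma integral_gauss_eq_of_forall_isTest [h' : Fact (-1 < a)]
    {K : Set (EuclideanSpace ℝ (Fin n))} {m : Measure K} [IsFiniteMeasure m] {g : Pt n → Pt n}
    (hg : MemLp g 2 (halfMeasure n a))
    (hm : ∀ ψ, IsTest ψ →
      ∫ x : K, ψ (x, 0) ∂m = ∫ z, euclDot (g z) (euclGrad ψ z) ∂halfMeasure n a)
    {t : ℝ} (ht : 0 < t) (x : EuclideanSpace ℝ (Fin n)) :
    ∫ x' : K, gauss t x (x', 0) ∂m =
      -(2 * t) * ∫ z, gauss t x z * euclDot (g z) (z - (x, 0)) ∂halfMeasure n a := by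
  have ha : -1 < a := h'.out
  obtain ⟨η, hη, hη01, hη1⟩ := exists_isTest_eq_one (n := n) 1
  obtain ⟨C, hC⟩ := hη.continuous_fderiv.bounded_above_of_compact_support (hη.2.fderiv (𝕜 := ℝ))
  have hC0 : 0 ≤ C := (norm_nonneg _).trans (hC 0)
  let c : ℕ → ℝ := fun k => ((k : ℝ) + 1)⁻¹
  have hc0 : ∀ k, 0 < c k := fun k => by positivity
  have hc1 : ∀ k, c k ≤ 1 := fun k => inv_le_one_of_one_le₀ (by simp)
  have hclim : Tendsto c atTop (𝓝 0) := by
    simpa [c, one_div] using tendsto_one_div_add_atTop_nhds_zero_nat (𝕜 := ℝ)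
  -- Gaussians lack compact support. The dilated cut-offs tend to 1, and their derivatives carry a
  -- factor `c k`, so the extra term of the product rule disappears in the limit.
  let χ : ℕ → Pt n → ℝ := fun k z => η (c k • z)
  have hχd : ∀ k, ContDiff ℝ ((⊤ : ℕ∞) : WithTop ℕ∞) (χ k) := fun k =>
    hη.1.comp (contDiff_const_smul _)
  have hχ : ∀ k, IsTest (χ k) := fun k => ⟨hχd k, hη.2.comp_smul (hc0 k).ne'⟩
  have hfχ : ∀ k z, fderiv ℝ (χ k) z = c k • fderiv ℝ η (c k • z) := fun k z =>
    fderiv_comp_smul (c k)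
  have hψ : ∀ k, IsTest (fun z => gauss t x z * χ k z) := fun k => (hχ k).mul_left (contDiff_gauss t x)
  have hχev : ∀ z, ∀ᶠ k in atTop, χ k z = 1 := by
    intro z
    have h1 : Tendsto (fun k => ‖c k • z‖) atTop (𝓝 ‖(0 : ℝ) • z‖) :=
      (hclim.smul_const z).norm
    rw [zero_smul, norm_zero] at h1
    filter_upwards [h1.eventually_le_const zero_lt_one] with k hk using hη1 _ hk
  have hL : Tendsto (fun k => ∫ x' : K, gauss t x (x', 0) * χ k (x', 0) ∂m) atTop
      (𝓝 (∫ x' : K, gauss t x (x', 0) ∂m)) := by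
    refine tendsto_integral_of_dominated_convergence (fun _ => 1) (fun k => ?_)
      (integrable_const _) (fun k => ae_of_all _ fun x' => ?_) (ae_of_all _ fun x' => ?_)
    · exact ((hψ k).continuous.comp (by fun_prop : Continuous fun x' : K =>
        ((x' : EuclideanSpace ℝ (Fin n)), (0 : ℝ)))).aestronglyMeasurable
    · rw [Real.norm_of_nonneg (mul_nonneg (gauss_pos _ _ _).le (hη01 _).1)]
      exact mul_le_one₀ (gauss_le_one ht.le _ _) (hη01 _).1 (hη01 _).2
    · refine tendsto_const_nhds.congr' ?_
      filter_upwards [hχev (x', 0)] with k hk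
      rw [hk, mul_one]
  have hformula : ∀ k z, euclDot (g z) (euclGrad (fun z => gauss t x z * χ k z) z) =
      -(2 * t) * (gauss t x z * euclDot (g z) (z - (x, 0))) * χ k z +
        gauss t x z * (c k * fderiv ℝ η (c k • z) (g z)) := by
    intro k z
    rw [euclDot_comm, euclDot_euclGrad ((hψ k).differentiableAt z),
      fderiv_fun_mul (differentiable_gauss t x z) ((hχ k).differentiableAt z)]
    simp only [add_apply, smul_apply, smul_eq_mul, fderiv_gauss, hfχ]
    rw [euclDot_comm]; ring
  have hi1 : Integrable (fun z => gauss t x z * euclDot (g z) (z - (x, 0))) (halfMeasure n a) := by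
    have := integrable_bilinear (euclDotL n) hg (memLp_gauss_smul_sub ha ht x)
    simpa only [euclDotL_apply, euclDot_smul_right] using this
  have hgauss2 : MemLp (gauss t x) 2 (halfMeasure n a) :=
    memLp_of_le_gauss (C := 1) (m := 0) (x := x) ha ht
      (continuous_gauss t x).aestronglyMeasurable fun z => by
      simp [abs_of_pos (gauss_pos t x z)]
  have hi2 : Integrable (fun z => gauss t x z * ‖g z‖) (halfMeasure n a) :=
    hgauss2.integrable_mul hg.norm
  have hR : Tendsto (fun k => ∫ z, euclDot (g z) (euclGrad (fun z => gauss t x z * χ k z) z)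
      ∂halfMeasure n a) atTop
      (𝓝 (∫ z, -(2 * t) * (gauss t x z * euclDot (g z) (z - (x, 0))) ∂halfMeasure n a)) := by
    refine tendsto_integral_of_dominated_convergence
      (fun z => ‖-(2 * t) * (gauss t x z * euclDot (g z) (z - (x, 0)))‖ +
        C * (gauss t x z * ‖g z‖)) (fun k => ?_)
      ((hi1.const_mul _).norm.add (hi2.const_mul C)) (fun k => ae_of_all _ fun z => ?_)
      (ae_of_all _ fun z => ?_)
    · have := integrable_bilinear (euclDotL n) hg ((hψ k).memLp_euclGrad (a := a))
      simp only [euclDotL_apply] at this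
      exact this.1
    · rw [hformula]
      refine (norm_add_le _ _).trans (add_le_add ?_ ?_)
      · rw [norm_mul _ (χ k z)]
        refine mul_le_of_le_one_right (norm_nonneg _) ?_
        rw [Real.norm_of_nonneg (hη01 _).1]; exact (hη01 _).2
      · rw [norm_mul, norm_mul, Real.norm_of_nonneg (gauss_pos t x z).le,
          Real.norm_of_nonneg (hc0 k).le]
        have h1 : ‖fderiv ℝ η (c k • z) (g z)‖ ≤ C * ‖g z‖ :=
          ContinuousLinearMap.le_of_opNorm_le _ (hC _) _
        have h2 := (gauss_pos t x z).le
        calc _ ≤ gauss t x z * (1 * (C * ‖g z‖)) := by gcongr; exact hc1 k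
          _ = _ := by ring
    · have h1 : Tendsto (fun k => gauss t x z * (c k * fderiv ℝ η (c k • z) (g z))) atTop
          (𝓝 (gauss t x z * 0)) := by
        refine Tendsto.const_mul _ ?_
        refine squeeze_zero_norm (fun k => ?_) (a := fun k => c k * (C * ‖g z‖))
          (by simpa using hclim.mul_const (C * ‖g z‖))
        rw [norm_mul, Real.norm_of_nonneg (hc0 k).le]
        exact mul_le_mul_of_nonneg_left
          (ContinuousLinearMap.le_of_opNorm_le _ (hC _) _) (hc0 k).le
      rw [mul_zero] at h1
      have h2 : Tendsto (fun k => -(2 * t) * (gauss t x z * euclDot (g z) (z - (x, 0))) * χ k z)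
          atTop (𝓝 (-(2 * t) * (gauss t x z * euclDot (g z) (z - (x, 0))))) := by
        refine tendsto_const_nhds.congr' ?_
        filter_upwards [hχev z] with k hk
        rw [hk, mul_one]
      have h3 := h2.add h1
      rw [add_zero] at h3
      exact h3.congr fun k => (hformula k z).symm
  rw [integral_const_mul] at hR
  exact tendsto_nhds_unique (hL.congr fun k => hm _ (hψ k)) hR

lemma gauss_anti {s t : ℝ} (h : s ≤ t) (x : EuclideanSpace ℝ (Fin n)) (z : Pt n) :
    gauss t x z ≤ gauss s x z := by
  have := mul_le_mul_of_nonneg_right h (normSq_nonneg (z - (x, 0)))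
  exact Real.exp_le_exp.2 (by linarith)

lemma integrable_mul_gauss (ha : -1 < a) {φ : Pt n → ℝ}
    (hφ : MemLp (fun z => hardyWeight z * φ z) 2 (halfMeasure n a)) {t : ℝ} (ht : 0 < t)
    (x : EuclideanSpace ℝ (Fin n)) :
    Integrable (fun z => φ z * gauss t x z) (halfMeasure n a) :=
  (integrable_mul_of_le_gauss (C := 1) (m := 0) (t := t) (x := x) ha ht hφ
    (continuous_gauss t x).aestronglyMeasurable fun z => by
      simp [abs_of_pos (gauss_pos t x z)]).2

lemma integrable_mul_gauss_mul_normSq (ha : -1 < a) {φ : Pt n → ℝ}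
    (hφ : MemLp (fun z => hardyWeight z * φ z) 2 (halfMeasure n a)) {t : ℝ} (ht : 0 < t)
    (x : EuclideanSpace ℝ (Fin n)) :
    Integrable (fun z => φ z * (gauss t x z * normSq (z - (x, 0)))) (halfMeasure n a) := by
  refine (integrable_mul_of_le_gauss (t := t) (x := x) (m := 1)
    (C := |1| * (2 + 2 * ‖x‖ ^ 2) + |0|) ha ht hφ
    (Continuous.aestronglyMeasurable (by fun_prop)) fun z => ?_).2
  simpa only [one_mul, sub_zero] using abs_gauss_mul_le (t := t) x 1 0 z

lemma aestronglyMeasurable_of_hardyWeight_mul {φ : Pt n → ℝ}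
    (hφ : MemLp (fun z => hardyWeight z * φ z) 2 (halfMeasure n a)) :
    AEStronglyMeasurable φ (halfMeasure n a) := by
  have hc : Continuous fun z : Pt n => (hardyWeight z)⁻¹ :=
    continuous_hardyWeight.inv₀ fun z => (hardyWeight_pos z).ne'
  refine (hc.aestronglyMeasurable.mul hφ.1).congr (ae_of_all _ fun z => ?_)
  have := (hardyWeight_pos z).ne'
  simp only [Pi.mul_apply]
  field_simp

lemma hasDerivAt_integral_mul_gauss (ha : -1 < a) {φ : Pt n → ℝ}
    (hφ : MemLp (fun z => hardyWeight z * φ z) 2 (halfMeasure n a)) {t : ℝ} (ht : 0 < t)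
    (x : EuclideanSpace ℝ (Fin n)) :
    HasDerivAt (fun t => ∫ z, φ z * gauss t x z ∂halfMeasure n a)
      (-∫ z, φ z * (gauss t x z * normSq (z - (x, 0))) ∂halfMeasure n a) t := by
  have hφm := aestronglyMeasurable_of_hardyWeight_mul hφ
  rw [← integral_neg]
  refine (hasDerivAt_integral_of_dominated_loc_of_deriv_le (s := Ioi (t / 2))
    (F := fun t z => φ z * gauss t x z)
    (F' := fun t z => -(φ z * (gauss t x z * normSq (z - (x, 0)))))
    (bound := fun z => ‖φ z * (gauss (t / 2) x z * normSq (z - (x, 0)))‖)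
    (Ioi_mem_nhds (by linarith)) (Eventually.of_forall fun s => ?_)
    (integrable_mul_gauss ha hφ ht x) ?_ (ae_of_all _ fun z s hs => ?_)
    (integrable_mul_gauss_mul_normSq ha hφ (half_pos ht) x).norm
    (ae_of_all _ fun z s hs => ?_)).2
  · exact hφm.mul (continuous_gauss s x).aestronglyMeasurable
  · exact (integrable_mul_gauss_mul_normSq ha hφ ht x).1.neg
  · rw [norm_neg, norm_mul, norm_mul, norm_mul, norm_mul, Real.norm_of_nonneg (gauss_pos _ _ _).le,
      Real.norm_of_nonneg (gauss_pos _ _ _).le]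
    have : gauss s x z ≤ gauss (t / 2) x z := gauss_anti (le_of_lt hs) x z
    gcongr
  · have h1 : HasDerivAt (fun s : ℝ => -s * normSq (z - (x, 0))) (-1 * normSq (z - (x, 0))) s :=
      (hasDerivAt_neg s).mul_const _
    have h2 := (h1.exp).const_mul (φ z)
    refine h2.congr_deriv ?_
    rw [gauss]; ring

/-- The prefactor t^β is chosen so that the derivative is exactly the integral produced by the
dilation identity, which is what brings in the gradient of φ. -/
lemma hasDerivAt_rpow_mul_integral_gauss (ha : -1 < a) {φ : Pt n → ℝ}
    (hφ : MemLp (fun z => hardyWeight z * φ z) 2 (halfMeasure n a)) {t : ℝ} (ht : 0 < t)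
    (x : EuclideanSpace ℝ (Fin n)) :
    HasDerivAt (fun t => t ^ halfDim n a * ∫ z, φ z * gauss t x z ∂halfMeasure n a)
      (-(1 / 2) * t ^ (halfDim n a - 1) * ∫ z, φ z * (gauss t x z *
        (2 * t * normSq (z - (x, 0)) - 2 * halfDim n a)) ∂halfMeasure n a) t := by
  refine ((Real.hasDerivAt_rpow_const (p := halfDim n a) (Or.inl ht.ne')).mul
    (hasDerivAt_integral_mul_gauss ha hφ ht x)).congr_deriv ?_
  have e : ∀ z, φ z * (gauss t x z * (2 * t * normSq (z - (x, 0)) - 2 * halfDim n a)) =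
      2 * t * (φ z * (gauss t x z * normSq (z - (x, 0)))) -
        2 * halfDim n a * (φ z * gauss t x z) := fun z => by ring
  simp_rw [e]
  rw [integral_sub ((integrable_mul_gauss_mul_normSq ha hφ ht x).const_mul _)
    ((integrable_mul_gauss ha hφ ht x).const_mul _), integral_const_mul, integral_const_mul]
  have : t ^ halfDim n a = t ^ (halfDim n a - 1) * t := by
    rw [Real.rpow_sub_one ht.ne']; field_simp
  rw [this]; ring

lemma one_add_normSq_mul_gauss_le {t : ℝ} (ht : 0 < t) (ht1 : t ≤ 1)
    (x : EuclideanSpace ℝ (Fin n)) (z : Pt n) :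
    (1 + normSq z) * gauss t x z ^ 2 ≤ (2 + 2 * ‖x‖ ^ 2) * (2 / t) * gauss t x z := by
  have h1 := one_add_normSq_le z x
  set ρ := normSq (z - (x, 0)) with hρ
  have h0 : 0 ≤ ρ := normSq_nonneg _
  have hg := gauss_pos t x z
  have hg1 := gauss_le_one ht.le x z
  have h2 : (1 + ρ) * gauss t x z ≤ 2 / t := by
    have h3 : t * ρ * gauss t x z ≤ 1 := by
      have h4 : t * ρ ≤ Real.exp (t * ρ) := by linarith [Real.add_one_le_exp (t * ρ)]
      calc t * ρ * gauss t x z ≤ Real.exp (t * ρ) * gauss t x z := by gcongr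
        _ = 1 := by rw [gauss, ← Real.exp_add]; simp [hρ]
    rw [le_div_iff₀ ht]
    nlinarith
  calc (1 + normSq z) * gauss t x z ^ 2
      ≤ ((2 + 2 * ‖x‖ ^ 2) * (1 + ρ)) * gauss t x z ^ 2 := by gcongr
    _ = (2 + 2 * ‖x‖ ^ 2) * ((1 + ρ) * gauss t x z) * gauss t x z := by ring
    _ ≤ _ := by gcongr

/-- The initial value of the Gaussian transform. As t → 0 the Gaussian flattens, so this is where
the weighted L² bound acts as decay at infinity and excludes constants. -/
lemma tendsto_rpow_mul_integral_gauss_zero (ha : -1 < a) (hb : 1 < halfDim n a) {φ : Pt n → ℝ}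
    (hφ : MemLp (fun z => hardyWeight z * φ z) 2 (halfMeasure n a))
    (x : EuclideanSpace ℝ (Fin n)) :
    Tendsto (fun t : ℝ => t ^ halfDim n a * ∫ z, φ z * gauss t x z ∂halfMeasure n a)
      (𝓝[>] 0) (𝓝 0) := by
  set β := halfDim n a with hβ
  set A := ∫ z, (hardyWeight z * φ z) ^ 2 ∂halfMeasure n a with hA
  have hAi : Integrable (fun z => (hardyWeight z * φ z) ^ 2) (halfMeasure n a) :=
    hφ.integrable_sq
  set B := (2 + 2 * ‖x‖ ^ 2) * 2 * gaussMass n a with hB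
  have hlim : Tendsto (fun t : ℝ => (A + B) * t ^ ((β - 1) / 2)) (𝓝[>] 0) (𝓝 0) := by
    have h1 : Tendsto (fun t : ℝ => t ^ ((β - 1) / 2)) (𝓝[>] 0) (𝓝 (0 ^ ((β - 1) / 2))) :=
      ((Real.continuous_rpow_const (by linarith)).tendsto 0).mono_left nhdsWithin_le_nhds
    rw [Real.zero_rpow (by linarith)] at h1
    simpa using h1.const_mul (A + B)
  refine squeeze_zero_norm' ?_ hlim
  filter_upwards [Ioo_mem_nhdsGT zero_lt_one] with t ht
  have ht0 := ht.1
  -- The weight in Young's inequality. The two resulting terms have sizes l and l⁻¹ t^(-1-β);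
  -- multiplied by t^β, both become t^((β-1)/2), which tends to 0 since β > 1.
  set l := t ^ (-β + (β - 1) / 2) with hl
  have hl0 : 0 < l := Real.rpow_pos_of_pos ht0 _
  have hK := gaussMass_pos (n := n) ha
  have hint : |∫ z, φ z * gauss t x z ∂halfMeasure n a| ≤
      l * A + l⁻¹ * ((2 + 2 * ‖x‖ ^ 2) * (2 / t) * (gaussMass n a * t ^ (-β))) := by
    have hbound : Integrable (fun z => l * (hardyWeight z * φ z) ^ 2 +
        l⁻¹ * ((2 + 2 * ‖x‖ ^ 2) * (2 / t) * gauss t x z)) (halfMeasure n a) :=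
      (hAi.const_mul l).add (((integrable_gauss ha ht0 x).const_mul _).const_mul _)
    have h2 := norm_integral_le_of_norm_le hbound (f := fun z => φ z * gauss t x z)
      (ae_of_all _ fun z => ?_)
    · rw [integral_add (hAi.const_mul l) (((integrable_gauss ha ht0 x).const_mul _).const_mul _),
        integral_const_mul, integral_const_mul, integral_const_mul, integral_gauss ha ht0 x] at h2
      exact h2
    · have h3 := one_add_normSq_mul_gauss_le ht0 ht.2.le x z
      have h4 := hardyWeight_pos z
      have h5 := hardyWeight_sq z
      have h6 : 1 + normSq z = ((hardyWeight z) ^ 2)⁻¹ := by rw [h5, inv_inv]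
      have hg := gauss_pos t x z
      rw [h6] at h3
      refine le_trans ?_ (add_le_add le_rfl (mul_le_mul_of_nonneg_left h3 (inv_pos.2 hl0).le))
      rw [Real.norm_eq_abs, abs_mul, abs_of_pos hg, ← sq_abs (hardyWeight z * φ z), abs_mul,
        abs_of_pos h4]
      have : l * (hardyWeight z * |φ z|) ^ 2 +
          l⁻¹ * ((hardyWeight z ^ 2)⁻¹ * gauss t x z ^ 2) - 2 * (|φ z| * gauss t x z) =
          l⁻¹ * (l * (hardyWeight z * |φ z|) - (hardyWeight z)⁻¹ * gauss t x z) ^ 2 := by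
        field_simp; ring
      have h7 : 0 ≤ l⁻¹ * (l * (hardyWeight z * |φ z|) - (hardyWeight z)⁻¹ * gauss t x z) ^ 2 := by
        positivity
      have h8 : 0 ≤ |φ z| * gauss t x z := by positivity
      linarith
  have htβ : 0 < t ^ β := Real.rpow_pos_of_pos ht0 _
  rw [norm_mul, Real.norm_of_nonneg htβ.le, Real.norm_eq_abs]
  have e1 : t ^ β * l = t ^ ((β - 1) / 2) := by
    rw [hl, ← Real.rpow_add ht0]; ring_nf
  have e2 : t ^ β * (l⁻¹ * (t⁻¹ * t ^ (-β))) = t ^ ((β - 1) / 2) := by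
    rw [hl, ← Real.rpow_neg ht0.le, ← Real.rpow_neg_one, ← Real.rpow_add ht0, ← Real.rpow_add ht0,
      ← Real.rpow_add ht0]
    ring_nf
  calc t ^ β * |∫ z, φ z * gauss t x z ∂halfMeasure n a|
      ≤ t ^ β * (l * A + l⁻¹ * ((2 + 2 * ‖x‖ ^ 2) * (2 / t) * (gaussMass n a * t ^ (-β)))) := by
        gcongr
    _ = A * (t ^ β * l) + B * (t ^ β * (l⁻¹ * (t⁻¹ * t ^ (-β)))) := by
        rw [hB, div_eq_mul_inv]; ring
    _ = _ := by rw [e1, e2]; ring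

/-- The inner integral is at most the mass of `m`, and s^(β-2) is integrable at 0 because β > 1. -/
lemma intervalIntegrable_rpow_mul_integral_gauss (hb : 1 < halfDim n a) {K : Set (EuclideanSpace ℝ (Fin n))}
    (m : Measure K) [IsFiniteMeasure m] {t : ℝ} (ht : 0 < t) (x : EuclideanSpace ℝ (Fin n)) :
    IntervalIntegrable
      (fun s : ℝ => (1 / 4) * s ^ (halfDim n a - 2) * ∫ x' : K, gauss s x (x', 0) ∂m)
      volume 0 t := by
  have h1 : IntervalIntegrable (fun s : ℝ => (1 / 4) * s ^ (halfDim n a - 2)) volume 0 t :=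
    (intervalIntegral.intervalIntegrable_rpow' (by linarith)).const_mul _
  have hmeas : StronglyMeasurable fun s : ℝ => ∫ x' : K, gauss s x (x', 0) ∂m := by
    refine StronglyMeasurable.integral_prod_right
      (f := fun (s : ℝ) (x' : K) => gauss s x ((x' : EuclideanSpace ℝ (Fin n)), 0)) ?_
    refine Continuous.stronglyMeasurable ?_
    unfold gauss Function.uncurry
    fun_prop
  rw [intervalIntegrable_iff_integrableOn_Ioc_of_le ht.le] at h1 ⊢
  refine h1.mul_bdd (c := m.real univ) hmeas.aestronglyMeasurable
    ((ae_restrict_iff' measurableSet_Ioc).2 (ae_of_all _ fun s hs => ?_))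
  refine (norm_integral_le_of_norm_le_const (C := 1) (ae_of_all _ fun x' => ?_)).trans (by simp)
  rw [Real.norm_of_nonneg (gauss_pos _ _ _).le]
  exact gauss_le_one hs.1.le _ _

/-- The Gaussian transform of a potential in terms of its measure. -/
lemma IsTestLimit.rpow_mul_integral_gauss [h' : Fact (-1 < a)] (hb : 1 < halfDim n a)
    {K : Set (EuclideanSpace ℝ (Fin n))} {m : Measure K} [IsFiniteMeasure m]
    {φ : Pt n → ℝ} {g : Pt n → Pt n} (h : IsTestLimit a φ g)
    (hm : ∀ ψ, IsTest ψ →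
      ∫ x : K, ψ (x, 0) ∂m = ∫ z, euclDot (g z) (euclGrad ψ z) ∂halfMeasure n a)
    {t : ℝ} (ht : 0 < t) (x : EuclideanSpace ℝ (Fin n)) :
    t ^ halfDim n a * ∫ z, φ z * gauss t x z ∂halfMeasure n a =
      ∫ s in 0..t, (1 / 4) * s ^ (halfDim n a - 2) * ∫ x' : K, gauss s x (x', 0) ∂m := by
  have ha : -1 < a := h'.out
  have hφ := h.memLp_hardyWeight_mul hb
  have hd : ∀ s : ℝ, 0 < s → HasDerivAt
      (fun t => t ^ halfDim n a * ∫ z, φ z * gauss t x z ∂halfMeasure n a)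
      ((1 / 4) * s ^ (halfDim n a - 2) * ∫ x' : K, gauss s x (x', 0) ∂m) s := by
    intro s hs
    refine (hasDerivAt_rpow_mul_integral_gauss ha hφ hs x).congr_deriv ?_
    -- The pairing of g with the Gaussian field is eliminated between the two identities; the
    -- constant 1/4 is (-1/2)·(-1/2), from the derivative formula and from the gradient of the
    -- Gaussian.
    rw [integral_gauss_eq_of_forall_isTest h.2.1 hm hs x, h.integral_gauss_mul_grad hb hs x]
    have : s ^ (halfDim n a - 1) = s ^ (halfDim n a - 2) * s := by
      rw [show halfDim n a - 2 = halfDim n a - 1 - 1 by ring, Real.rpow_sub_one hs.ne' (_ - 1)]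
      field_simp
    rw [this]; ring
  rw [intervalIntegral.integral_eq_sub_of_hasDerivAt_of_tendsto ht (fun s hs => hd s hs.1)
    (intervalIntegrable_rpow_mul_integral_gauss hb m ht x)
    (tendsto_rpow_mul_integral_gauss_zero ha hb hφ x)
    ((hd t ht).continuousAt.tendsto.mono_left nhdsWithin_le_nhds), sub_zero]

/-! ### The fundamental solution as a superposition of Gaussians -/

/-- The fundamental solution of the Neumann problem for `div(y^a ∇ ·)` in the half space. -/
def fundKernel (n : ℕ) (a : ℝ) (z : Pt n) : ℝ :=
  Real.Gamma (halfDim n a - 1) / (4 * gaussMass n a) * normSq z ^ (-(halfDim n a - 1))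

lemma fundKernel_nonneg (ha : -1 < a) (hb : 1 < halfDim n a) (z : Pt n) : 0 ≤ fundKernel n a z := by
  have h1 := gaussMass_pos (n := n) ha
  have h2 := Real.Gamma_pos_of_pos (s := halfDim n a - 1) (by linarith)
  have h3 := normSq_nonneg z
  unfold fundKernel; positivity

lemma lintegral_rpow_mul_exp {b r : ℝ} (hb : 0 < b) (hr : 0 < r) :
    ∫⁻ s in Ioi (0 : ℝ), ENNReal.ofReal (s ^ (b - 1) * Real.exp (-s * r)) =
      ENNReal.ofReal (Real.Gamma b * r ^ (-b)) := by
  have hi : IntegrableOn (fun s : ℝ => s ^ (b - 1) * Real.exp (-s * r)) (Ioi 0) := by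
    have := integrableOn_rpow_mul_exp_neg_mul_rpow (p := 1) (s := b - 1) (b := r) (by linarith)
      (by norm_num) hr
    refine this.congr_fun (fun s _ => ?_) measurableSet_Ioi
    simp only [Real.rpow_one]; ring_nf
  rw [← ofReal_integral_eq_lintegral_ofReal hi
    ((ae_restrict_iff' measurableSet_Ioi).2 (ae_of_all _ fun s hs => by
      have hs : 0 < s := hs
      simp only [Pi.zero_apply]; positivity))]
  congr 1
  have := Real.integral_rpow_mul_exp_neg_mul_Ioi hb hr
  rw [one_div, Real.inv_rpow hr.le, ← Real.rpow_neg hr.le] at this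
  rw [mul_comm, ← this]
  congr 1; ext s; ring_nf

/-- The Gamma integral for the power -(β - 1) of the squared distance; z.2 > 0 keeps that distance
positive. -/
lemma ofReal_fundKernel_sub (ha : -1 < a) (hb : 1 < halfDim n a) {z : Pt n} (hz : 0 < z.2)
    (x : EuclideanSpace ℝ (Fin n)) :
    ENNReal.ofReal (fundKernel n a (z - (x, 0))) =
      ∫⁻ s in Ioi (0 : ℝ), ENNReal.ofReal ((4 * gaussMass n a)⁻¹ * s ^ (halfDim n a - 2)) *
        ENNReal.ofReal (gauss s x z) := by
  have hr : 0 < normSq (z - (x, 0)) := by rw [normSq_sub_mk]; positivity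
  have hK := gaussMass_pos (n := n) ha
  have h1 := lintegral_rpow_mul_exp (b := halfDim n a - 1) (by linarith) hr
  have h2 : ∀ s ∈ Ioi (0 : ℝ), ENNReal.ofReal ((4 * gaussMass n a)⁻¹ * s ^ (halfDim n a - 2)) *
      ENNReal.ofReal (gauss s x z) = ENNReal.ofReal (4 * gaussMass n a)⁻¹ *
      ENNReal.ofReal (s ^ (halfDim n a - 1 - 1) * Real.exp (-s * normSq (z - (x, 0)))) := by
    intro s hs
    have hs : 0 < s := hs
    rw [← ENNReal.ofReal_mul (by positivity), ← ENNReal.ofReal_mul (by positivity), gauss,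
      show halfDim n a - 1 - 1 = halfDim n a - 2 by ring]
    ring_nf
  rw [setLIntegral_congr_fun measurableSet_Ioi h2, lintegral_const_mul _ (by fun_prop), h1,
    ← ENNReal.ofReal_mul (by positivity), fundKernel]
  congr 1; ring

lemma add_mul_norm_sq_sub {s t : ℝ} (hst : 0 < s + t) (v x x₀ : EuclideanSpace ℝ (Fin n)) :
    s * ‖v - x‖ ^ 2 + t * ‖v - x₀‖ ^ 2 = (s + t) * ‖v - (s + t)⁻¹ • (s • x + t • x₀)‖ ^ 2 +
      s * t / (s + t) * ‖x - x₀‖ ^ 2 := by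
  have e1 : v - (s + t)⁻¹ • (s • x + t • x₀) = (s + t)⁻¹ • (s • (v - x) + t • (v - x₀)) := by
    have : v = (s + t)⁻¹ • ((s + t) • v) := by rw [smul_smul, inv_mul_cancel₀ hst.ne', one_smul]
    conv_lhs => rw [this]
    rw [← smul_sub]; congr 1
    module
  have e2 : x - x₀ = (v - x₀) - (v - x) := by abel
  rw [e1, e2, norm_smul, mul_pow, Real.norm_eq_abs, sq_abs, norm_add_sq_real,
    norm_sub_sq_real (v - x₀) (v - x), norm_smul, norm_smul, inner_smul_left, inner_smul_right,
    real_inner_comm (v - x) (v - x₀),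
    mul_pow, mul_pow, Real.norm_eq_abs, Real.norm_eq_abs, sq_abs, sq_abs]
  simp only [conj_trivial]
  field_simp
  ring

/-- Completing the square: the product is again a Gaussian centred on {y = 0}, up to a constant.
Both the transform of the kernel and the algebra of Gaussians rest on this. -/
lemma gauss_mul_gauss {s t : ℝ} (hst : 0 < s + t) (x x₀ : EuclideanSpace ℝ (Fin n)) (z : Pt n) :
    gauss s x z * gauss t x₀ z = gauss (s * t / (s + t)) x₀ (x, 0) *
      gauss (s + t) ((s + t)⁻¹ • (s • x + t • x₀)) z := by
  have h := add_mul_norm_sq_sub hst z.1 x x₀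
  rw [gauss_mk_zero, gauss, gauss, gauss, ← Real.exp_add, ← Real.exp_add, normSq_sub_mk,
    normSq_sub_mk, normSq_sub_mk]
  congr 1
  linarith

lemma image_mul_div_add_Ioi {t : ℝ} (ht : 0 < t) :
    (fun s : ℝ => s * t / (s + t)) '' Ioi 0 = Ioo 0 t := by
  ext σ
  simp only [mem_image, mem_Ioi, mem_Ioo]
  constructor
  · rintro ⟨s, hs, rfl⟩
    refine ⟨by positivity, ?_⟩
    rw [div_lt_iff₀ (by positivity)]
    nlinarith
  · rintro ⟨h1, h2⟩
    have h3 : 0 < t - σ := by linarith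
    refine ⟨σ * t / (t - σ), by positivity, ?_⟩
    field_simp
    ring_nf

/-- The substitution σ = st/(s + t), the exponent left over when Gaussians of exponents s and t are
multiplied. -/
lemma lintegral_comp_mul_div_add {t : ℝ} (ht : 0 < t) (f : ℝ → ℝ≥0∞) :
    ∫⁻ σ in Ioo 0 t, f σ =
      ∫⁻ s in Ioi (0 : ℝ), ENNReal.ofReal (t ^ 2 / (s + t) ^ 2) * f (s * t / (s + t)) := by
  rw [← image_mul_div_add_Ioi ht, lintegral_image_eq_lintegral_abs_deriv_mul measurableSet_Ioi
    (f' := fun s => t ^ 2 / (s + t) ^ 2)]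
  · refine setLIntegral_congr_fun measurableSet_Ioi fun s hs => ?_
    have hs : 0 < s := hs
    rw [abs_of_nonneg (by positivity)]
  · intro s hs
    have hs : 0 < s := hs
    have hst : s + t ≠ 0 := by positivity
    refine HasDerivAt.hasDerivWithinAt ?_
    refine (((hasDerivAt_id s).mul_const t).div ((hasDerivAt_id s).add_const t) hst).congr_deriv ?_
    simp only [id]
    field_simp
    ring
  · intro s hs s' hs' h
    have hs : 0 < s := hs
    have hs' : 0 < s' := hs'
    simp only at h
    rw [div_eq_div_iff (by positivity) (by positivity)] at h
    have : t ^ 2 * (s - s') = 0 := by linarith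
    have := (mul_eq_zero.1 this).resolve_left (by positivity)
    linarith

/-- The Gaussian transform of the fundamental solution. -/
lemma lintegral_fundKernel_mul_gauss (ha : -1 < a) (hb : 1 < halfDim n a) {t : ℝ} (ht : 0 < t)
    (x x₀ : EuclideanSpace ℝ (Fin n)) :
    ∫⁻ z, ENNReal.ofReal (fundKernel n a (z - (x, 0))) * ENNReal.ofReal (gauss t x₀ z)
        ∂halfMeasure n a =
      ENNReal.ofReal (t ^ (-halfDim n a)) * ∫⁻ s in Ioo 0 t,
        ENNReal.ofReal (1 / 4 * s ^ (halfDim n a - 2) * gauss s x₀ (x, 0)) := by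
  have hK := gaussMass_pos (n := n) ha
  have hmeas : Measurable (fun p : Pt n × ℝ => gauss p.2 x p.1) := by
    refine Continuous.measurable ?_
    unfold gauss; fun_prop
  have hmeas₀ : Measurable (fun z : Pt n => gauss t x₀ z) := (continuous_gauss t x₀).measurable
  calc _ = ∫⁻ z : Pt n, (∫⁻ s in Ioi (0 : ℝ),
        ENNReal.ofReal ((4 * gaussMass n a)⁻¹ * s ^ (halfDim n a - 2)) *
        ENNReal.ofReal (gauss s x z) * ENNReal.ofReal (gauss t x₀ z)) ∂halfMeasure n a := by
        refine lintegral_congr_ae ?_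
        filter_upwards [ae_pos_halfMeasure n a] with z hz
        rw [ofReal_fundKernel_sub ha hb hz x, ← lintegral_mul_const _ (by
          have := hmeas.comp (measurable_prodMk_left (x := z))
          simp only [Function.comp_def] at this
          fun_prop)]
    _ = ∫⁻ s in Ioi (0 : ℝ), ∫⁻ z,
        ENNReal.ofReal ((4 * gaussMass n a)⁻¹ * s ^ (halfDim n a - 2)) *
        ENNReal.ofReal (gauss s x z) * ENNReal.ofReal (gauss t x₀ z) ∂halfMeasure n a := by
        refine lintegral_lintegral_swap (Measurable.aemeasurable ?_)
        unfold Function.uncurry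
        fun_prop
    -- Integrating the product Gaussian in z gives `gaussMass` times (s + t)^(-β), and s^(β-2) (s +
    -- t)^(-β) ds = t^(-β) σ^(β-2) dσ with σ = st/(s + t).
    _ = ∫⁻ s in Ioi (0 : ℝ), ENNReal.ofReal (t ^ (-halfDim n a)) *
        (ENNReal.ofReal (t ^ 2 / (s + t) ^ 2) * ENNReal.ofReal (1 / 4 *
          (s * t / (s + t)) ^ (halfDim n a - 2) * gauss (s * t / (s + t)) x₀ (x, 0))) := by
        refine setLIntegral_congr_fun measurableSet_Ioi fun s hs => ?_
        have hs : 0 < s := hs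
        have hst : 0 < s + t := by positivity
        have e : ∀ z : Pt n, ENNReal.ofReal ((4 * gaussMass n a)⁻¹ * s ^ (halfDim n a - 2)) *
            ENNReal.ofReal (gauss s x z) * ENNReal.ofReal (gauss t x₀ z) =
            ENNReal.ofReal ((4 * gaussMass n a)⁻¹ * s ^ (halfDim n a - 2) *
              gauss (s * t / (s + t)) x₀ (x, 0)) *
            ENNReal.ofReal (gauss (s + t) ((s + t)⁻¹ • (s • x + t • x₀)) z) := by
          intro z
          have h1 := (gauss_pos s x z).le
          have h2 := (gauss_pos t x₀ z).le
          have h3 := (gauss_pos (s * t / (s + t)) x₀ (x, 0)).le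
          rw [mul_assoc, ← ENNReal.ofReal_mul h1, ← ENNReal.ofReal_mul (by positivity),
            ← ENNReal.ofReal_mul (by positivity), gauss_mul_gauss hst]
          ring_nf
        simp_rw [e]
        rw [lintegral_const_mul _ (by fun_prop), ← ofReal_integral_eq_lintegral_ofReal
          (integrable_gauss ha hst _) (ae_of_all _ fun z => (gauss_pos _ _ _).le),
          integral_gauss ha hst]
        have h3 := (gauss_pos (s * t / (s + t)) x₀ (x, 0)).le
        rw [← ENNReal.ofReal_mul (by positivity), ← ENNReal.ofReal_mul (by positivity),
          ← ENNReal.ofReal_mul (by positivity)]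
        congr 1
        have h4 : 0 < t ^ halfDim n a := Real.rpow_pos_of_pos ht _
        have h5 : 0 < (s + t) ^ halfDim n a := Real.rpow_pos_of_pos hst _
        rw [Real.div_rpow (by positivity) hst.le, Real.mul_rpow hs.le ht.le,
          Real.rpow_sub ht, Real.rpow_sub hst, Real.rpow_ofNat, Real.rpow_ofNat,
          Real.rpow_neg ht.le, Real.rpow_neg hst.le]
        field_simp
    _ = _ := by
        rw [lintegral_const_mul _ (by unfold gauss; fun_prop), lintegral_comp_mul_div_add ht]

/-! ### Potentials of measures on {y = 0} and their Gaussian transforms -/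

section Potential

variable {K : Set (EuclideanSpace ℝ (Fin n))}

/-- The potential of a measure on a subset of `{y = 0}`. -/
def potential (a : ℝ) (m : Measure K) (z : Pt n) : ℝ := ∫ x : K, fundKernel n a (z - (x.1, 0)) ∂m

lemma measurable_fundKernel_sub (n : ℕ) (a : ℝ) (K : Set (EuclideanSpace ℝ (Fin n))) :
    Measurable fun p : Pt n × K => fundKernel n a (p.1 - ((p.2 : EuclideanSpace ℝ (Fin n)), 0)) := by
  have h : Measurable fun p : Pt n × K =>
      normSq (p.1 - ((p.2 : EuclideanSpace ℝ (Fin n)), (0 : ℝ))) :=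
    Continuous.measurable (by fun_prop)
  unfold fundKernel
  fun_prop

lemma integrable_fundKernel_sub (ha : -1 < a) (hb : 1 < halfDim n a) (m : Measure K)
    [IsFiniteMeasure m] {z : Pt n} {r : ℝ} (hr : 0 < r)
    (hz : ∀ x : K, r ≤ normSq (z - ((x : EuclideanSpace ℝ (Fin n)), 0))) :
    Integrable (fun x : K => fundKernel n a (z - (x.1, 0))) m := by
  have h1 := gaussMass_pos (n := n) ha
  have h2 := Real.Gamma_pos_of_pos (s := halfDim n a - 1) (by linarith)
  refine Integrable.of_bound
    ((measurable_fundKernel_sub n a K).comp measurable_prodMk_left).aestronglyMeasurable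
    (Real.Gamma (halfDim n a - 1) / (4 * gaussMass n a) * r ^ (-(halfDim n a - 1)))
    (ae_of_all _ fun x => ?_)
  rw [Real.norm_of_nonneg (fundKernel_nonneg ha hb _), fundKernel]
  refine mul_le_mul_of_nonneg_left ?_ (by positivity)
  exact Real.rpow_le_rpow_of_nonpos hr (hz x) (by linarith)

lemma potential_nonneg (ha : -1 < a) (hb : 1 < halfDim n a) (m : Measure K) (z : Pt n) :
    0 ≤ potential a m z := integral_nonneg fun _ => fundKernel_nonneg ha hb _

lemma measurable_potential (m : Measure K) [IsFiniteMeasure m] : Measurable (potential a m) :=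
  ((measurable_fundKernel_sub n a K).stronglyMeasurable.integral_prod_right').measurable

/-- Tonelli reduces the claim to the transform of the kernel. The right-hand side is the expression
found for φ in `IsTestLimit.rpow_mul_integral_gauss`, which is what makes the two comparable. -/
lemma lintegral_potential_mul_gauss (ha : -1 < a) (hb : 1 < halfDim n a) (m : Measure K)
    [IsFiniteMeasure m] {t : ℝ} (ht : 0 < t) (x : EuclideanSpace ℝ (Fin n)) :
    ∫⁻ z, ENNReal.ofReal (potential a m z * gauss t x z) ∂halfMeasure n a =
      ENNReal.ofReal (t ^ (-halfDim n a) * ∫ s in 0..t,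
        (1 / 4) * s ^ (halfDim n a - 2) * ∫ x' : K, gauss s x (x', 0) ∂m) := by
  have hgc : Continuous fun p : K × ℝ => gauss p.2 x ((p.1 : EuclideanSpace ℝ (Fin n)), 0) := by
    unfold gauss; fun_prop
  have hmeasP := measurable_fundKernel_sub n a K
  have hii := intervalIntegrable_rpow_mul_integral_gauss hb m ht x (a := a)
  rw [intervalIntegrable_iff_integrableOn_Ioc_of_le ht.le] at hii
  calc ∫⁻ z, ENNReal.ofReal (potential a m z * gauss t x z) ∂halfMeasure n a
      = ∫⁻ z, (∫⁻ x' : K, ENNReal.ofReal (fundKernel n a (z - (x'.1, 0))) *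
          ENNReal.ofReal (gauss t x z) ∂m) ∂halfMeasure n a := by
        refine lintegral_congr_ae ?_
        filter_upwards [ae_pos_halfMeasure n a] with z hz
        have hi := integrable_fundKernel_sub ha hb m (z := z) (r := z.2 ^ 2) (by positivity)
          fun x' => by rw [normSq_sub_mk]; nlinarith [sq_nonneg ‖z.1 - (x' : EuclideanSpace ℝ (Fin n))‖]
        rw [ENNReal.ofReal_mul (potential_nonneg ha hb m z), potential,
          ofReal_integral_eq_lintegral_ofReal hi (ae_of_all _ fun _ => fundKernel_nonneg ha hb _),
          lintegral_mul_const'' _ hi.1.aemeasurable.ennreal_ofReal]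
    _ = ∫⁻ x' : K, (∫⁻ z, ENNReal.ofReal (fundKernel n a (z - (x'.1, 0))) *
          ENNReal.ofReal (gauss t x z) ∂halfMeasure n a) ∂m := by
        refine lintegral_lintegral_swap (Measurable.aemeasurable ?_)
        have := (continuous_gauss t x).measurable
        exact hmeasP.ennreal_ofReal.mul (this.comp measurable_fst).ennreal_ofReal
    _ = ENNReal.ofReal (t ^ (-halfDim n a)) * ∫⁻ x' : K, (∫⁻ s in Ioo 0 t,
          ENNReal.ofReal (1 / 4 * s ^ (halfDim n a - 2) * gauss s x (x', 0))) ∂m := by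
        simp_rw [lintegral_fundKernel_mul_gauss ha hb ht]
        refine lintegral_const_mul _ (Measurable.lintegral_prod_right' (f := fun p : K × ℝ =>
          ENNReal.ofReal (1 / 4 * p.2 ^ (halfDim n a - 2) *
            gauss p.2 x ((p.1 : EuclideanSpace ℝ (Fin n)), 0))) ?_)
        have := hgc.measurable
        fun_prop
    _ = ENNReal.ofReal (t ^ (-halfDim n a)) * ∫⁻ s in Ioo 0 t, (∫⁻ x' : K,
          ENNReal.ofReal (1 / 4 * s ^ (halfDim n a - 2) * gauss s x (x', 0)) ∂m) := by
        congr 1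
        refine lintegral_lintegral_swap (Measurable.aemeasurable ?_)
        have := hgc.measurable
        unfold Function.uncurry
        fun_prop
    _ = ENNReal.ofReal (t ^ (-halfDim n a)) * ∫⁻ s in Ioo 0 t, ENNReal.ofReal
          (1 / 4 * s ^ (halfDim n a - 2) * ∫ x' : K, gauss s x (x', 0) ∂m) := by
        congr 1
        refine setLIntegral_congr_fun measurableSet_Ioo fun s hs => ?_
        have hs0 := hs.1
        rw [← integral_const_mul, ofReal_integral_eq_lintegral_ofReal]
        · refine Integrable.const_mul ?_ _
          refine Integrable.of_bound (hgc.comp (by fun_prop :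
            Continuous fun x' : K => (x', s))).aestronglyMeasurable 1 (ae_of_all _ fun x' => ?_)
          rw [Real.norm_of_nonneg (gauss_pos _ _ _).le]
          exact gauss_le_one hs0.le _ _
        · refine ae_of_all _ fun x' => ?_
          have := (gauss_pos s x ((x' : EuclideanSpace ℝ (Fin n)), 0)).le
          exact mul_nonneg (by positivity) this
    _ = _ := by
        rw [setLIntegral_congr Ioo_ae_eq_Ioc, ← ofReal_integral_eq_lintegral_ofReal hii
          ((ae_restrict_iff' measurableSet_Ioc).2 (ae_of_all _ fun s hs => ?_)),
          ← ENNReal.ofReal_mul (by positivity), intervalIntegral.integral_of_le ht.le]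
        have hs0 := hs.1
        have : 0 ≤ ∫ x' : K, gauss s x (x', 0) ∂m := integral_nonneg fun _ => (gauss_pos _ _ _).le
        simp only [Pi.zero_apply]
        positivity

lemma integral_potential_mul_gauss (ha : -1 < a) (hb : 1 < halfDim n a) (m : Measure K)
    [IsFiniteMeasure m] {t : ℝ} (ht : 0 < t) (x : EuclideanSpace ℝ (Fin n)) :
    Integrable (fun z => potential a m z * gauss t x z) (halfMeasure n a) ∧
    ∫ z, potential a m z * gauss t x z ∂halfMeasure n a =
      t ^ (-halfDim n a) * ∫ s in 0..t,
        (1 / 4) * s ^ (halfDim n a - 2) * ∫ x' : K, gauss s x (x', 0) ∂m := by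
  have h := lintegral_potential_mul_gauss ha hb m ht x
  have h0 : 0 ≤ᵐ[halfMeasure n a] fun z => potential a m z * gauss t x z :=
    ae_of_all _ fun z => mul_nonneg (potential_nonneg ha hb m z) (gauss_pos t x z).le
  have hm : AEStronglyMeasurable (fun z => potential a m z * gauss t x z) (halfMeasure n a) :=
    ((measurable_potential m).mul (continuous_gauss t x).measurable).aestronglyMeasurable
  refine ⟨(lintegral_ofReal_ne_top_iff_integrable hm h0).1 (by rw [h]; exact ENNReal.ofReal_ne_top),
    ?_⟩
  rw [integral_eq_lintegral_of_nonneg_ae h0 hm, h, ENNReal.toReal_ofReal]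
  refine mul_nonneg (by positivity) (intervalIntegral.integral_nonneg ht.le fun s hs => ?_)
  have hs0 := hs.1
  have : 0 ≤ ∫ x' : K, gauss s x (x', 0) ∂m := integral_nonneg fun _ => (gauss_pos _ _ _).le
  positivity

end Potential

section

open scoped BoundedContinuousFunction

/-! ### Injectivity of the Gaussian transform -/

/-- The closed half space. -/
abbrev ClosedHalf (n : ℕ) : Type := {z : Pt n // 0 ≤ z.2}

/-- Gaussians as bounded continuous functions on the closed half space. -/
def gaussBCF {t : ℝ} (ht : 0 ≤ t) (x : EuclideanSpace ℝ (Fin n)) : ClosedHalf n →ᵇ ℝ :=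
  BoundedContinuousFunction.ofNormedAddCommGroup (fun z => gauss t x z.1)
    ((continuous_gauss t x).comp continuous_subtype_val) 1 fun z => by
      rw [Real.norm_of_nonneg (gauss_pos _ _ _).le]; exact gauss_le_one ht _ _

lemma gaussBCF_apply {t : ℝ} (ht : 0 ≤ t) (x : EuclideanSpace ℝ (Fin n)) (z : ClosedHalf n) :
    gaussBCF ht x z = gauss t x z.1 := rfl

/-- The Gaussians on the closed half space. -/
def gaussSet (n : ℕ) : Set (ClosedHalf n →ᵇ ℝ) :=
  {f | ∃ (t : ℝ) (ht : 0 < t) (x : EuclideanSpace ℝ (Fin n)), f = gaussBCF ht.le x}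

/-- The algebra generated by the Gaussians. -/
def gaussAlgebra (n : ℕ) : StarSubalgebra ℝ (ClosedHalf n →ᵇ ℝ) where
  toSubalgebra := Algebra.adjoin ℝ (gaussSet n)
  star_mem' {f} hf := by
    have : star f = f := by ext z; simp
    rwa [this]

lemma mem_closure_gaussSet {f : ClosedHalf n →ᵇ ℝ} (hf : f ∈ Submonoid.closure (gaussSet n)) :
    f = 1 ∨ ∃ (c t : ℝ) (ht : 0 < t) (x : EuclideanSpace ℝ (Fin n)), f = c • gaussBCF ht.le x := by
  induction hf using Submonoid.closure_induction with
  | mem f hf =>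
    obtain ⟨t, ht, x, rfl⟩ := hf
    exact Or.inr ⟨1, t, ht, x, by simp⟩
  | one => exact Or.inl rfl
  | mul f g _ _ hf hg =>
    rcases hf with rfl | ⟨c, t, ht, x, rfl⟩
    · simpa using hg
    rcases hg with rfl | ⟨d, s, hs, x', rfl⟩
    · exact Or.inr ⟨c, t, ht, x, by simp⟩
    · refine Or.inr ⟨c * d * gauss (t * s / (t + s)) x' (x, 0), t + s, by positivity,
        (t + s)⁻¹ • (t • x + s • x'), ?_⟩
      ext z
      simp only [BoundedContinuousFunction.coe_mul, BoundedContinuousFunction.coe_smul,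
        Pi.mul_apply, gaussBCF_apply, smul_eq_mul]
      have := gauss_mul_gauss (by positivity : 0 < t + s) x x' z.1
      linear_combination c * d * this

/-- Centres on {y = 0} determine x and y² only, so the sign condition of the closed half space is
essential. -/
lemma separatesPoints_gaussAlgebra (n : ℕ) :
    ((gaussAlgebra n).map
      (BoundedContinuousFunction.toContinuousMapStarₐ ℝ)).SeparatesPoints := by
  intro z z' hne
  by_contra hcon
  push Not at hcon
  have h : ∀ x, gauss 1 x z.1 = gauss 1 x z'.1 := by
    intro x
    refine hcon _ ⟨_, ⟨gaussBCF zero_le_one x, Algebra.subset_adjoin ⟨1, one_pos, x, rfl⟩, rfl⟩, rfl⟩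
  have h' : ∀ x, ‖z.1.1 - x‖ ^ 2 + z.1.2 ^ 2 = ‖z'.1.1 - x‖ ^ 2 + z'.1.2 ^ 2 := by
    intro x
    have := Real.exp_injective (h x)
    rw [normSq_sub_mk, normSq_sub_mk] at this
    linarith
  have h1 := h' z.1.1
  have h2 := h' z'.1.1
  rw [sub_self, norm_zero] at h1 h2
  rw [norm_sub_rev] at h2
  have h3 : ‖z'.1.1 - z.1.1‖ = 0 := by
    have : ‖z'.1.1 - z.1.1‖ ^ 2 = 0 := by linarith
    exact pow_eq_zero_iff two_ne_zero |>.1 this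
  rw [h3] at h1
  have h4 : z.1.2 = z'.1.2 := by
    refine (sq_eq_sq₀ z.2 z'.2).1 (by linarith)
  exact hne (Subtype.ext (Prod.ext (sub_eq_zero.1 (norm_eq_zero.1 h3)).symm h4))

/-- A function whose integrals against all Gaussians centred on `{y = 0}` vanish is zero. -/
lemma ae_eq_zero_of_forall_integral_gauss {w : Pt n → ℝ}
    (hi : ∀ t : ℝ, 0 < t → ∀ x, Integrable (fun z => w z * gauss t x z) (halfMeasure n a))
    (h0 : ∀ t : ℝ, 0 < t → ∀ x, ∫ z, w z * gauss t x z ∂halfMeasure n a = 0) :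
    w =ᵐ[halfMeasure n a] 0 := by
  -- One Gaussian factor makes `w` integrable, and by the product formula `u` against any Gaussian
  -- is still `w` against a multiple of a Gaussian. The positive and negative parts of `u` are the
  -- densities of two finite measures, to be proved equal.
  let u : Pt n → ℝ := fun z => w z * gauss 1 0 z
  have hu : Integrable u (halfMeasure n a) := hi 1 one_pos 0
  let ρ : (Pt n → ℝ) → Measure (Pt n) := fun v =>
    (halfMeasure n a).withDensity fun z => ENNReal.ofReal (v z)
  have hfin : ∀ v : Pt n → ℝ, Integrable v (halfMeasure n a) → IsFiniteMeasure (ρ v) := fun v hv =>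
    isFiniteMeasure_withDensity_ofReal hv.2
  have := hfin u hu
  have := hfin (-u) hu.neg
  -- A continuous retraction onto the closed half space, equal to the identity almost everywhere for
  -- `halfMeasure`.
  let q : Pt n → ClosedHalf n := fun z => ⟨(z.1, max z.2 0), le_max_right _ _⟩
  have hq : Continuous q := by fun_prop
  have hqv : ∀ᵐ z ∂halfMeasure n a, (q z).1 = z := by
    filter_upwards [ae_pos_halfMeasure n a] with z hz
    simp only [q]; rw [max_eq_left hz.le]
  have hint : ∀ (v : Pt n → ℝ), Integrable v (halfMeasure n a) → ∀ f : ClosedHalf n →ᵇ ℝ,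
      ∫ z, f z ∂(ρ v).map q = ∫ z, max (v z) 0 * f (q z) ∂halfMeasure n a := by
    intro v hv f
    rw [integral_map hq.aemeasurable f.continuous.aestronglyMeasurable,
      integral_withDensity_eq_integral_toReal_smul₀ hv.1.aemeasurable.ennreal_ofReal (by simp)]
    simp [ENNReal.toReal_ofReal']
  have hdiff : ∀ f : ClosedHalf n →ᵇ ℝ, ∫ z, f z ∂(ρ u).map q - ∫ z, f z ∂(ρ (-u)).map q =
      ∫ z, u z * f (q z) ∂halfMeasure n a := by
    intro f
    have hbi : ∀ v : Pt n → ℝ, Integrable v (halfMeasure n a) →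
        Integrable (fun z => max (v z) 0 * f (q z)) (halfMeasure n a) := fun v hv =>
      hv.pos_part.mul_bdd (c := ‖f‖) (f.continuous.comp hq).aestronglyMeasurable
        (ae_of_all _ fun z => f.norm_coe_le_norm _)
    rw [hint u hu, hint (-u) hu.neg, ← integral_sub (hbi u hu) (hbi (-u) hu.neg)]
    congr 1; ext z
    rw [← sub_mul]
    congr 1
    simp only [Pi.neg_apply]
    rcases le_total (u z) 0 with h | h
    · rw [max_eq_right h, max_eq_left (by linarith)]; ring
    · rw [max_eq_left h, max_eq_right (by linarith)]; ring
  have heq : (ρ u).map q = (ρ (-u)).map q := by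
    have : PolishSpace (ClosedHalf n) :=
      (isClosed_le continuous_const continuous_snd).polishSpace
    refine ext_of_forall_mem_subalgebra_integral_eq_of_polish (separatesPoints_gaussAlgebra n)
      fun f hf => sub_eq_zero.1 ?_
    rw [hdiff]
    have hf' : f ∈ Submodule.span ℝ (Submonoid.closure (gaussSet n) : Set (ClosedHalf n →ᵇ ℝ)) := by
      rw [← Algebra.adjoin_eq_span]; exact hf
    have hbi : ∀ f : ClosedHalf n →ᵇ ℝ, Integrable (fun z => u z * f (q z)) (halfMeasure n a) :=
      fun f => hu.mul_bdd (c := ‖f‖) (f.continuous.comp hq).aestronglyMeasurable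
        (ae_of_all _ fun z => f.norm_coe_le_norm _)
    clear hf
    induction hf' using Submodule.span_induction with
    | mem f hf =>
      rcases mem_closure_gaussSet hf with rfl | ⟨c, t, ht, x, rfl⟩
      -- The unit of the algebra is not a Gaussian, but here it leaves the factor `gauss 1 0`
      -- already built into `u`.
      · simpa using h0 1 one_pos 0
      · have h1 : 0 < 1 + t := by positivity
        have h2 := h0 (1 + t) h1
          ((1 + t)⁻¹ • ((1 : ℝ) • (0 : EuclideanSpace ℝ (Fin n)) + t • x))
        have h3 := integral_const_mul (μ := halfMeasure n a)
          (c * gauss (1 * t / (1 + t)) x (0, 0)) fun z => w z * gauss (1 + t)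
            ((1 + t)⁻¹ • ((1 : ℝ) • (0 : EuclideanSpace ℝ (Fin n)) + t • x)) z
        rw [h2, mul_zero] at h3
        refine Eq.trans ?_ h3
        refine integral_congr_ae ?_
        filter_upwards [hqv] with z hz
        have := gauss_mul_gauss h1 0 x z
        simp only [BoundedContinuousFunction.coe_smul, gaussBCF_apply, smul_eq_mul, hz, u]
        linear_combination w z * c * this
    | zero => simp
    | add f g _ _ hf hg =>
      simp only [BoundedContinuousFunction.coe_add, Pi.add_apply, mul_add]
      rw [integral_add (hbi f) (hbi g), hf, hg, add_zero]
    | smul c f _ hf =>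
      simp only [BoundedContinuousFunction.coe_smul, smul_eq_mul, mul_left_comm _ c]
      rw [integral_const_mul, hf, mul_zero]
  have hρ : ρ u = ρ (-u) := by
    ext s hs
    have hs' : MeasurableSet (Subtype.val ⁻¹' s : Set (ClosedHalf n)) := measurable_subtype_coe hs
    have key : ∀ v : Pt n → ℝ, (ρ v).map q (Subtype.val ⁻¹' s) = ρ v s := by
      intro v
      rw [Measure.map_apply hq.measurable hs']
      refine measure_congr ?_
      have : ∀ᵐ z ∂ρ v, (q z).1 = z := (withDensity_absolutelyContinuous _ _).ae_le hqv
      filter_upwards [this] with z hz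
      exact congrArg s hz
    rw [← key u, ← key (-u), heq]
  have hae := (withDensity_eq_iff hu.1.aemeasurable.ennreal_ofReal
    hu.neg.1.aemeasurable.ennreal_ofReal hu.lintegral_lt_top.ne).1 hρ
  filter_upwards [hae] with z hz
  have h1 : u z = 0 := by
    simp only [Pi.neg_apply] at hz
    rcases le_total (u z) 0 with h | h
    · rw [ENNReal.ofReal_of_nonpos h] at hz
      have := ENNReal.ofReal_eq_zero.1 hz.symm
      linarith
    · rw [ENNReal.ofReal_of_nonpos (p := -u z) (by linarith)] at hz
      have := ENNReal.ofReal_eq_zero.1 hz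
      linarith
  exact (mul_eq_zero.1 h1).resolve_right (gauss_pos _ _ _).ne'

end

/-! ### The fundamental solution -/

lemma IsTest.memLp_hardyWeight_mul [Fact (-1 < a)] {ψ : Pt n → ℝ} (h : IsTest ψ) :
    MemLp (fun z => hardyWeight z * ψ z) 2 (halfMeasure n a) :=
  (continuous_hardyWeight.mul h.continuous).memLp_of_hasCompactSupport h.2.mul_left

lemma euclNorm_mul_gauss_le {s : ℝ} (hs : 0 < s) (z : Pt n) :
    euclNorm z * gauss s 0 z ≤ s ^ (-(1 / 2) : ℝ) * gauss (s / 2) 0 z := by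
  have h0 := euclNorm_nonneg z
  have e1 : gauss s 0 z = Real.exp (-(s / 2 * normSq z)) * gauss (s / 2) 0 z := by
    rw [gauss, gauss, ← Real.exp_add, Prod.mk_zero_zero, sub_zero]; ring_nf
  have h1 : Real.sqrt s * euclNorm z ≤ Real.exp (s / 2 * normSq z) := by
    have h2 := Real.add_one_le_exp (s / 2 * normSq z)
    have h3 : (Real.sqrt s * euclNorm z) ^ 2 = s * normSq z := by
      rw [mul_pow, Real.sq_sqrt hs.le, euclNorm_sq]
    nlinarith [sq_nonneg (Real.sqrt s * euclNorm z - 1)]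
  have hsq : 0 < Real.sqrt s := Real.sqrt_pos.2 hs
  have e2 : s ^ (-(1 / 2) : ℝ) = (Real.sqrt s)⁻¹ := by
    rw [Real.rpow_neg hs.le, Real.sqrt_eq_rpow]
  have h4 : euclNorm z * Real.exp (-(s / 2 * normSq z)) ≤ (Real.sqrt s)⁻¹ := by
    rw [Real.exp_neg, ← div_eq_mul_inv, div_le_iff₀ (Real.exp_pos _), inv_mul_eq_div,
      le_div_iff₀ hsq]
    linarith
  rw [e1, e2, ← mul_assoc]
  exact mul_le_mul_of_nonneg_right h4 (gauss_pos _ _ _).le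

/-- Under a Gaussian of exponent s, a factor |z| is worth s^(-1/2). -/
lemma integral_euclNorm_mul_gauss_le (ha : -1 < a) {s : ℝ} (hs : 0 < s) :
    Integrable (fun z => euclNorm z * gauss s 0 z) (halfMeasure n a) ∧
    ∫ z, euclNorm z * gauss s 0 z ∂halfMeasure n a ≤
      gaussMass n a * 2 ^ halfDim n a * s ^ (-(1 / 2) - halfDim n a) := by
  have hi := (integrable_gauss (n := n) ha (half_pos hs) 0).const_mul (s ^ (-(1 / 2) : ℝ))
  have hle : ∀ z : Pt n, ‖euclNorm z * gauss s 0 z‖ ≤ s ^ (-(1 / 2) : ℝ) * gauss (s / 2) 0 z :=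
    fun z => by
      rw [Real.norm_of_nonneg (mul_nonneg (euclNorm_nonneg z) (gauss_pos _ _ _).le)]
      exact euclNorm_mul_gauss_le hs z
  refine ⟨hi.mono' (Continuous.aestronglyMeasurable (by fun_prop)) (ae_of_all _ hle), ?_⟩
  refine (le_abs_self _).trans ((norm_integral_le_of_norm_le hi (ae_of_all _ hle)).trans ?_)
  rw [integral_const_mul, integral_gauss ha (half_pos hs), Real.div_rpow hs.le (by norm_num),
    Real.rpow_neg zero_le_two, div_inv_eq_mul, sub_eq_add_neg, Real.rpow_add hs]
  exact le_of_eq (by ring)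

lemma IsTest.exists_lipschitz {ψ : Pt n → ℝ} (h : IsTest ψ) :
    ∃ C, 0 ≤ C ∧ ∀ z, |ψ z - ψ 0| ≤ C * euclNorm z := by
  obtain ⟨C, hC⟩ := (h.1.of_le (by exact_mod_cast le_top : (1 : WithTop ℕ∞) ≤ _)
    ).lipschitzWith_of_hasCompactSupport h.2 one_ne_zero
  refine ⟨C, C.2, fun z => ?_⟩
  have := hC.dist_le_mul z 0
  rw [Real.dist_eq, dist_zero_right] at this
  exact this.trans (mul_le_mul_of_nonneg_left (norm_le_euclNorm z) C.2)

/-- The kernels s^β exp(-s|z|²) have constant mass `gaussMass` and concentrate at 0; for a Lipschitz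
function the error is O(s^(-1/2)). -/
lemma IsTest.tendsto_rpow_mul_integral_gauss_atTop [h' : Fact (-1 < a)] {ψ : Pt n → ℝ}
    (h : IsTest ψ) :
    Tendsto (fun s : ℝ => s ^ halfDim n a * ∫ z, ψ z * gauss s 0 z ∂halfMeasure n a) atTop
      (𝓝 (gaussMass n a * ψ 0)) := by
  have ha : -1 < a := h'.out
  obtain ⟨C, hC0, hC⟩ := h.exists_lipschitz
  rw [tendsto_iff_dist_tendsto_zero]
  have hlim : Tendsto (fun s : ℝ => C * (gaussMass n a * 2 ^ halfDim n a) * s ^ (-(1 / 2) : ℝ))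
      atTop (𝓝 0) := by
    have := (tendsto_rpow_neg_atTop (y := 1 / 2) (by norm_num)).const_mul
      (C * (gaussMass n a * 2 ^ halfDim n a))
    simpa using this
  refine squeeze_zero' (Eventually.of_forall fun s => dist_nonneg) ?_ hlim
  filter_upwards [eventually_gt_atTop 0] with s hs
  have hi := integrable_mul_gauss ha h.memLp_hardyWeight_mul hs (0 : EuclideanSpace ℝ (Fin n))
  have hg := integrable_gauss ha hs (0 : EuclideanSpace ℝ (Fin n))
  have hsβ : 0 < s ^ halfDim n a := Real.rpow_pos_of_pos hs _
  have e : gaussMass n a * ψ 0 = s ^ halfDim n a * ∫ z, ψ 0 * gauss s 0 z ∂halfMeasure n a := by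
    rw [integral_const_mul, integral_gauss ha hs, Real.rpow_neg hs.le]
    field_simp
  rw [e, Real.dist_eq, ← mul_sub, ← integral_sub hi (hg.const_mul _), abs_mul, abs_of_pos hsβ]
  have h2 := integral_euclNorm_mul_gauss_le (n := n) ha hs
  have h1 := norm_integral_le_of_norm_le (h2.1.const_mul C)
    (f := fun z => ψ z * gauss s 0 z - ψ 0 * gauss s 0 z) (ae_of_all _ fun z => by
      rw [← sub_mul, norm_mul, Real.norm_of_nonneg (gauss_pos _ _ _).le, ← mul_assoc]
      exact mul_le_mul_of_nonneg_right (hC z) (gauss_pos _ _ _).le)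
  rw [integral_const_mul] at h1
  calc _ ≤ s ^ halfDim n a * (C * (gaussMass n a * 2 ^ halfDim n a *
        s ^ (-(1 / 2) - halfDim n a))) := by
        refine mul_le_mul_of_nonneg_left (h1.trans ?_) hsβ.le
        exact mul_le_mul_of_nonneg_left h2.2 hC0
    _ = _ := by
        rw [Real.rpow_sub hs]; field_simp

/-- Justifies Fubini. For s ≤ 1 the Gaussian is at most 1 and s^(β-1) is integrable; for s > 1 the
factor |z| yields the integrable bound s^(-3/2). -/
lemma IsTest.integrable_prod_gauss_mul_grad [h' : Fact (-1 < a)] (hb : 1 < halfDim n a)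
    {ψ : Pt n → ℝ} (h : IsTest ψ) :
    Integrable (fun p : Pt n × ℝ => p.2 ^ (halfDim n a - 1) *
      (gauss p.2 0 p.1 * euclDot (euclGrad ψ p.1) p.1))
      ((halfMeasure n a).prod (volume.restrict (Ioi 0))) := by
  have ha : -1 < a := h'.out
  have hgc := h.continuous_euclGrad
  have hE : Continuous fun z => euclDot (euclGrad ψ z) z := by fun_prop
  have hEs : HasCompactSupport fun z => euclDot (euclGrad ψ z) z :=
    h.hasCompactSupport_euclGrad.mono fun z hz h0 => hz (by simp [h0, euclDot])
  have hEi : Integrable (fun z => euclDot (euclGrad ψ z) z) (halfMeasure n a) :=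
    hE.integrable_of_hasCompactSupport hEs
  obtain ⟨C, hC⟩ := hgc.bounded_above_of_compact_support h.hasCompactSupport_euclGrad
  have hC0 : 0 ≤ C := (norm_nonneg _).trans (hC 0)
  have hEC : ∀ z, ‖euclDot (euclGrad ψ z) z‖ ≤ 2 * C * euclNorm z := fun z =>
    (abs_euclDot_le _ _).trans (mul_le_mul_of_nonneg_right
      ((euclNorm_le _).trans (by linarith [hC z])) (euclNorm_nonneg z))
  have hmg : Measurable fun p : Pt n × ℝ => gauss p.2 0 p.1 := by
    refine Continuous.measurable ?_
    unfold gauss; fun_prop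
  have hmeas : Measurable (fun p : Pt n × ℝ => p.2 ^ (halfDim n a - 1) *
      (gauss p.2 0 p.1 * euclDot (euclGrad ψ p.1) p.1)) :=
    (measurable_snd.pow_const _).mul (hmg.mul (hE.measurable.comp measurable_fst))
  have hGi : ∀ s : ℝ, Integrable (fun z => gauss s 0 z * euclDot (euclGrad ψ z) z)
      (halfMeasure n a) := fun s =>
    Continuous.integrable_of_hasCompactSupport (by fun_prop) hEs.mul_left
  refine (integrable_prod_iff' hmeas.aestronglyMeasurable).2
    ⟨ae_of_all _ fun s => (hGi s).const_mul (s ^ (halfDim n a - 1)), ?_⟩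
  have hJm : AEStronglyMeasurable (fun s : ℝ => ∫ z, ‖s ^ (halfDim n a - 1) *
      (gauss s 0 z * euclDot (euclGrad ψ z) z)‖ ∂halfMeasure n a) volume :=
    (StronglyMeasurable.integral_prod_right' (ν := halfMeasure n a) (f := fun q : ℝ × Pt n =>
      ‖q.1 ^ (halfDim n a - 1) * (gauss q.1 0 q.2 * euclDot (euclGrad ψ q.2) q.2)‖)
      (hmeas.comp measurable_swap).norm.stronglyMeasurable).aestronglyMeasurable
  have hJ : ∀ s : ℝ, 0 < s → ‖∫ z, ‖s ^ (halfDim n a - 1) *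
      (gauss s 0 z * euclDot (euclGrad ψ z) z)‖ ∂halfMeasure n a‖ =
      s ^ (halfDim n a - 1) * ∫ z, ‖gauss s 0 z * euclDot (euclGrad ψ z) z‖ ∂halfMeasure n a := by
    intro s hs
    rw [Real.norm_of_nonneg (integral_nonneg fun _ => norm_nonneg _), ← integral_const_mul]
    congr 1; ext z
    rw [norm_mul, Real.norm_of_nonneg (Real.rpow_nonneg hs.le _)]
  change IntegrableOn _ (Ioi 0) volume
  rw [← Ioc_union_Ioi_eq_Ioi (zero_le_one' ℝ)]
  refine IntegrableOn.union ?_ ?_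
  · have hb1 : IntegrableOn (fun s : ℝ => s ^ (halfDim n a - 1) *
        ∫ z, ‖euclDot (euclGrad ψ z) z‖ ∂halfMeasure n a) (Ioc 0 1) := by
      have := (intervalIntegral.intervalIntegrable_rpow' (a := 0) (b := 1)
        (r := halfDim n a - 1) (by linarith))
      rw [intervalIntegrable_iff_integrableOn_Ioc_of_le zero_le_one] at this
      exact this.mul_const _
    refine hb1.mono' hJm.restrict ((ae_restrict_iff' measurableSet_Ioc).2
      (ae_of_all _ fun s hs => ?_))
    rw [hJ s hs.1]
    refine mul_le_mul_of_nonneg_left (integral_mono (hGi s).norm hEi.norm fun z => ?_)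
      (Real.rpow_nonneg hs.1.le _)
    simp only [norm_mul, Real.norm_of_nonneg (gauss_pos s 0 z).le]
    exact mul_le_of_le_one_left (norm_nonneg _) (gauss_le_one hs.1.le _ _)
  · have hb2 : IntegrableOn (fun s : ℝ => 2 * C * (gaussMass n a * 2 ^ halfDim n a) *
        s ^ (-(3 / 2) : ℝ)) (Ioi 1) :=
      (integrableOn_Ioi_rpow_of_lt (by norm_num) one_pos).const_mul _
    refine hb2.mono' hJm.restrict ((ae_restrict_iff' measurableSet_Ioi).2
      (ae_of_all _ fun s hs => ?_))
    have hs0 : 0 < s := zero_lt_one.trans hs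
    rw [hJ s hs0]
    have h2 := integral_euclNorm_mul_gauss_le (n := n) ha hs0
    have h3 : ∫ z, ‖gauss s 0 z * euclDot (euclGrad ψ z) z‖ ∂halfMeasure n a ≤
        2 * C * (gaussMass n a * 2 ^ halfDim n a * s ^ (-(1 / 2) - halfDim n a)) := by
      refine le_trans (integral_mono (hGi s).norm (h2.1.const_mul (2 * C)) fun z => ?_) ?_
      · simp only [norm_mul (gauss s 0 z), Real.norm_of_nonneg (gauss_pos s 0 z).le]
        calc _ ≤ gauss s 0 z * (2 * C * euclNorm z) :=
              mul_le_mul_of_nonneg_left (hEC z) (gauss_pos s 0 z).le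
          _ = _ := by ring
      · rw [integral_const_mul]
        exact mul_le_mul_of_nonneg_left h2.2 (by positivity)
    refine (mul_le_mul_of_nonneg_left h3 (Real.rpow_nonneg hs0.le _)).trans (le_of_eq ?_)
    have : s ^ (-(3 / 2) : ℝ) = s ^ (halfDim n a - 1) * s ^ (-(1 / 2) - halfDim n a) := by
      rw [← Real.rpow_add hs0]; ring_nf
    rw [this]; ring

/-- The integrand is -2 times the derivative of s^β ∫ ψ exp(-s|z|²), whose limits at 0 and ∞ are 0
and `gaussMass n a * ψ 0`. -/
lemma IsTest.integral_rpow_mul_integral_gauss_mul_grad [h' : Fact (-1 < a)]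
    (hb : 1 < halfDim n a) {ψ : Pt n → ℝ} (h : IsTest ψ) :
    ∫ s in Ioi (0 : ℝ), s ^ (halfDim n a - 1) *
      ∫ z, gauss s 0 z * euclDot (euclGrad ψ z) z ∂halfMeasure n a =
      -2 * (gaussMass n a * ψ 0) := by
  have ha : -1 < a := h'.out
  have hφ := h.memLp_hardyWeight_mul (a := a)
  have hint : IntegrableOn (fun s : ℝ => s ^ (halfDim n a - 1) *
      ∫ z, gauss s 0 z * euclDot (euclGrad ψ z) z ∂halfMeasure n a) (Ioi 0) := by
    have := (h.integrable_prod_gauss_mul_grad hb (a := a)).integral_prod_right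
    refine this.congr (ae_of_all _ fun s => ?_)
    simp only
    rw [integral_const_mul]
  have h0 := tendsto_rpow_mul_integral_gauss_zero ha hb hφ 0
  have key := integral_Ioi_of_hasDerivAt_of_tendsto (a := 0)
    (f := fun s : ℝ => s ^ halfDim n a * ∫ z, ψ z * gauss s 0 z ∂halfMeasure n a)
    (f' := fun s : ℝ => -(1 / 2) * (s ^ (halfDim n a - 1) *
      ∫ z, gauss s 0 z * euclDot (euclGrad ψ z) z ∂halfMeasure n a))
    (by
      rw [← continuousWithinAt_Ioi_iff_Ici, ContinuousWithinAt,
        Real.zero_rpow (by linarith), zero_mul]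
      exact h0)
    (fun s hs => by
      refine (hasDerivAt_rpow_mul_integral_gauss ha hφ hs 0).congr_deriv ?_
      rw [← h.integral_gauss_mul_grad s 0]
      simp only [Prod.mk_zero_zero, sub_zero]
      ring)
    (hint.const_mul _) h.tendsto_rpow_mul_integral_gauss_atTop
  rw [integral_const_mul, Real.zero_rpow (by linarith), zero_mul, sub_zero] at key
  linarith

/-- Γ(β) = (β - 1) Γ(β - 1) puts the gradient in the form of a Gamma integral of s^(β-1)
exp(-s|z|²). -/
lemma euclDot_euclGrad_fundKernel (ha : -1 < a) (hb : 1 < halfDim n a) {z : Pt n}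
    (hz : 0 < normSq z) (w : Pt n) :
    euclDot (euclGrad (fundKernel n a) z) w = -(2 * gaussMass n a)⁻¹ *
      (Real.Gamma (halfDim n a) * normSq z ^ (-halfDim n a)) * euclDot z w := by
  have hK := gaussMass_pos (n := n) ha
  have hd := ((differentiable_normSq z).hasFDerivAt.rpow_const (p := -(halfDim n a - 1))
    (Or.inl hz.ne')).const_mul (Real.Gamma (halfDim n a - 1) / (4 * gaussMass n a))
  have hd' : HasFDerivAt (fundKernel n a) _ z := hd
  rw [euclDot_euclGrad hd'.differentiableAt, hd'.fderiv]
  have hG : Real.Gamma (halfDim n a) = (halfDim n a - 1) * Real.Gamma (halfDim n a - 1) := by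
    rw [← Real.Gamma_add_one (by linarith)]; ring_nf
  simp only [smul_apply, smul_eq_mul, fderiv_normSq]
  rw [hG, show -(halfDim n a - 1) - 1 = -halfDim n a by ring]
  field_simp
  ring

/-- `div(y^a ∇ fundKernel) = -δ` in the half space, with the Neumann condition on `{y = 0}`. -/
lemma IsTest.integral_grad_fundKernel [h' : Fact (-1 < a)] (hb : 1 < halfDim n a)
    {ψ : Pt n → ℝ} (h : IsTest ψ) :
    Integrable (fun z => euclDot (euclGrad (fundKernel n a) z) (euclGrad ψ z))
      (halfMeasure n a) ∧
    ∫ z, euclDot (euclGrad (fundKernel n a) z) (euclGrad ψ z) ∂halfMeasure n a = ψ 0 := by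
  have ha : -1 < a := h'.out
  have hK := gaussMass_pos (n := n) ha
  have hp := h.integrable_prod_gauss_mul_grad hb (a := a)
  have hae : ∀ᵐ z ∂halfMeasure n a, -(2 * gaussMass n a)⁻¹ *
      ∫ s in Ioi (0 : ℝ), s ^ (halfDim n a - 1) * (gauss s 0 z * euclDot (euclGrad ψ z) z) =
      euclDot (euclGrad (fundKernel n a) z) (euclGrad ψ z) := by
    filter_upwards [ae_pos_halfMeasure n a] with z hz
    have hz' : 0 < normSq z := by unfold normSq; positivity
    rw [euclDot_euclGrad_fundKernel ha hb hz', euclDot_comm z, mul_assoc]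
    congr 1
    have e : ∀ s : ℝ, s ^ (halfDim n a - 1) * (gauss s 0 z * euclDot (euclGrad ψ z) z) =
        s ^ (halfDim n a - 1) * Real.exp (-(normSq z * s)) * euclDot (euclGrad ψ z) z := by
      intro s
      rw [gauss]; simp only [Prod.mk_zero_zero, sub_zero]; ring_nf
    simp_rw [e]
    rw [integral_mul_const, Real.integral_rpow_mul_exp_neg_mul_Ioi (by linarith) hz', one_div,
      Real.inv_rpow hz'.le, Real.rpow_neg hz'.le]
    ring
  refine ⟨(hp.integral_prod_left.const_mul _).congr hae, ?_⟩
  rw [← integral_congr_ae hae, integral_const_mul,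
    integral_integral_swap (f := fun z (s : ℝ) => s ^ (halfDim n a - 1) *
      (gauss s 0 z * euclDot (euclGrad ψ z) z)) hp]
  simp_rw [integral_const_mul]
  rw [h.integral_rpow_mul_integral_gauss_mul_grad hb]
  field_simp

/-! ### The constant μ and reflection to the whole space -/

lemma one_lt_halfDim (hn : 2 ≤ n) (ha : -1 < a) : 1 < halfDim n a := by
  have : (2 : ℝ) ≤ n := by exact_mod_cast hn
  unfold halfDim; linarith

/-- The constant `μ` with `div(|y|^a ∇h) = -μ δ`. -/
def fundConst (n : ℕ) (a : ℝ) : ℝ :=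
  8 * nuConst (n + 1 + a) * gaussMass n a / Real.Gamma (halfDim n a - 1)

lemma fundConst_pos (ha : -1 < a) (hb : 1 < halfDim n a) : 0 < fundConst n a := by
  have h1 := gaussMass_pos (n := n) ha
  have h2 := Real.Gamma_pos_of_pos (s := halfDim n a - 1) (by linarith)
  have h3 : 0 < nuConst (n + 1 + a) := by
    have h4 := Real.Gamma_pos_of_pos (s := ((n : ℝ) + 1 + a - 1) / 2) (by
      unfold halfDim at hb; linarith)
    have := Real.pi_pos
    unfold nuConst; positivity
  unfold fundConst; positivity

lemma hFun_eq (ha : -1 < a) (hb : 1 < halfDim n a) :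
    hFun n a = fun z => fundConst n a / 2 * fundKernel n a z := by
  funext z
  have h1 := gaussMass_pos (n := n) ha
  have h2 := Real.Gamma_pos_of_pos (s := halfDim n a - 1) (by linarith)
  have e : ((n : ℝ) - 1 + a) / 2 = halfDim n a - 1 := by unfold halfDim; ring
  change nuConst (n + 1 + a) / normSq z ^ (((n : ℝ) - 1 + a) / 2) = _
  rw [e, fundConst, fundKernel, Real.rpow_neg (normSq_nonneg z)]
  field_simp
  ring

lemma differentiableAt_fundKernel {z : Pt n} (hz : 0 < normSq z) :
    DifferentiableAt ℝ (fundKernel n a) z :=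
  ((differentiable_normSq z).rpow_const (Or.inl hz.ne')).const_mul _

lemma euclDot_euclGrad_hFun (ha : -1 < a) (hb : 1 < halfDim n a) {z : Pt n} (hz : 0 < normSq z)
    (w : Pt n) : euclDot (euclGrad (hFun n a) z) w =
      fundConst n a / 2 * euclDot (euclGrad (fundKernel n a) z) w := by
  have hd := differentiableAt_fundKernel (a := a) hz
  rw [hFun_eq ha hb, euclDot_euclGrad (hd.const_mul _), fderiv_const_mul hd, euclDot_euclGrad hd]
  simp

lemma integrable_halfMeasure_iff (f : Pt n → ℝ) :
    Integrable f (halfMeasure n a) ↔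
      IntegrableOn (fun z : Pt n => |z.2| ^ a * f z) {z | 0 < z.2} := by
  unfold halfMeasure
  rw [integrable_withDensity_iff_integrable_smul' (by fun_prop) (by simp)]
  refine integrableOn_congr_fun (fun z hz => ?_) (measurableSet_lt measurable_const measurable_snd)
  have hz : 0 < z.2 := hz
  simp [ENNReal.toReal_ofReal (Real.rpow_nonneg hz.le a), abs_of_pos hz]

lemma integral_halfMeasure (f : Pt n → ℝ) :
    ∫ z, f z ∂halfMeasure n a = ∫ z in {z : Pt n | 0 < z.2}, |z.2| ^ a * f z := by
  unfold halfMeasure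
  rw [integral_withDensity_eq_integral_toReal_smul (by fun_prop) (by simp)]
  refine setIntegral_congr_fun (measurableSet_lt measurable_const measurable_snd) fun z hz => ?_
  have hz : 0 < z.2 := hz
  simp [ENNReal.toReal_ofReal (Real.rpow_nonneg hz.le a), abs_of_pos hz]

/-- The reflection `(x, y) ↦ (x, -y)`. -/
def reflect (n : ℕ) : Pt n ≃L[ℝ] Pt n :=
  (ContinuousLinearEquiv.refl ℝ _).prodCongr (ContinuousLinearEquiv.neg ℝ)

lemma reflect_apply (z : Pt n) : reflect n z = (z.1, -z.2) := rfl

lemma measurePreserving_reflect : MeasurePreserving (reflect n) (volume : Measure (Pt n)) volume :=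
  (MeasurePreserving.id volume).prod (Measure.measurePreserving_neg volume)

lemma euclGrad_comp_reflect (f : Pt n → ℝ) (z : Pt n) :
    euclGrad (fun z => f (reflect n z)) z = reflect n (euclGrad f (reflect n z)) := by
  simp only [euclGrad, reflect_apply]
  ext1
  · rfl
  · exact deriv_comp_neg (fun y => f (z.1, y)) z.2

lemma euclDot_reflect (z w : Pt n) : euclDot (reflect n z) (reflect n w) = euclDot z w := by
  simp [euclDot, reflect_apply]

lemma IsTest.comp_reflect {ψ : Pt n → ℝ} (h : IsTest ψ) : IsTest fun z => ψ (reflect n z) :=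
  ⟨h.1.comp (reflect n).contDiff, h.2.comp_homeomorph (reflect n).toHomeomorph⟩

/-- Since h is even in y, the lower half space contributes the upper integral of the reflected test
function, which has the same value at 0. Each half gives (μ/2) ψ(0). -/
lemma isFundamentalConst_fundConst (ha : -1 < a) (hb : 1 < halfDim n a) :
    IsFundamentalConst n a (fundConst n a) := by
  intro ψ hψ
  have : Fact (-1 < a) := ⟨ha⟩
  let G : (Pt n → ℝ) → Pt n → ℝ := fun χ z =>
    |z.2| ^ a * euclDot (euclGrad (hFun n a) z) (euclGrad χ z)
  have hhalf : ∀ χ : Pt n → ℝ, IsTest χ → IntegrableOn (G χ) {z | 0 < z.2} ∧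
      ∫ z in {z : Pt n | 0 < z.2}, G χ z = fundConst n a / 2 * χ 0 := by
    intro χ hχ
    have h := hχ.integral_grad_fundKernel (a := a) hb
    have hae : ∀ᵐ z ∂halfMeasure n a,
        fundConst n a / 2 * euclDot (euclGrad (fundKernel n a) z) (euclGrad χ z) =
          euclDot (euclGrad (hFun n a) z) (euclGrad χ z) := by
      filter_upwards [ae_pos_halfMeasure n a] with z hz
      exact (euclDot_euclGrad_hFun ha hb (by unfold normSq; positivity) _).symm
    refine ⟨(integrable_halfMeasure_iff _).1 ((h.1.const_mul _).congr hae), ?_⟩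
    rw [← integral_halfMeasure, ← integral_congr_ae hae, integral_const_mul, h.2]
  have hrefl : ∀ z, G ψ (reflect n z) = G (fun z => ψ (reflect n z)) z := by
    intro z
    have hh : (fun z => hFun n a (reflect n z)) = hFun n a := by
      funext z; simp [hFun, reflect_apply]
    have h1 := euclGrad_comp_reflect (hFun n a) z
    rw [hh] at h1
    simp only [G]
    rw [euclGrad_comp_reflect ψ z, h1, euclDot_reflect]
    simp [reflect_apply]
  have hpre : (reflect n) ⁻¹' {z : Pt n | z.2 < 0} = {z | 0 < z.2} := by
    ext z; simp [reflect_apply]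
  have hemb : MeasurableEmbedding (reflect n) := (reflect n).toHomeomorph.measurableEmbedding
  obtain ⟨hi1, h1⟩ := hhalf ψ hψ
  obtain ⟨hi2, h2⟩ := hhalf _ hψ.comp_reflect
  have hi3 : IntegrableOn (G ψ) {z | z.2 < 0} := by
    rw [← measurePreserving_reflect.integrableOn_comp_preimage hemb, hpre]
    exact hi2.congr_fun (fun z _ => (hrefl z).symm)
      (measurableSet_lt measurable_const measurable_snd)
  have h3 : ∫ z in {z : Pt n | z.2 < 0}, G ψ z = fundConst n a / 2 * ψ 0 := by
    rw [← measurePreserving_reflect.setIntegral_preimage_emb hemb, hpre]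
    simp_rw [hrefl]
    rw [h2]; simp
  have hu : ({z : Pt n | 0 < z.2} ∪ {z | z.2 < 0} : Set (Pt n)) =ᵐ[volume] univ := by
    have h0 : ∀ᵐ z : Pt n, z.2 ≠ 0 := by
      have : Measure.QuasiMeasurePreserving (Prod.snd : Pt n → ℝ) volume volume :=
        Measure.quasiMeasurePreserving_snd
      exact this.ae (Measure.ae_ne volume 0)
    filter_upwards [h0] with z hz
    exact propext ⟨fun _ => trivial, fun _ => hz.lt_or_gt.symm⟩
  change ∫ z, G ψ z = _
  rw [← setIntegral_univ, ← setIntegral_congr_set hu, setIntegral_union _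
    (measurableSet_lt measurable_snd measurable_const) hi1 hi3, h1, h3]
  · ring
  · rw [disjoint_left]
    intro z (hz : 0 < z.2) (hz' : z.2 < 0)
    exact lt_asymm hz hz'

/-! ### Capacitary potentials -/

/-- A capacitary potential is the potential of a measure whose total mass is the capacity. -/
theorem IsCapacitaryPotential.exists_ae_eq_potential (ha : -1 < a) (hb : 1 < halfDim n a)
    {A K : Set (EuclideanSpace ℝ (Fin n))} {φ : Pt n → ℝ} (h : IsCapacitaryPotential a A φ)
    (hK : IsCompact K) (hAK : A ⊆ K) :
    ∃ m : Measure K, IsFiniteMeasure m ∧ m univ = sCap a A ∧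
      potential a m =ᵐ[halfMeasure n a] φ := by
  have : Fact (-1 < a) := ⟨ha⟩
  obtain ⟨g, hg, hE⟩ := h
  obtain ⟨m, hm, hmass, hmL⟩ := hg.exists_measure hE hK hAK
  have hlim := hg.isTestLimit
  have hφ := hlim.memLp_hardyWeight_mul hb
  refine ⟨m, hm, hmass, ?_⟩
  have hw := ae_eq_zero_of_forall_integral_gauss (a := a) (w := fun z => potential a m z - φ z)
    (fun t ht x => by
      simp only [sub_mul]
      exact (integral_potential_mul_gauss ha hb m ht x).1.sub (integrable_mul_gauss ha hφ ht x))
    (fun t ht x => by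
      simp only [sub_mul]
      rw [integral_sub (integral_potential_mul_gauss ha hb m ht x).1
        (integrable_mul_gauss ha hφ ht x), (integral_potential_mul_gauss ha hb m ht x).2,
        ← hlim.rpow_mul_integral_gauss hb hmL ht x, ← mul_assoc, ← Real.rpow_add ht,
        neg_add_cancel, Real.rpow_zero, one_mul, sub_self])
  filter_upwards [hw] with z hz
  exact sub_eq_zero.1 hz

/-! ### Asymptotics of potentials far from the support -/

lemma exists_rpow_neg_close (q : ℝ) {δ : ℝ} (hδ : 0 < δ) :
    ∃ τ : ℝ, 0 < τ ∧ τ < 1 ∧ (1 - τ) ^ (-q) ≤ 1 + δ ∧ 1 - δ ≤ (1 + τ) ^ (-q) := by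
  have h1 : ContinuousAt (fun τ : ℝ => (1 - τ) ^ (-q)) 0 :=
    ContinuousAt.rpow_const (by fun_prop) (Or.inl (by simp))
  have h2 : ContinuousAt (fun τ : ℝ => (1 + τ) ^ (-q)) 0 :=
    ContinuousAt.rpow_const (by fun_prop) (Or.inl (by simp))
  have h3 : ∀ᶠ τ in 𝓝 (0 : ℝ), (1 - τ) ^ (-q) < 1 + δ :=
    h1.eventually_lt_const (by simpa using hδ)
  have h4 : ∀ᶠ τ in 𝓝 (0 : ℝ), 1 - δ < (1 + τ) ^ (-q) :=
    h2.eventually_const_lt (by simpa using hδ)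
  have h5 : ∀ᶠ τ in 𝓝[>] (0 : ℝ), τ ∈ Ioo (0 : ℝ) 1 := Ioo_mem_nhdsGT zero_lt_one
  obtain ⟨τ, ⟨ha, hb⟩, hc⟩ := (((h3.and h4).filter_mono nhdsWithin_le_nhds).and h5).exists
  exact ⟨τ, hc.1, hc.2, ha.le, hb.le⟩

lemma fundKernel_eq_rpow_euclNorm (z : Pt n) :
    fundKernel n a z = Real.Gamma (halfDim n a - 1) / (4 * gaussMass n a) *
      euclNorm z ^ (-(2 * (halfDim n a - 1))) := by
  rw [fundKernel, ← euclNorm_sq, ← Real.rpow_natCast, ← Real.rpow_mul (euclNorm_nonneg z)]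
  push_cast
  ring_nf

/-- The fundamental solution varies little on balls that are small compared with the distance. -/
lemma abs_fundKernel_sub_le (ha : -1 < a) (hb : 1 < halfDim n a) {δ τ : ℝ} (hτ0 : 0 < τ)
    (hτ1 : τ < 1) (h1 : (1 - τ) ^ (-(2 * (halfDim n a - 1))) ≤ 1 + δ)
    (h2 : 1 - δ ≤ (1 + τ) ^ (-(2 * (halfDim n a - 1)))) {w v : Pt n} (hw : 0 < euclNorm w)
    (hv : (1 - τ) * euclNorm w ≤ euclNorm v) (hv' : euclNorm v ≤ (1 + τ) * euclNorm w) :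
    |fundKernel n a v - fundKernel n a w| ≤ δ * fundKernel n a w := by
  have hK := gaussMass_pos (n := n) ha
  have hG := Real.Gamma_pos_of_pos (s := halfDim n a - 1) (by linarith)
  rw [fundKernel_eq_rpow_euclNorm, fundKernel_eq_rpow_euclNorm]
  set c := Real.Gamma (halfDim n a - 1) / (4 * gaussMass n a) with hc
  have hc0 : 0 < c := by positivity
  set q := -(2 * (halfDim n a - 1)) with hq
  have hq0 : q ≤ 0 := by rw [hq]; linarith
  have hlow : 0 < (1 - τ) * euclNorm w := mul_pos (by linarith) hw
  have hwq : 0 < euclNorm w ^ q := Real.rpow_pos_of_pos hw _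
  have hu : euclNorm v ^ q ≤ (1 + δ) * euclNorm w ^ q := by
    refine (Real.rpow_le_rpow_of_nonpos hlow hv hq0).trans ?_
    rw [Real.mul_rpow (by linarith) hw.le]
    gcongr
  have hl : (1 - δ) * euclNorm w ^ q ≤ euclNorm v ^ q := by
    refine le_trans ?_ (Real.rpow_le_rpow_of_nonpos (hlow.trans_le hv) hv' hq0)
    rw [Real.mul_rpow (by linarith) hw.le]
    gcongr
  rw [abs_le]
  constructor <;> nlinarith

lemma euclNorm_sub_mk_bounds (z : Pt n) {c x : EuclideanSpace ℝ (Fin n)} {ρ : ℝ}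
    (hx : x ∈ Metric.closedBall c ρ) :
    euclNorm (z - (c, 0)) - ρ ≤ euclNorm (z - (x, 0)) ∧
      euclNorm (z - (x, 0)) ≤ euclNorm (z - (c, 0)) + ρ := by
  have hn : ∀ v : EuclideanSpace ℝ (Fin n), euclNorm ((v, 0) : Pt n) = ‖v‖ := fun v => by
    simp [euclNorm, Real.sqrt_sq (norm_nonneg v)]
  have h1 := euclNorm_add_le (z - (x, 0)) (x - c, 0)
  have h2 := euclNorm_add_le (z - (c, 0)) (c - x, 0)
  rw [hn] at h1 h2
  have e1 : z - (x, 0) + (x - c, 0) = z - (c, 0) := by ext <;> simp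
  have e2 : z - (c, 0) + (c - x, 0) = z - (x, 0) := by ext <;> simp
  rw [e1] at h1
  rw [e2, norm_sub_rev] at h2
  rw [Metric.mem_closedBall, dist_eq_norm] at hx
  constructor <;> linarith

/-- Dominated convergence: at a fixed distance from the support the kernel is bounded by a constant,
integrable for the finite measure. -/
lemma continuousOn_potential (ha : -1 < a) (hb : 1 < halfDim n a)
    {K : Set (EuclideanSpace ℝ (Fin n))} (m : Measure K) [IsFiniteMeasure m] {s : Set (Pt n)}
    {r : ℝ} (hr : 0 < r)
    (hs : ∀ z ∈ s, ∀ x ∈ K, r ≤ normSq (z - ((x : EuclideanSpace ℝ (Fin n)), 0))) :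
    ContinuousOn (potential a m) s := by
  have h1 := gaussMass_pos (n := n) ha
  have h2 := Real.Gamma_pos_of_pos (s := halfDim n a - 1) (by linarith)
  refine continuousOn_of_dominated (bound := fun _ =>
    Real.Gamma (halfDim n a - 1) / (4 * gaussMass n a) * r ^ (-(halfDim n a - 1)))
    (fun z hz => (integrable_fundKernel_sub ha hb m hr fun x => hs z hz x x.2).1)
    (fun z hz => ae_of_all _ fun x => ?_) (integrable_const _) (ae_of_all _ fun x => ?_)
  · rw [Real.norm_of_nonneg (fundKernel_nonneg ha hb _), fundKernel]
    refine mul_le_mul_of_nonneg_left ?_ (by positivity)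
    exact Real.rpow_le_rpow_of_nonpos hr (hs z hz x x.2) (by linarith)
  · intro z hz
    have hd : DifferentiableAt ℝ (fundKernel n a) (z - (x.1, 0)) :=
      differentiableAt_fundKernel (hr.trans_le (hs z hz x x.2))
    exact (ContinuousAt.comp (f := fun z : Pt n => z - (x.1, 0)) hd.continuousAt
      (by fun_prop)).continuousWithinAt

lemma abs_potential_sub_le (ha : -1 < a) (hb : 1 < halfDim n a)
    {K : Set (EuclideanSpace ℝ (Fin n))} (m : Measure K) [IsFiniteMeasure m] {z w : Pt n}
    {r δ : ℝ} (hr : 0 < r)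
    (hz : ∀ x ∈ K, r ≤ normSq (z - ((x : EuclideanSpace ℝ (Fin n)), 0)))
    (h : ∀ x ∈ K, |fundKernel n a (z - (x, 0)) - fundKernel n a w| ≤ δ * fundKernel n a w) :
    |potential a m z - m.real univ * fundKernel n a w| ≤
      δ * (m.real univ * fundKernel n a w) := by
  have hi := integrable_fundKernel_sub ha hb m hr fun x => hz x x.2
  have e : potential a m z - m.real univ * fundKernel n a w =
      ∫ x : K, (fundKernel n a (z - (x.1, 0)) - fundKernel n a w) ∂m := by
    rw [integral_sub hi (integrable_const _), integral_const, smul_eq_mul, potential]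
  rw [e]
  have hbd : ‖∫ x : K, (fundKernel n a (z - (x.1, 0)) - fundKernel n a w) ∂m‖ ≤
      δ * fundKernel n a w * m.real univ :=
    norm_integral_le_of_norm_le_const (ae_of_all _ fun x : K => h x.1 x.2)
  exact hbd.trans (le_of_eq (by ring))

end FracCap
end

theorem mainTheorem7 (n : ℕ) (hn : 2 ≤ n) (a : ℝ) (ha : -1 < a) (ha' : a < 1) :
    ∃ μ : ℝ, 0 < μ ∧ FracCap.IsFundamentalConst n a μ ∧
      ∀ M : ℝ, 0 < M → ∀ δ : ℝ, 0 < δ → ∃ R : ℝ, 0 < R ∧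
        ∀ (Ω : Type*) [MeasurableSpace Ω] (P : Measure Ω) [IsProbabilityMeasure P]
          (S : ℝ → (Fin n → ℤ) → Ω → Set (EuclideanSpace ℝ (Fin n)))
          (γ : (Fin n → ℤ) → Ω → ℝ≥0),
          (∀ ε : ℝ, 0 < ε → ∀ k ω,
            FracCap.sCap a (S ε k ω) = ENNReal.ofReal (ε ^ n * (γ k ω : ℝ))) →
          (∀ᵐ ω ∂P, ∀ ε : ℝ, 0 < ε → ∀ k, S ε k ω ⊆
            Metric.closedBall (FracCap.latticePt ε k) (M * FracCap.critSize n a ε)) →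
          ∀ᵐ ω ∂P, ∀ ε : ℝ, 0 < ε → ∀ k, ∀ φ : FracCap.Pt n → ℝ,
            FracCap.IsCapacitaryPotential a (S ε k ω) φ →
            ∃ φ' : FracCap.Pt n → ℝ, φ' =ᵐ[FracCap.halfMeasure n a] φ ∧
              ContinuousOn φ'
                (FracCap.farRegion (FracCap.latticePt ε k) (R * FracCap.critSize n a ε)) ∧
              ∀ z ∈ FracCap.farRegion (FracCap.latticePt ε k) (R * FracCap.critSize n a ε),
                |φ' z - ε ^ n * (γ k ω : ℝ) * (2 / μ) *
                    FracCap.hFun n a (z - (FracCap.latticePt ε k, 0))| ≤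
                  δ * (ε ^ n * (γ k ω : ℝ) * (2 / μ) *
                    FracCap.hFun n a (z - (FracCap.latticePt ε k, 0))) := by
  have hb := FracCap.one_lt_halfDim hn ha
  have hμ := FracCap.fundConst_pos ha hb
  refine ⟨FracCap.fundConst n a, hμ, FracCap.isFundamentalConst_fundConst ha hb, ?_⟩
  intro M hM δ hδ
  obtain ⟨τ, hτ0, hτ1, h1, h2⟩ :=
    FracCap.exists_rpow_neg_close (2 * (FracCap.halfDim n a - 1)) hδ
  -- For a far point, moving the pole inside the ball of radius M critical sizes then changes its
  -- distance by at most the fraction τ. The number τ depends only on δ and on the exponent 2(β - 1)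
  -- = n - 1 + a.
  refine ⟨M / τ, by positivity, ?_⟩
  intro Ω _ P _ S γ hcap hsub
  filter_upwards [hsub] with ω hω ε hε k φ hφ
  set r := FracCap.critSize n a ε with hrdef
  have hr : 0 < r := Real.rpow_pos_of_pos hε _
  set c := FracCap.latticePt ε k with hc
  -- The representing measure sits on the compact ball rather than on `S ε k ω`, of which neither
  -- closedness nor measurability is known.
  obtain ⟨m, hm, hmass, hae⟩ := hφ.exists_ae_eq_potential ha hb
    (isCompact_closedBall c (M * r)) (hω ε hε k)
  have hκ : m.real univ = ε ^ n * (γ k ω : ℝ) := by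
    rw [Measure.real, hmass, hcap ε hε, ENNReal.toReal_ofReal (by positivity)]
  have hfar : ∀ z ∈ FracCap.farRegion c (M / τ * r), ∀ x ∈ Metric.closedBall c (M * r),
      0 < FracCap.euclNorm (z - (c, 0)) ∧
      (1 - τ) * FracCap.euclNorm (z - (c, 0)) ≤ FracCap.euclNorm (z - (x, 0)) ∧
      FracCap.euclNorm (z - (x, 0)) ≤ (1 + τ) * FracCap.euclNorm (z - (c, 0)) := by
    intro z hz x hx
    have hd := hz.2
    have hMr : M * r ≤ τ * FracCap.euclNorm (z - (c, 0)) := by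
      calc M * r = τ * (M / τ * r) := by field_simp
        _ ≤ _ := by gcongr
    obtain ⟨h3, h4⟩ := FracCap.euclNorm_sub_mk_bounds z hx
    exact ⟨lt_of_lt_of_le (by positivity) hd, by linarith, by linarith⟩
  have hlow : ∀ z ∈ FracCap.farRegion c (M / τ * r), ∀ x ∈ Metric.closedBall c (M * r),
      ((1 - τ) * (M / τ * r)) ^ 2 ≤ FracCap.normSq (z - (x, 0)) := by
    intro z hz x hx
    have h1τ : 0 < 1 - τ := by linarith
    rw [← FracCap.euclNorm_sq]
    refine pow_le_pow_left₀ (by positivity) (le_trans ?_ (hfar z hz x hx).2.1) 2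
    exact mul_le_mul_of_nonneg_left hz.2 h1τ.le
  have hpos : 0 < ((1 - τ) * (M / τ * r)) ^ 2 := by
    have h1τ : 0 < 1 - τ := by linarith
    positivity
  refine ⟨FracCap.potential a m, hae, FracCap.continuousOn_potential ha hb m hpos hlow, ?_⟩
  intro z hz
  have key := FracCap.abs_potential_sub_le ha hb m (w := z - (c, 0)) (δ := δ) hpos (hlow z hz)
    fun x hx => by
      obtain ⟨h3, h4, h5⟩ := hfar z hz x hx
      exact FracCap.abs_fundKernel_sub_le ha hb hτ0 hτ1 h1 h2 h3 h4 h5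
  have e : ε ^ n * (γ k ω : ℝ) * (2 / FracCap.fundConst n a) * FracCap.hFun n a (z - (c, 0)) =
      m.real univ * FracCap.fundKernel n a (z - (c, 0)) := by
    rw [hκ, FracCap.hFun_eq ha hb]
    field_simp
  rw [e]
  exact key
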